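/- Let $f:(\mathbb C^d,0)\to(\mathbb C^d,0)$ be a holomorphic germ which is contracting (every eigenvalue of $df_0$ has modulus $<1$) and rigid, i.e. its generalized critical set $\mathcal C^\infty(f)=\bigcup_{n\ge 0}f^{-n}(\{\det df=0\})$ is, near $0$, a (possibly empty) simple normal crossing hypersurface: $\mathcal C^\infty(f)=W^1\cup\dots\cup W^q$ with $W^k=\{u^k=0\}$, where $u^1,\dots,u^q$ are holomorphic, vanish at $0$, and have linearly independent differentials at $0$. Let $A=A(f)=(a_l^k)\in\mathcal M_{q\times q}(\mathbb N)$ be the internal action, defined by $f^*W^k=\sum_l a_l^k W^l$ (that is, $a_l^k$ is the order of vanishing of $u^k\circ f$ along $W^l$). Assume that - $A$ is injective; - every periodic component is fixed: if $(f^*)^\eta W^k=W^k$ for some $\eta\ge1$, then $f^*W^k=W^k$; - the nilpotent part of $df_0$ vanishes, i.e. $df_0$ is zero on its generalized eigenspace for the eigenvalue $0$. Let $\lambda=(\lambda^1,\dots,\lambda^s)$ be the non-zero eigenvalues of $df_0$, counted with multiplicity and suitably ordered. Then there are $p,m\ge 0$ with $s+p+m=d$ such that $f$ is conjugated, by a germ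 of biholomorphism $\Phi:(\mathbb C^d,0)\to(\mathbb C^s\times\mathbb C^p\times\mathbb C^m,0)$, to a map of the form $$(x,y,z)\mapsto\big(\sigma_{\rm PD}(x),\ \beta\,x^E y^D(1+g(x)),\ h(x,y,z)\big),$$ where the middle component has entries $\beta^k\prod_l (x^l)^{e_l^k}\prod_l (y^l)^{d_l^k}\,(1+g^k(x))$, $k=1,\dots,p$, and - $\beta\in(\mathbb C^*)^p$, $E=(e_l^k)\in\mathcal M_{s\times p}(\mathbb N)$, and $D=(d_l^k)\in\mathcal M_{p\times p}(\mathbb N)$ with $\det D\ne0$; - $\sigma_{\rm PD}:(\mathbb C^s,0)\to(\mathbb C^s,0)$ is a contracting invertible polynomial germ in Poincaré–Dulac normal form: its linear part is lower triangular with diagonal $\lambda$, and every monomial $x^n$ occurring in its $k$-th component satisfies $\lambda^n=\lambda^k$; moreover the differential at $0$ of the normal form is $d(\sigma_{\rm PD})_0\oplus0$; - in the coordinates $(x,y,z)=\Phi$, one has near $0$ that $\{\prod_k y^k=0\}\subseteq\mathcal C^\infty(f)\subseteq\{\prod_l x^l\prod_k y^k=0\}$; - $g:(\mathbb C^s,0)\to(\mathbb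 C^p,0)$ is a polynomial map containing only secondary resonant monomials, i.e. monomials $x^n$ with $|n|\ge1$ such that $\lambda^n$ is an eigenvalue of $A$; - $h:(\mathbb C^d,0)\to(\mathbb C^{m},0)$ is holomorphic with $dh_0=0$. -/

import Mathlib

open Filter Topology

/-- `Cn n` is the complex vector space `ℂⁿ`. -/
abbrev Cn (n : ℕ) : Type := Fin n → ℂ

/-- The generalized critical set `⋃ₙ f⁻ⁿ(Crit f)`, where `Crit f = {det df = 0}`.
If `f` is a contracting germ at `0`, small balls (for an adapted norm) are mapped into themselves,
so the germ of this set at `0` depends only on the germ of `f`. -/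
def genCrit {d : ℕ} (f : Cn d → Cn d) : Set (Cn d) :=
  {x | ∃ n : ℕ, (fderiv ℂ f (f^[n] x)).det = 0}

/-- `f` is (a representative of) a holomorphic germ `(ℂᵈ,0) → (ℂᵈ,0)` that is contracting:
every eigenvalue of `df₀` has modulus `< 1`. -/
structure IsContractingGerm {d : ℕ} (f : Cn d → Cn d) : Prop where
  analytic : AnalyticAt ℂ f 0
  map_zero : f 0 = 0
  eigenvalue_lt : ∀ μ : ℂ,
    Module.End.HasEigenvalue (fderiv ℂ f 0 : Cn d →ₗ[ℂ] Cn d) μ → ‖μ‖ < 1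

/-- Near `0`, the set `C` is a simple normal crossing hypersurface with the `q` irreducible
components `{u k = 0}`: the `u k` vanish at `0`, are holomorphic with linearly independent
differentials at `0` (so they are part of a system of local coordinates), and
`C = {∏ₖ u k = 0}`. The case `q = 0` (empty `C`) is allowed. -/
structure IsSNC {d q : ℕ} (C : Set (Cn d)) (u : Fin q → Cn d → ℂ) : Prop where
  analytic : ∀ k, AnalyticAt ℂ (u k) 0
  map_zero : ∀ k, u k 0 = 0
  independent : LinearIndependent ℂ (fun k => fderiv ℂ (u k) 0)
  locus : ∀ᶠ x in 𝓝 (0 : Cn d), x ∈ C ↔ ∃ k, u k x = 0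

/-- The multiplicity of the hypersurface germ `{u = 0}` in the divisor of the germ `g`:
the largest `m` such that `u ^ m` divides `g` in the ring of holomorphic germs at `0`.
(The set is bounded as soon as `u 0 = 0` and `g` is not the zero germ.) -/
noncomputable def ordAlong {d : ℕ} (u g : Cn d → ℂ) : ℕ :=
  sSup {m : ℕ | ∃ v : Cn d → ℂ, AnalyticAt ℂ v 0 ∧ ∀ᶠ x in 𝓝 (0 : Cn d), g x = u x ^ m * v x}

/-- The internal action: the matrix `A = (a l k)` with `f^* W^k = ∑ l, a l k • W^l`, where
`W^k = {u k = 0}`. -/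
noncomputable def internalAction {d q : ℕ} (f : Cn d → Cn d) (u : Fin q → Cn d → ℂ) :
    Matrix (Fin q) (Fin q) ℕ :=
  Matrix.of fun l k => ordAlong (u l) (u k ∘ f)

/-- The matrix `A` is injective (as an endomorphism of `ℤ^q`). -/
def IsInjectiveAction {q : ℕ} (A : Matrix (Fin q) (Fin q) ℕ) : Prop :=
  Function.Injective (A.map (Nat.cast : ℕ → ℤ)).mulVec

/-- Every periodic component is fixed: if `(f^*)^η W^k = W^k` for some `η ≥ 1`,
then `f^* W^k = W^k`. -/
def PeriodicComponentsFixed {q : ℕ} (A : Matrix (Fin q) (Fin q) ℕ) : Prop :=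
  ∀ k : Fin q, (∃ η : ℕ, 1 ≤ η ∧ (A ^ η).mulVec (Pi.single k 1) = Pi.single k 1) →
    A.mulVec (Pi.single k 1) = Pi.single k 1

/-- The nilpotent part of `T`, i.e. the restriction of `T` to the generalized eigenspace of the
eigenvalue `0`, vanishes. -/
def NilpotentPartVanishes {d : ℕ} (T : Cn d →L[ℂ] Cn d) : Prop :=
  ∀ v ∈ Module.End.maxGenEigenspace (T : Cn d →ₗ[ℂ] Cn d) 0, T v = 0

/-- `Φ` is (a representative of) a germ of biholomorphism fixing the origin. -/
structure IsLocalBiholomorphism {E F : Type*} [NormedAddCommGroup E] [NormedSpace ℂ E]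
    [NormedAddCommGroup F] [NormedSpace ℂ F] (Φ : E → F) : Prop where
  analytic : AnalyticAt ℂ Φ 0
  map_zero : Φ 0 = 0
  invertible : ∃ L : E ≃L[ℂ] F, HasFDerivAt Φ (L : E →L[ℂ] F) 0

/-- The monomial `λ^n = ∏ k, (λ k) ^ (n k)`. -/
def powMonomial {s : ℕ} (lam : Cn s) (n : Fin s →₀ ℕ) : ℂ := ∏ k, lam k ^ n k

/-- `(x^E)^k = ∏ l, (x l) ^ (E l k)`. -/
def matPow {s p : ℕ} (x : Cn s) (E : Matrix (Fin s) (Fin p) ℕ) : Cn p :=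
  fun k => ∏ l, x l ^ E l k

/-- The polynomial map with components `P k`. -/
noncomputable def polyMap {s p : ℕ} (P : Fin p → MvPolynomial (Fin s) ℂ) : Cn s → Cn p :=
  fun x k => MvPolynomial.eval x (P k)

/-- `σ` is a contracting invertible polynomial germ of `(ℂˢ,0)` in Poincaré–Dulac normal form:
its linear part is lower triangular with diagonal `λ`, `0 < |λ k| < 1`, and its `k`-th component
contains only resonant monomials `x^n`, i.e. `λ^n = λ k`. -/
structure IsPoincareDulac {s : ℕ} (lam : Cn s) (σ : Fin s → MvPolynomial (Fin s) ℂ) : Prop where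
  eigenvalue_pos : ∀ k, 0 < ‖lam k‖
  eigenvalue_lt : ∀ k, ‖lam k‖ < 1
  map_zero : ∀ k, MvPolynomial.coeff 0 (σ k) = 0
  diagonal : ∀ k, MvPolynomial.coeff (Finsupp.single k 1) (σ k) = lam k
  triangular : ∀ k l, k < l → MvPolynomial.coeff (Finsupp.single l 1) (σ k) = 0
  resonant : ∀ k n, MvPolynomial.coeff n (σ k) ≠ 0 → powMonomial lam n = lam k

/-- The monomial `x^n`, `|n| ≥ 1`, is secondary resonant: `λ^n` is an eigenvalue of `A`. -/
def IsSecondaryResonant {s q : ℕ} (lam : Cn s) (A : Matrix (Fin q) (Fin q) ℕ)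
    (n : Fin s →₀ ℕ) : Prop :=
  n ≠ 0 ∧ Module.End.HasEigenvalue (Matrix.toLin' (A.map (Nat.cast : ℕ → ℂ))) (powMonomial lam n)

/-- The map `(x, y, z) ↦ (σ(x), β x^E y^D (1 + g(x)), h(x, y, z))`. -/
noncomputable def normalForm {s p m : ℕ} (σ : Fin s → MvPolynomial (Fin s) ℂ) (β : Cn p)
    (E : Matrix (Fin s) (Fin p) ℕ) (D : Matrix (Fin p) (Fin p) ℕ)
    (g : Fin p → MvPolynomial (Fin s) ℂ) (h : Cn s × Cn p × Cn m → Cn m) :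
    Cn s × Cn p × Cn m → Cn s × Cn p × Cn m :=
  fun w => (polyMap σ w.1,
    fun k => β k * matPow w.1 E k * matPow w.2.1 D k * (1 + polyMap g w.1 k),
    h w)

/-! Everything is read off from the linear operator `f^*` on functions holomorphic at the origin,
with equalities taken modulo `An.flat`, the functions whose germ is zero. In an adapted norm `f`
contracts by some `θ < 1`, so `f^*` shrinks functions vanishing to order `N` by `θ ^ N`, and `f^* -
μ` is bijective on their germs once `θ ^ N < ‖μ‖` (`IsLyapunov.exists_cohomological`,
`IsLyapunov.eventually_eq_zero`). Each problem below is therefore solved on finite jets, where `f^*`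
is annihilated by a polynomial, and the remainder is then removed by a convergent series.

Generalized eigencovectors of `df₀` for non-zero eigenvalues lift in this way to generalized
eigenfunctions `x` of `f^*` (`IsLyapunov.exists_lift`). As `f^*` is multiplicative, a monomial in
the `x` is a generalized eigenfunction for the product of the eigenvalues; hence a generalized
eigenfunction for `μ ≠ 0` is a polynomial in the monomials with `λ^n = μ`
(`IsAdapted.exists_sub_mem_flat`). Applied to `f^* x^k`, this is the Poincaré–Dulac form.

The generalized critical set is backward invariant, so `f^* u^k` vanishes only on the components and
is a monomial in the `u^l` times a unit (`IsSNC.exists_pullback_eq`). A fixed component becomes an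
eigenfunction after multiplication by a unit and is taken among the `x`. For the other components
the covector `du^k` is killed by the transpose of `df₀`: otherwise, in the absence of a nilpotent
part, its iterates never vanish, they run through multiples of the finitely many `du^l`, and
injectivity of `A` makes the component periodic, hence fixed
(`IsSNC.transpose_eq_zero_of_not_fixed`).

Replacing a non-fixed `u^k` by `y^k = u^k e^{φ^k}` changes the unit in `f^* u^k`. Taking logarithms,
the normal form amounts to `φ ∘ f - Dᵗ φ + ψ = log (1 + g(x))`. By Cramer's rule the range of `f^* -
Dᵗ` contains that of `χ_D(f^*)`, and modulo the latter only the monomials with `χ_D(λ^n) = 0`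
survive; these form `g` (`IsAdapted.exists_normalization`). Since `A` is block triangular, the
eigenvalues of `D` are eigenvalues of `A`, and `det D ≠ 0` excludes the eigenvalue `0`, for which
the equation could not be solved. The coordinates `z` are linear forms killed by the transpose of
`df₀`. -/

/-! ### Cauchy estimates and normally convergent series -/

open Metric in
-- One derivative is spent at a time: on the ball of radius `R * n / (n + 1)` there is still room `R
-- / (n + 1)` to apply the first-order Cauchy estimate. The bound is weaker than `n! / R ^ n`, but
-- after division by `n!` it is still geometric.
theorem norm_iteratedFDeriv_le_of_bounded {E F : Type} [NormedAddCommGroup E] [NormedSpace ℂ E]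
    (n : ℕ) [NormedAddCommGroup F] [NormedSpace ℂ F] [CompleteSpace F]
    {f : E → F} {c : E} {R M : ℝ} (hR : 0 < R) (hf : AnalyticOnNhd ℂ f (ball c R))
    (hM : ∀ x ∈ ball c R, ‖f x‖ ≤ M) :
    ‖iteratedFDeriv ℂ n f c‖ ≤ M * (2 * n / R) ^ n := by
  induction n generalizing F R M with
  | zero => simpa using hM c (mem_ball_self hR)
  | succ n ih =>
    have hn : (0 : ℝ) < n + 1 := by positivity
    rw [← norm_iteratedFDeriv_fderiv]
    -- The first derivative is estimated directly, since the smaller radius `R * n / (n + 1)` is `0`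
    -- for `n = 0`.
    rcases Nat.eq_zero_or_pos n with rfl | hpos
    · rw [norm_iteratedFDeriv_zero]
      refine (Complex.norm_fderiv_le_div_of_mapsTo_ball (R₂ := 2 * M)
        hf.differentiableOn (fun z hz => ?_) hR).trans (le_of_eq (by simp; ring))
      rw [mem_closedBall, dist_eq_norm]
      linarith [norm_sub_le (f z) (f c), hM z hz, hM c (mem_ball_self hR)]
    have hn0 : (0 : ℝ) < n := by exact_mod_cast hpos
    have hR' : 0 < R * n / (n + 1) := by positivity
    have hsub : ball c (R * n / (n + 1)) ⊆ ball c R := by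
      apply ball_subset_ball
      rw [div_le_iff₀ hn]
      nlinarith
    have key : ∀ x ∈ ball c (R * n / (n + 1)), ‖fderiv ℂ f x‖ ≤ 2 * M * (n + 1) / R := by
      intro x hx
      have hsub' : ball x (R / (n + 1)) ⊆ ball c R := by
        apply ball_subset_ball'
        have : R / (n + 1) + R * n / (n + 1) = R := by field_simp; ring
        linarith [mem_ball.1 hx]
      refine (Complex.norm_fderiv_le_div_of_mapsTo_ball (R₂ := 2 * M)
        (hf.differentiableOn.mono hsub') (fun z hz => ?_) (by positivity)).trans
        (le_of_eq (by field_simp))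
      rw [mem_closedBall, dist_eq_norm]
      linarith [norm_sub_le (f z) (f x), hM z (hsub' hz), hM x (hsub hx)]
    refine (ih hR' (hf.fderiv.mono hsub) key).trans (le_of_eq ?_)
    have : 2 * (n : ℝ) / (R * n / (n + 1)) = 2 * (n + 1) / R := by field_simp
    rw [this, pow_succ]
    push_cast
    ring

open Metric in
/-- Weierstrass' theorem for normally convergent series of analytic functions. -/
theorem analyticAt_tsum_of_bounded {E : Type} [NormedAddCommGroup E] [NormedSpace ℂ E]
    {f : ℕ → E → ℂ} {R : ℝ} {M : ℕ → ℝ} (hR : 0 < R)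
    (hf : ∀ j, AnalyticOnNhd ℂ (f j) (ball 0 R))
    (hM : ∀ j, ∀ x ∈ ball (0 : E) R, ‖f j x‖ ≤ M j) (hs : Summable M) :
    AnalyticAt ℂ (fun x => ∑' j, f j x) 0 := by
  let p : ℕ → FormalMultilinearSeries ℂ E ℂ := fun j n =>
    ((n.factorial : ℂ))⁻¹ • iteratedFDeriv ℂ n (f j) 0
  have hM0 : ∀ j, 0 ≤ M j := fun j => (norm_nonneg _).trans (hM j 0 (mem_ball_self hR))
  -- `(2n/R)^n / n! ≤ (2e/R)^n`, because `n^n / n! ≤ e^n`.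
  obtain ⟨K, hK, hKdef⟩ : ∃ K : ℝ, 0 < K ∧ K = 2 * Real.exp 1 / R :=
    ⟨_, by positivity, rfl⟩
  have hp : ∀ j n, ‖p j n‖ ≤ M j * K ^ n := by
    intro j n
    have h1 := norm_iteratedFDeriv_le_of_bounded n hR (hf j) (hM j)
    have h2 := Real.pow_div_factorial_le_exp (n : ℝ) (by positivity) n
    have h3 : Real.exp n = Real.exp 1 ^ n := by rw [← Real.exp_nat_mul]; simp
    have hfac : (0 : ℝ) < n.factorial := by positivity
    calc ‖p j n‖ = (n.factorial : ℝ)⁻¹ * ‖iteratedFDeriv ℂ n (f j) 0‖ := by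
          simp [p, norm_smul]
      _ ≤ (n.factorial : ℝ)⁻¹ * (M j * (2 * n / R) ^ n) := by gcongr
      _ = M j * (2 / R) ^ n * ((n : ℝ) ^ n / n.factorial) := by
          rw [div_pow, mul_pow, div_pow]; field_simp
      _ ≤ M j * (2 / R) ^ n * Real.exp 1 ^ n := by
          rw [← h3]; have := hM0 j; gcongr
      _ = M j * K ^ n := by
          rw [hKdef, mul_assoc, ← mul_pow]; congr 2; ring
  obtain ⟨ρ, hρ, hρK⟩ : ∃ ρ : NNReal, 0 < ρ ∧ K * ρ = 1 / 2 :=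
    ⟨(1 / (2 * K)).toNNReal, Real.toNNReal_pos.2 (by positivity),
      by rw [Real.coe_toNNReal _ (by positivity)]; field_simp⟩
  have hρ' : (0 : ℝ) < ρ := by exact_mod_cast hρ
  have hρR : (ρ : ℝ) ≤ R := by
    have h1 : K * R = 2 * Real.exp 1 := by rw [hKdef]; field_simp
    have h2 := Real.add_one_le_exp (1 : ℝ)
    by_contra hlt
    push Not at hlt
    nlinarith [mul_lt_mul_of_pos_left hlt hK]
  have hrad : ∀ j, (ρ : ENNReal) ≤ (p j).radius := by
    intro j
    refine (p j).le_radius_of_bound (M j) fun n => ?_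
    calc ‖p j n‖ * (ρ : ℝ) ^ n ≤ M j * K ^ n * (ρ : ℝ) ^ n := by gcongr; exact hp j n
      _ = M j * (1 / 2) ^ n := by rw [mul_assoc, ← mul_pow, hρK]
      _ ≤ M j * 1 := by
          have := hM0 j
          gcongr
          exact pow_le_one₀ (by norm_num) (by norm_num)
      _ = M j := mul_one _
  have hpos : ∀ j, 0 < (p j).radius := fun j =>
    lt_of_lt_of_le (by exact_mod_cast hρ) (hrad j)
  have hsum : ∀ j, ∀ y ∈ ball (0 : E) ρ, HasSum (fun n => p j n fun _ => y) (f j y) := by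
    intro j y hy
    have h1 := (p j).hasFPowerSeriesOnBall (hpos j)
    have hsub : ball (0 : E) ρ ⊆ eball 0 (p j).radius := by
      rw [← eball_coe]; exact eball_subset_eball (hrad j)
    have h3 : (p j).sum =ᶠ[𝓝 0] f j := by
      obtain ⟨q, hq⟩ := hf j 0 (mem_ball_self hR)
      obtain ⟨r, hq⟩ := hq
      filter_upwards [eball_mem_nhds (0 : E) hq.r_pos] with z hz
      have := hq.hasSum_iteratedFDeriv hz
      rw [zero_add] at this
      exact this.tsum_eq
    -- The Taylor series is known to represent `f j` only near `0`, on a ball depending on `j`; the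
    -- identity theorem extends this to the common radius `ρ`.
    have h4 := (h1.analyticOnNhd.mono hsub).eqOn_of_preconnected_of_eventuallyEq
      ((hf j).mono (ball_subset_ball hρR)) (convex_ball _ _).isPreconnected
      (mem_ball_self hρ') h3
    rw [← h4 hy]
    simpa using h1.hasSum (hsub hy)
  have hsp : ∀ n, Summable fun j => p j n := fun n =>
    Summable.of_norm_bounded (hs.mul_right _) fun j => hp j n
  let P : FormalMultilinearSeries ℂ E ℂ := fun n => ∑' j, p j n
  refine ⟨P, ρ, ⟨?_, by exact_mod_cast hρ, ?_⟩⟩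
  · refine P.le_radius_of_bound (∑' j, M j) fun n => ?_
    have h1 : ‖P n‖ ≤ (∑' j, M j) * K ^ n := by
      rw [← tsum_mul_right]
      exact tsum_of_norm_bounded (hs.mul_right _).hasSum fun j => hp j n
    calc ‖P n‖ * (ρ : ℝ) ^ n ≤ (∑' j, M j) * K ^ n * (ρ : ℝ) ^ n := by gcongr
      _ = (∑' j, M j) * (1 / 2) ^ n := by rw [mul_assoc, ← mul_pow, hρK]
      _ ≤ (∑' j, M j) * 1 := by
          exact mul_le_mul_of_nonneg_left (pow_le_one₀ (by norm_num) (by norm_num))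
            (tsum_nonneg hM0)
      _ = _ := mul_one _
  · intro y hy
    rw [eball_coe] at hy
    rw [zero_add]
    have hy' : ‖y‖ < ρ := by simpa using hy
    have hbd : ∀ n j, ‖p j n fun _ => y‖ ≤ (1 / 2) ^ n * M j := by
      intro n j
      calc ‖p j n fun _ => y‖ ≤ ‖p j n‖ * ‖y‖ ^ n := by
            simpa using (p j n).le_opNorm fun _ => y
        _ ≤ M j * K ^ n * (ρ : ℝ) ^ n := by
            have := hM0 j
            gcongr
            exact hp j n
        _ = (1 / 2) ^ n * M j := by rw [mul_assoc, ← mul_pow, hρK, mul_comm]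
    -- Absolute summability of the double series allows the sums over the degree and over `j` to be
    -- exchanged.
    have hSS : Summable (fun x : ℕ × ℕ => p x.2 x.1 fun _ => y) :=
      Summable.of_norm_bounded
        ((summable_geometric_of_lt_one (by norm_num) (by norm_num)).mul_of_nonneg hs
          (fun n => by positivity) hM0) fun x => hbd x.1 x.2
    have hH := hSS.hasSum
    have e1 : ∀ n, HasSum (fun j => p j n fun _ => y) (P n fun _ => y) := by
      intro n
      have h := (hSS.prod_factor n).hasSum
      have : (P n fun _ => y) = ∑' j, p j n fun _ => y :=
        ContinuousMultilinearMap.tsum_eval (hsp n) _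
      rw [this]
      exact h
    have h1 := hH.prod_fiberwise e1
    have hH2 : HasSum (fun x : ℕ × ℕ => p x.1 x.2 fun _ => y)
        (∑' x : ℕ × ℕ, p x.2 x.1 fun _ => y) :=
      (Equiv.prodComm ℕ ℕ).hasSum_iff.1 hH
    have h2 := hH2.prod_fiberwise (g := fun j => f j y) fun j => hsum j y hy
    rw [h2.tsum_eq]
    exact h1

/-! ### Contraction in an adapted norm -/

/-- Gelfand's formula: in finite dimension the spectrum consists of eigenvalues, so the spectral
radius is below `1` and some power of `T` has norm at most `θ ^ N`. -/
theorem exists_norm_pow_le_of_eigenvalue_lt {E : Type} [NormedAddCommGroup E] [NormedSpace ℂ E]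
    [FiniteDimensional ℂ E] (T : E →L[ℂ] E)
    (hT : ∀ μ : ℂ, Module.End.HasEigenvalue (T : E →ₗ[ℂ] E) μ → ‖μ‖ < 1) :
    ∃ θ : ℝ, 0 < θ ∧ θ < 1 ∧ ∃ N : ℕ, 1 ≤ N ∧ ‖T ^ N‖ ≤ θ ^ N := by
  have : CompleteSpace E := FiniteDimensional.complete ℂ E
  have hspec : ∀ μ ∈ spectrum ℂ T, ‖μ‖₊ < 1 := by
    intro μ hμ
    have h1 : μ ∈ spectrum ℂ (T : E →ₗ[ℂ] E) := by
      rw [spectrum.mem_iff] at hμ ⊢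
      contrapose! hμ
      rw [Module.End.isUnit_iff] at hμ
      let e := LinearEquiv.toContinuousLinearEquiv (LinearEquiv.ofBijective _ hμ)
      have he : algebraMap ℂ (E →L[ℂ] E) μ - T = (e : E →L[ℂ] E) := by
        ext x; simp [e, Algebra.algebraMap_eq_smul_one]
      rw [he]
      exact ⟨ContinuousLinearEquiv.unitsEquiv ℂ E |>.symm e, rfl⟩
    exact_mod_cast hT μ (Module.End.hasEigenvalue_iff_mem_spectrum.2 h1)
  have hlt : spectralRadius ℂ T < 1 := by
    rcases (spectrum ℂ T).eq_empty_or_nonempty with h | h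
    · simp [spectralRadius, h]
    · exact_mod_cast spectrum.spectralRadius_lt_of_forall_lt_of_nonempty h hspec
  obtain ⟨θ, h1, h2⟩ := ENNReal.lt_iff_exists_nnreal_btwn.1 hlt
  have hG := spectrum.pow_nnnorm_pow_one_div_tendsto_nhds_spectralRadius T
  obtain ⟨N, hN, hN1⟩ := ((hG.eventually_lt_const h1).and (eventually_ge_atTop 1)).exists
  have hN0 : (N : ℝ) ≠ 0 := by positivity
  refine ⟨max θ (1 / 2), by positivity, max_lt (by exact_mod_cast h2) (by norm_num), N, hN1, ?_⟩
  have h3 : ‖T ^ N‖₊ ≤ θ ^ N := by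
    have h4 := ENNReal.rpow_le_rpow hN.le (z := N) (by positivity)
    rw [← ENNReal.rpow_mul, one_div, inv_mul_cancel₀ hN0, ENNReal.rpow_one,
      ENNReal.rpow_natCast] at h4
    exact_mod_cast h4
  calc ‖T ^ N‖ ≤ (θ : ℝ) ^ N := by exact_mod_cast h3
    _ ≤ _ := by gcongr; exact le_max_left _ _

/-- `V` is a Lyapunov function, equivalent to the norm, that `f` contracts by the factor `θ`
on the domain `{V < r}`. -/
structure IsLyapunov {d : ℕ} (f : Cn d → Cn d) (θ : ℝ) (V : Cn d → ℝ) (r C : ℝ) : Prop where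
  rate_pos : 0 < θ
  rate_lt : θ < 1
  radius_pos : 0 < r
  const_pos : 0 < C
  norm_le : ∀ x, ‖x‖ ≤ V x
  le_norm : ∀ x, V x ≤ C * ‖x‖
  analytic : AnalyticOnNhd ℂ f {x | V x < r}
  contract : ∀ x, V x < r → V (f x) ≤ θ * V x

/-- The norm `∑ θ^{-j} ‖T^j x‖` over `j < N` is contracted by `T`: the shift loses the term `‖x‖`
and gains `θ^{-N} ‖T^N x‖ ≤ ‖x‖`. The non-linear part of `f` costs half of the gap `1 - θ`, whence
the final rate `(1 + θ) / 2`. -/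
theorem IsContractingGerm.exists_lyapunov {d : ℕ} {f : Cn d → Cn d} (hf : IsContractingGerm f) :
    ∃ (θ : ℝ) (V : Cn d → ℝ) (r C : ℝ), IsLyapunov f θ V r C := by
  set T := fderiv ℂ f 0 with hTdef
  obtain ⟨θ, hθ0, hθ1, N, hN1, hN⟩ := exists_norm_pow_le_of_eigenvalue_lt T hf.eigenvalue_lt
  let V : Cn d → ℝ := fun x => ∑ j ∈ Finset.range N, θ⁻¹ ^ j * ‖(T ^ j) x‖
  have hVadd : ∀ x y, V (x + y) ≤ V x + V y := by
    intro x y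
    simp only [V, ← Finset.sum_add_distrib]
    gcongr with j _
    rw [map_add, ← mul_add]
    gcongr
    exact norm_add_le _ _
  have hVge : ∀ x, ‖x‖ ≤ V x := by
    intro x
    have := Finset.single_le_sum (s := Finset.range N)
      (f := fun j => θ⁻¹ ^ j * ‖(T ^ j) x‖) (fun j _ => by positivity)
      (Finset.mem_range.2 (by omega : 0 < N))
    simpa [V] using this
  obtain ⟨C, hC, hVle⟩ : ∃ C : ℝ, 0 < C ∧ ∀ x, V x ≤ C * ‖x‖ := by
    refine ⟨∑ j ∈ Finset.range N, θ⁻¹ ^ j * ‖T ^ j‖ + 1, by positivity, fun x => ?_⟩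
    rw [add_mul, Finset.sum_mul]
    refine (Finset.sum_le_sum fun j _ => ?_).trans (le_add_of_nonneg_right (by positivity))
    rw [mul_assoc]
    gcongr
    exact (T ^ j).le_opNorm x
  have hVT : ∀ x, V (T x) ≤ θ * V x := by
    intro x
    have h2 := Finset.sum_range_succ (fun j => θ⁻¹ ^ j * ‖(T ^ j) x‖) N
    have h3 := Finset.sum_range_succ' (fun j => θ⁻¹ ^ j * ‖(T ^ j) x‖) N
    have h4 : θ⁻¹ ^ N * ‖(T ^ N) x‖ ≤ ‖x‖ := by
      calc θ⁻¹ ^ N * ‖(T ^ N) x‖ ≤ θ⁻¹ ^ N * (θ ^ N * ‖x‖) := by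
            gcongr
            exact ((T ^ N).le_opNorm x).trans (by gcongr)
        _ = ‖x‖ := by rw [← mul_assoc, ← mul_pow, inv_mul_cancel₀ hθ0.ne', one_pow, one_mul]
    have h5 : V (T x) = θ * ∑ j ∈ Finset.range N, θ⁻¹ ^ (j + 1) * ‖(T ^ (j + 1)) x‖ := by
      rw [Finset.mul_sum]
      refine Finset.sum_congr rfl fun j _ => ?_
      rw [pow_succ (M := Cn d →L[ℂ] Cn d), mul_apply_eq_comp, pow_succ' θ⁻¹,
        ← mul_assoc, ← mul_assoc, mul_inv_cancel₀ hθ0.ne', one_mul]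
    rw [h5]
    gcongr
    have h6 : θ⁻¹ ^ 0 * ‖(T ^ 0) x‖ = ‖x‖ := by simp
    have h7 : V x = ∑ j ∈ Finset.range N, θ⁻¹ ^ j * ‖(T ^ j) x‖ := rfl
    linarith
  have hε : 0 < (1 - θ) / (2 * C) := div_pos (by linarith) (by positivity)
  have hlin : ∀ᶠ x in 𝓝 (0 : Cn d), ‖f x - T x‖ ≤ (1 - θ) / (2 * C) * ‖x‖ := by
    have h := hf.analytic.differentiableAt.hasFDerivAt.isLittleO
    have h' := h.def hε
    simpa [hf.map_zero] using h'
  obtain ⟨r, hr, hball⟩ := Metric.eventually_nhds_iff_ball.1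
    (hlin.and hf.analytic.eventually_analyticAt)
  have hmem : ∀ x, V x < r → x ∈ Metric.ball (0 : Cn d) r := fun x hx => by
    simpa using (hVge x).trans_lt hx
  refine ⟨(1 + θ) / 2, V, r, C, by linarith, by linarith, hr, hC, hVge, hVle,
    fun x hx => (hball x (hmem x hx)).2, fun x hx => ?_⟩
  calc V (f x) = V (T x + (f x - T x)) := by congr 1; abel
    _ ≤ V (T x) + V (f x - T x) := hVadd _ _
    _ ≤ θ * V x + C * ((1 - θ) / (2 * C) * ‖x‖) := by
        gcongr
        · exact hVT x
        · exact (hVle _).trans (by gcongr; exact (hball x (hmem x hx)).1)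
    _ = θ * V x + (1 - θ) / 2 * ‖x‖ := by field_simp
    _ ≤ θ * V x + (1 - θ) / 2 * V x := by
        have : 0 < 1 - θ := by linarith
        gcongr
        exact hVge x
    _ = _ := by ring

section

open Asymptotics

/-! ### The scalar cohomological equation -/

namespace IsLyapunov

variable {d : ℕ} {f : Cn d → Cn d} {θ : ℝ} {V : Cn d → ℝ} {r C : ℝ}

theorem nonneg (h : IsLyapunov f θ V r C) (x : Cn d) : 0 ≤ V x :=
  (norm_nonneg x).trans (h.norm_le x)

theorem restrict (h : IsLyapunov f θ V r C) {ρ : ℝ} (hρ : 0 < ρ) (hρr : ρ ≤ r) :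
    IsLyapunov f θ V ρ C :=
  { h with
    radius_pos := hρ
    analytic := h.analytic.mono fun _ hx => lt_of_lt_of_le hx hρr
    contract := fun x hx => h.contract x (lt_of_lt_of_le hx hρr) }

theorem mapsTo (h : IsLyapunov f θ V r C) : Set.MapsTo f {x | V x < r} {x | V x < r} :=
  fun x hx => lt_of_le_of_lt ((h.contract x hx).trans
    (mul_le_of_le_one_left (h.nonneg x) h.rate_lt.le)) hx

theorem iterate_le (h : IsLyapunov f θ V r C) {x : Cn d} (hx : V x < r) (j : ℕ) :
    V (f^[j] x) ≤ θ ^ j * V x := by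
  induction j with
  | zero => simp
  | succ j ih =>
    rw [Function.iterate_succ_apply', pow_succ', mul_assoc]
    refine (h.contract _ (h.mapsTo.iterate j hx)).trans ?_
    have := h.rate_pos
    gcongr

theorem analytic_iterate (h : IsLyapunov f θ V r C) (j : ℕ) :
    AnalyticOnNhd ℂ (f^[j]) {x | V x < r} := by
  induction j with
  | zero => exact analyticOnNhd_id
  | succ j ih =>
    rw [Function.iterate_succ']
    exact h.analytic.comp ih (h.mapsTo.iterate j)

theorem ball_subset (h : IsLyapunov f θ V r C) :
    Metric.ball (0 : Cn d) (r / C) ⊆ {x | V x < r} := by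
  intro x hx
  rw [mem_ball_zero_iff, lt_div_iff₀ h.const_pos] at hx
  exact (h.le_norm x).trans_lt (by linarith)

theorem ball_pos (h : IsLyapunov f θ V r C) : 0 < r / C := div_pos h.radius_pos h.const_pos

/-- Adapts the domain of a Lyapunov function to a germ vanishing to order `N`. -/
theorem exists_bound (h : IsLyapunov f θ V r C) {v : Cn d → ℂ} (hv : AnalyticAt ℂ v 0) {N : ℕ}
    (hN : v =O[𝓝 0] fun x => ‖x‖ ^ N) :
    ∃ ρ K : ℝ, 0 < K ∧ IsLyapunov f θ V ρ C ∧ AnalyticOnNhd ℂ v {x | V x < ρ} ∧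
      ∀ x, V x < ρ → ‖v x‖ ≤ K * V x ^ N := by
  obtain ⟨K, hK, hb⟩ := hN.exists_pos
  obtain ⟨ε, hε, hball⟩ := Metric.eventually_nhds_iff_ball.1
    (hb.bound.and hv.eventually_analyticAt)
  have hmem : ∀ x, V x < min ε r → x ∈ Metric.ball (0 : Cn d) ε := fun x hx => by
    simpa using (h.norm_le x).trans_lt (hx.trans_le (min_le_left _ _))
  refine ⟨min ε r, K, hK, h.restrict (lt_min hε h.radius_pos) (min_le_right _ _),
    fun x hx => (hball x (hmem x hx)).2, fun x hx => ?_⟩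
  refine (hball x (hmem x hx)).1.trans ?_
  rw [norm_pow, norm_norm]
  gcongr
  exact h.norm_le x

/-- The cohomological equation `w ∘ f - μ w = v` is solvable for germs `v` vanishing to high
order. -/
theorem exists_cohomological (h : IsLyapunov f θ V r C) {μ : ℂ} (hμ : μ ≠ 0) {N : ℕ}
    (hμN : θ ^ N < ‖μ‖) {v : Cn d → ℂ} (hv : AnalyticAt ℂ v 0)
    (hN : v =O[𝓝 0] fun x => ‖x‖ ^ N) :
    ∃ w : Cn d → ℂ, AnalyticAt ℂ w 0 ∧ (w =O[𝓝 0] fun x => ‖x‖ ^ N) ∧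
      ∀ᶠ x in 𝓝 0, w (f x) - μ * w x = v x := by
  obtain ⟨ρ, K, hK, h, hva, hvb⟩ := h.exists_bound hv hN
  have hθ := h.rate_pos
  have hC := h.const_pos
  have hμ0 : 0 < ‖μ‖ := norm_pos_iff.2 hμ
  let q : ℝ := θ ^ N / ‖μ‖
  have hq0 : 0 ≤ q := by positivity
  have hq1 : q < 1 := (div_lt_one hμ0).2 hμN
  -- Neumann series for `(f^* - μ)⁻¹ v`, up to sign. Since `v ∘ f^j` is of size `θ ^ (j * N)`, the
  -- terms decay like `q ^ j`.
  let F : ℕ → Cn d → ℂ := fun j x => μ⁻¹ ^ (j + 1) * v (f^[j] x)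
  have hF : ∀ j, ∀ x, V x < ρ → ‖F j x‖ ≤ ‖μ‖⁻¹ * K * V x ^ N * q ^ j := by
    intro j x hx
    have h1 := hvb _ (h.mapsTo.iterate j hx)
    have h2 := h.iterate_le hx j
    have h3 := h.nonneg (f^[j] x)
    calc ‖F j x‖ = ‖μ‖⁻¹ ^ (j + 1) * ‖v (f^[j] x)‖ := by simp [F]
      _ ≤ ‖μ‖⁻¹ ^ (j + 1) * (K * (θ ^ j * V x) ^ N) := by
          gcongr
          exact h1.trans (by gcongr)
      _ = _ := by
          simp only [q, div_eq_mul_inv, mul_pow]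
          rw [← pow_mul, ← pow_mul, mul_comm j N]
          ring
  have hsum : ∀ x, V x < ρ → Summable fun j => F j x := fun x hx =>
    Summable.of_norm_bounded ((summable_geometric_of_lt_one hq0 hq1).mul_left _) fun j => hF j x hx
  have hFa : ∀ j, AnalyticOnNhd ℂ (F j) {x | V x < ρ} := fun j =>
    analyticOnNhd_const.mul (hva.comp (h.analytic_iterate j) (h.mapsTo.iterate j))
  have hU : ∀ᶠ x in 𝓝 (0 : Cn d), V x < ρ :=
    mem_of_superset (Metric.ball_mem_nhds _ h.ball_pos) h.ball_subset
  refine ⟨fun x => -∑' j, F j x, ?_, ?_, ?_⟩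
  · refine (analyticAt_tsum_of_bounded (M := fun j => ‖μ‖⁻¹ * K * ρ ^ N * q ^ j) h.ball_pos
      (fun j => (hFa j).mono h.ball_subset) (fun j x hx => ?_)
      ((summable_geometric_of_lt_one hq0 hq1).mul_left _)).neg
    refine (hF j x (h.ball_subset hx)).trans ?_
    have := h.nonneg x
    have : V x < ρ := h.ball_subset hx
    gcongr
  · refine IsBigO.of_bound (‖μ‖⁻¹ * K * C ^ N * ∑' j, q ^ j) ?_
    filter_upwards [hU] with x hx
    rw [norm_neg, norm_pow, norm_norm]
    have h1 := tsum_of_norm_bounded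
      ((summable_geometric_of_lt_one hq0 hq1).mul_left (‖μ‖⁻¹ * K * V x ^ N)).hasSum
      fun j => hF j x hx
    refine h1.trans ?_
    rw [tsum_mul_left]
    have h2 : V x ^ N ≤ C ^ N * ‖x‖ ^ N := by
      rw [← mul_pow]
      exact pow_le_pow_left₀ (h.nonneg x) (h.le_norm x) N
    have h3 : 0 ≤ ∑' j, q ^ j := tsum_nonneg fun j => by positivity
    calc ‖μ‖⁻¹ * K * V x ^ N * ∑' j, q ^ j
        ≤ ‖μ‖⁻¹ * K * (C ^ N * ‖x‖ ^ N) * ∑' j, q ^ j := by gcongr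
      _ = _ := by ring
  · filter_upwards [hU] with x hx
    have h1 := (hsum x hx).tsum_eq_zero_add
    have h2 : ∑' j, F (j + 1) x = μ⁻¹ * ∑' j, F j (f x) := by
      rw [← tsum_mul_left]
      refine tsum_congr fun j => ?_
      simp only [F, Function.iterate_succ_apply]
      ring
    have h3 : F 0 x = μ⁻¹ * v x := by simp [F]
    rw [h1, h2, h3]
    field_simp
    ring

/-- The equation gives `v ∘ f^j = μ^j v`, while contraction gives `|v ∘ f^j| = O(θ^{jN})`; letting
`j → ∞` forces `v = 0`. This is the uniqueness part of the cohomological equation. -/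
theorem eventually_eq_zero (h : IsLyapunov f θ V r C) {μ : ℂ} (hμ : μ ≠ 0) {N : ℕ}
    (hμN : θ ^ N < ‖μ‖) {v : Cn d → ℂ} (hv : AnalyticAt ℂ v 0)
    (hN : v =O[𝓝 0] fun x => ‖x‖ ^ N) (he : ∀ᶠ x in 𝓝 0, v (f x) - μ * v x = 0) :
    ∀ᶠ x in 𝓝 0, v x = 0 := by
  obtain ⟨ρ, K, hK, h, hva, hvb⟩ := h.exists_bound hv hN
  have hθ := h.rate_pos
  have hμ0 : 0 < ‖μ‖ := norm_pos_iff.2 hμ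
  obtain ⟨ε, hε, hball⟩ := Metric.eventually_nhds_iff_ball.1 he
  have h := h.restrict (lt_min hε h.radius_pos) (min_le_right _ _)
  have hmem : ∀ x, V x < min ε ρ → x ∈ Metric.ball (0 : Cn d) ε := fun x hx => by
    simpa using (h.norm_le x).trans_lt (hx.trans_le (min_le_left _ _))
  filter_upwards [mem_of_superset (Metric.ball_mem_nhds _ h.ball_pos) h.ball_subset] with x hx
  have hit : ∀ j, v (f^[j] x) = μ ^ j * v x := by
    intro j
    induction j with
    | zero => simp
    | succ j ih =>
      have := hball _ (hmem _ (h.mapsTo.iterate j hx))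
      rw [Function.iterate_succ_apply', sub_eq_zero.1 this, ih]
      ring
  have hle : ∀ j : ℕ, ‖v x‖ ≤ K * V x ^ N * (θ ^ N / ‖μ‖) ^ j := by
    intro j
    have h1 := hvb _ (lt_of_lt_of_le (h.mapsTo.iterate j hx) (min_le_right _ _))
    have h2 := h.iterate_le hx j
    have h3 := h.nonneg (f^[j] x)
    rw [hit, norm_mul, norm_pow] at h1
    have h4 : ‖μ‖ ^ j * ‖v x‖ ≤ K * (θ ^ j * V x) ^ N := h1.trans (by gcongr)
    rw [div_pow, ← mul_div_assoc, le_div_iff₀ (by positivity)]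
    calc ‖v x‖ * ‖μ‖ ^ j = ‖μ‖ ^ j * ‖v x‖ := mul_comm _ _
      _ ≤ _ := h4
      _ = _ := by rw [mul_pow, ← pow_mul, ← pow_mul, mul_comm j N]; ring
  have hlim : Tendsto (fun j : ℕ => K * V x ^ N * (θ ^ N / ‖μ‖) ^ j) atTop (𝓝 0) := by
    simpa using (tendsto_pow_atTop_nhds_zero_of_lt_one (by positivity)
      ((div_lt_one hμ0).2 hμN)).const_mul (K * V x ^ N)
  simpa using ge_of_tendsto' hlim hle

end IsLyapunov

/-! ### Order of vanishing and Taylor polynomials -/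

section Taylor

variable {E F : Type} [NormedAddCommGroup E] [NormedSpace ℂ E] [NormedAddCommGroup F]
  [NormedSpace ℂ F] {f : E → F} {p : FormalMultilinearSeries ℂ E F} {n : ℕ}

theorem HasFPowerSeriesAt.apply_eq_zero_of_isBigO (hp : HasFPowerSeriesAt f p 0)
    (hn : f =O[𝓝 0] fun x => ‖x‖ ^ n) {k : ℕ} (hk : k < n) (y : E) : (p k fun _ => y) = 0 := by
  induction k using Nat.strong_induction_on generalizing y with
  | _ k ih =>
    have h := hp.isBigO_sub_partialSum_pow (k + 1)
    have hsum : p.partialSum (k + 1) = fun y => p k fun _ => y := by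
      funext z
      refine Finset.sum_eq_single _ (fun b hb hnb => ?_) fun hn => ?_
      · have := (Finset.mem_range_succ_iff.mp hb).lt_of_ne hnb
        exact ih b this (this.trans hk) z
      · exact (hn (Finset.mem_range.mpr k.lt_succ_self)).elim
    simp only [hsum, zero_add] at h
    have h2 : (fun x : E => ‖x‖ ^ n) =O[𝓝 0] fun x => ‖x‖ ^ (k + 1) := by
      obtain ⟨j, rfl⟩ := Nat.exists_eq_add_of_lt hk
      have hc : Tendsto (fun x : E => ‖x‖ ^ j) (𝓝 0) (𝓝 (‖(0 : E)‖ ^ j)) :=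
        (by fun_prop : Continuous fun x : E => ‖x‖ ^ j).tendsto 0
      have := (hc.isBigO_one ℝ).mul (isBigO_refl (fun x : E => ‖x‖ ^ (k + 1)) (𝓝 0))
      refine this.congr (fun x => ?_) fun x => one_mul _
      ring
    have h3 : (fun y => p k fun _ => y) =O[𝓝 0] fun y : E => ‖y‖ ^ (k + 1) := by
      have := (hn.trans h2).sub h
      exact this.congr_left fun x => by simp
    exact h3.continuousMultilinearMap_apply_eq_zero y

theorem HasFPowerSeriesAt.isBigO_sub_apply (hp : HasFPowerSeriesAt f p 0)
    (hn : f =O[𝓝 0] fun x => ‖x‖ ^ n) :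
    (fun y => f y - p n fun _ => y) =O[𝓝 0] fun x => ‖x‖ ^ (n + 1) := by
  refine (hp.isBigO_sub_partialSum_pow (n + 1)).congr_left fun y => ?_
  rw [zero_add]
  congr 1
  refine Finset.sum_eq_single _ (fun b hb hnb => ?_) fun hn => ?_
  · exact hp.apply_eq_zero_of_isBigO hn ((Finset.mem_range_succ_iff.mp hb).lt_of_ne hnb) y
  · exact (hn (Finset.mem_range.mpr n.lt_succ_self)).elim

/-- Along `t • y` with `t → 0`, both sides scale by `‖t‖ ^ n`, so the value at `y` is smaller than
every `ε`. -/
theorem ContinuousMultilinearMap.apply_diag_eq_zero_of_isLittleO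
    {q : ContinuousMultilinearMap ℂ (fun _ : Fin n => E) F}
    (h : (fun y => q fun _ => y) =o[𝓝 0] fun y : E => ‖y‖ ^ n) (y : E) : (q fun _ => y) = 0 := by
  have hy : Tendsto (fun t : ℂ => t • y) (𝓝[≠] 0) (𝓝 0) := by
    have : Tendsto (fun t : ℂ => t • y) (𝓝 0) (𝓝 ((0 : ℂ) • y)) :=
      (by fun_prop : Continuous fun t : ℂ => t • y).tendsto 0
    rw [zero_smul] at this
    exact this.mono_left nhdsWithin_le_nhds
  have h1 := h.comp_tendsto hy
  rw [← norm_le_zero_iff]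
  refine le_of_forall_pos_le_add fun ε hε => ?_
  have hδ : 0 < ε / (‖y‖ ^ n + 1) := by positivity
  obtain ⟨t, ht, ht0⟩ := ((h1.def hδ).and self_mem_nhdsWithin).exists
  have ht0' : 0 < ‖t‖ := norm_pos_iff.2 ht0
  have e : (q fun _ => t • y) = t ^ n • q fun _ => y := by
    simpa using q.map_smul_univ (fun _ => t) fun _ => y
  simp only [Function.comp, e, norm_smul, norm_pow, mul_pow] at ht
  rw [Real.norm_of_nonneg (by positivity)] at ht
  have h2 : ‖q fun _ => y‖ ≤ ε / (‖y‖ ^ n + 1) * ‖y‖ ^ n := by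
    refine le_of_mul_le_mul_left ?_ (pow_pos ht0' n)
    linarith
  refine h2.trans ?_
  rw [zero_add, div_mul_eq_mul_div, div_le_iff₀ (by positivity)]
  nlinarith [pow_nonneg (norm_nonneg y) n]

/-- The homogeneous term of degree `n` is itself `o(‖x‖ ^ n)`, hence zero: orders of vanishing of
holomorphic germs are integers. -/
theorem AnalyticAt.isBigO_succ_of_isLittleO (hf : AnalyticAt ℂ f 0)
    (hn : f =o[𝓝 0] fun x => ‖x‖ ^ n) : f =O[𝓝 0] fun x => ‖x‖ ^ (n + 1) := by
  obtain ⟨p, hp⟩ := hf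
  have h := hp.isBigO_sub_apply hn.isBigO
  have hlt : (fun x : E => ‖x‖ ^ (n + 1)) =o[𝓝 0] fun x => ‖x‖ ^ n := by
    have hc : Tendsto (fun x : E => ‖x‖) (𝓝 0) (𝓝 0) := by
      simpa using (continuous_norm (E := E)).tendsto 0
    have := ((isLittleO_one_iff ℝ).2 hc).mul_isBigO (isBigO_refl (fun x : E => ‖x‖ ^ n) (𝓝 0))
    exact this.congr (fun x => by ring) fun x => one_mul _
  have h0 : (fun y => p n fun _ => y) =o[𝓝 0] fun y : E => ‖y‖ ^ n :=
    (hn.sub (h.trans_isLittleO hlt)).congr_left fun x => by simp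
  refine h.congr_left fun y => ?_
  rw [ContinuousMultilinearMap.apply_diag_eq_zero_of_isLittleO h0 y, sub_zero]

theorem AnalyticAt.eventually_eq_zero_of_isBigO (hf : AnalyticAt ℂ f 0)
    (hn : ∀ n : ℕ, f =O[𝓝 0] fun x => ‖x‖ ^ n) : ∀ᶠ x in 𝓝 0, f x = 0 := by
  obtain ⟨p, hp⟩ := hf
  filter_upwards [hp.eventually_hasSum_sub] with y hy
  have : ∀ k, (p k fun _ => y - 0) = 0 := fun k =>
    hp.apply_eq_zero_of_isBigO (hn (k + 1)) k.lt_succ_self _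
  simp only [this] at hy
  exact hy.unique hasSum_zero

/-- Monomials are indexed by words `r : Fin n → ι` rather than by exponents. This is the form in
which a multilinear map expands over the standard basis, and equal monomials need not be collected.
-/
theorem AnalyticAt.exists_homogeneous {ι : Type} [Fintype ι] {v : (ι → ℂ) → ℂ}
    (hv : AnalyticAt ℂ v 0) (hn : v =O[𝓝 0] fun x => ‖x‖ ^ n) :
    ∃ c : (Fin n → ι) → ℂ,
      (fun t => v t - ∑ r, c r * ∏ i, t (r i)) =O[𝓝 0] fun x => ‖x‖ ^ (n + 1) := by
  classical
  obtain ⟨p, hp⟩ := hv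
  refine ⟨fun r => p n fun i => Pi.single (r i) 1, (hp.isBigO_sub_apply hn).congr_left fun t => ?_⟩
  congr 1
  have h1 : (fun _ : Fin n => t) = fun _ => ∑ j, t j • (Pi.single j (1 : ℂ) : ι → ℂ) := by
    funext i
    conv_lhs => rw [pi_eq_sum_univ' t]
  rw [h1]
  have h2 := (p n).toMultilinearMap.map_sum
    fun (_ : Fin n) (j : ι) => t j • (Pi.single j (1 : ℂ) : ι → ℂ)
  simp only [ContinuousMultilinearMap.coe_coe] at h2
  rw [h2]
  refine Finset.sum_congr rfl fun r _ => ?_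
  have h3 := (p n).map_smul_univ (fun i => t (r i)) fun i => (Pi.single (r i) (1 : ℂ) : ι → ℂ)
  rw [h3, smul_eq_mul, mul_comm]

end Taylor

/-! ### Local inverses and the algebra of holomorphic functions -/

theorem IsLocalBiholomorphism.exists_inverse {E F : Type} [NormedAddCommGroup E] [NormedSpace ℂ E]
    [CompleteSpace E] [NormedAddCommGroup F] [NormedSpace ℂ F] {Φ : E → F}
    (h : IsLocalBiholomorphism Φ) :
    ∃ Ψ : F → E, IsLocalBiholomorphism Ψ ∧ (∀ᶠ x in 𝓝 0, Ψ (Φ x) = x) ∧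
      ∀ᶠ y in 𝓝 0, Φ (Ψ y) = y := by
  obtain ⟨L, hL⟩ := h.invertible
  have hs : HasStrictFDerivAt Φ (L : E →L[ℂ] F) 0 := by
    have := h.analytic.hasStrictFDerivAt
    rwa [hL.fderiv] at this
  refine ⟨hs.localInverse Φ L 0, ⟨?_, ?_, L.symm, ?_⟩, hs.eventually_left_inverse, ?_⟩
  · have := OpenPartialHomeomorph.analyticAt_symm' (hs.toOpenPartialHomeomorph Φ)
      hs.mem_toOpenPartialHomeomorph_source h.analytic hL.fderiv
    rw [hs.toOpenPartialHomeomorph_coe, h.map_zero] at this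
    exact this
  · simpa [h.map_zero] using hs.localInverse_apply_image
  · simpa [h.map_zero] using hs.to_localInverse.hasFDerivAt
  · simpa [h.map_zero] using hs.eventually_right_inverse

/-- The algebra of functions that are holomorphic at the origin. -/
def An (d : ℕ) : Subalgebra ℂ (Cn d → ℂ) where
  carrier := {v | AnalyticAt ℂ v 0}
  mul_mem' := fun ha hb => AnalyticAt.mul ha hb
  add_mem' := fun ha hb => AnalyticAt.add ha hb
  algebraMap_mem' := fun c => (analyticAt_const : AnalyticAt ℂ (fun _ : Cn d => c) 0)

namespace An

variable {d : ℕ}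

theorem analyticAt (v : An d) : AnalyticAt ℂ (v : Cn d → ℂ) 0 := v.2

/-- Germs vanishing to order at least `n`. -/
def vanishing (d n : ℕ) : Submodule ℂ (An d) where
  carrier := {v | (v : Cn d → ℂ) =O[𝓝 0] fun x => ‖x‖ ^ n}
  add_mem' := fun ha hb => IsBigO.add ha hb
  zero_mem' := isBigO_zero _ _
  smul_mem' := fun c _ ha => IsBigO.const_smul_left ha c

/-- Functions vanishing near the origin. -/
def flat (d : ℕ) : Submodule ℂ (An d) where
  carrier := {v | ∀ᶠ x in 𝓝 0, (v : Cn d → ℂ) x = 0}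
  add_mem' := fun {a b} ha hb => by
    filter_upwards [ha, hb] with x h1 h2
    simp [h1, h2]
  zero_mem' := Eventually.of_forall fun _ => rfl
  smul_mem' := fun c a ha => by
    filter_upwards [ha] with x h1
    simp [h1]

theorem mem_vanishing {n : ℕ} {v : An d} :
    v ∈ vanishing d n ↔ (v : Cn d → ℂ) =O[𝓝 0] fun x => ‖x‖ ^ n := Iff.rfl

theorem mem_flat {v : An d} : v ∈ flat d ↔ ∀ᶠ x in 𝓝 0, (v : Cn d → ℂ) x = 0 := Iff.rfl

theorem flat_le_vanishing (n : ℕ) : flat d ≤ vanishing d n := fun _ hv =>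
  (isBigO_zero _ _).congr' (hv.mono fun _ hx => hx.symm) EventuallyEq.rfl

theorem vanishing_zero : vanishing d 0 = ⊤ := by
  refine eq_top_iff.2 fun v _ => ?_
  simp only [mem_vanishing, pow_zero]
  exact (An.analyticAt v).continuousAt.tendsto.isBigO_one ℝ

theorem mul_mem_vanishing {m n : ℕ} {v w : An d} (hv : v ∈ vanishing d m)
    (hw : w ∈ vanishing d n) : v * w ∈ vanishing d (m + n) :=
  (IsBigO.mul hv hw).congr_right fun _ => (pow_add _ _ _).symm

theorem mul_mem_vanishing_left {n : ℕ} (v : An d) {w : An d}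
    (hw : w ∈ vanishing d n) : v * w ∈ vanishing d n := by
  have := mul_mem_vanishing (v := v) (m := 0) (by rw [vanishing_zero]; trivial) hw
  rwa [zero_add] at this

theorem vanishing_anti : Antitone (vanishing d) := by
  refine antitone_nat_of_succ_le fun n v hv => ?_
  refine IsBigO.trans hv ?_
  have hc : Tendsto (fun x : Cn d => ‖x‖) (𝓝 0) (𝓝 ‖(0 : Cn d)‖) := continuous_norm.tendsto 0
  have := (hc.isBigO_one ℝ).mul (isBigO_refl (fun x : Cn d => ‖x‖ ^ n) (𝓝 0))
  exact this.congr (fun x => by ring) fun x => one_mul _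

theorem mul_mem_flat (v : An d) {w : An d} (hw : w ∈ flat d) : v * w ∈ flat d := by
  filter_upwards [hw] with x hx
  simp [hx]

theorem mem_vanishing_one {v : An d} : v ∈ vanishing d 1 ↔ (v : Cn d → ℂ) 0 = 0 := by
  simp only [mem_vanishing, pow_one]
  constructor
  · intro h
    have h' : (v : Cn d → ℂ) =O[𝓝 0] fun x => ‖x - 0‖ ^ 1 := by simpa using h
    exact h'.eq_zero_of_norm_pow one_ne_zero
  · intro h
    have := (An.analyticAt v).differentiableAt.hasFDerivAt.isBigO_sub
    simpa [h] using this.norm_right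

theorem prod_mem_vanishing {ι : Type} {s : Finset ι} {X : ι → An d}
    (hX : ∀ i ∈ s, X i ∈ vanishing d 1) : ∏ i ∈ s, X i ∈ vanishing d s.card := by
  classical
  induction s using Finset.induction_on with
  | empty => simp [vanishing_zero]
  | insert a s ha ih =>
    rw [Finset.prod_insert ha, Finset.card_insert_of_notMem ha, add_comm]
    exact mul_mem_vanishing (hX a (Finset.mem_insert_self _ _))
      (ih fun i hi => hX i (Finset.mem_insert_of_mem hi))

/-- Composition with a holomorphic germ. -/
noncomputable def pullback (f : Cn d → Cn d) (hf : AnalyticAt ℂ f 0) (h0 : f 0 = 0) :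
    An d →ₐ[ℂ] An d where
  toFun v := ⟨fun x => (v : Cn d → ℂ) (f x),
    AnalyticAt.comp (g := (v : Cn d → ℂ)) (h0.symm ▸ v.2) hf⟩
  map_one' := rfl
  map_mul' _ _ := rfl
  map_zero' := rfl
  map_add' _ _ := rfl
  commutes' _ := rfl

theorem pullback_apply {f : Cn d → Cn d} {hf : AnalyticAt ℂ f 0} {h0 : f 0 = 0} (v : An d)
    (x : Cn d) : (pullback f hf h0 v : Cn d → ℂ) x = (v : Cn d → ℂ) (f x) := rfl

theorem pullback_mem_vanishing {f : Cn d → Cn d} {hf : AnalyticAt ℂ f 0} {h0 : f 0 = 0} {n : ℕ}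
    {v : An d} (hv : v ∈ vanishing d n) : pullback f hf h0 v ∈ vanishing d n := by
  have h1 : Tendsto f (𝓝 0) (𝓝 0) := by simpa [ContinuousAt, h0] using hf.continuousAt
  have h2 : f =O[𝓝 0] fun x => x := by
    simpa [h0] using hf.differentiableAt.hasFDerivAt.isBigO_sub
  exact (IsBigO.comp_tendsto hv h1).trans (h2.norm_norm.pow n)

theorem pullback_mem_flat {f : Cn d → Cn d} {hf : AnalyticAt ℂ f 0} {h0 : f 0 = 0}
    {v : An d} (hv : v ∈ flat d) : pullback f hf h0 v ∈ flat d := by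
  have h1 : Tendsto f (𝓝 0) (𝓝 0) := by simpa [ContinuousAt, h0] using hf.continuousAt
  exact h1.eventually hv

/-- The Taylor expansion is taken in the chart `X` through its inverse `Ψ`, so the leading part of
`v` is a form in the possibly non-linear coordinates `X i`. -/
theorem exists_homogeneous {ι : Type} [Fintype ι] {X : ι → An d}
    (hX : IsLocalBiholomorphism fun x i => (X i : Cn d → ℂ) x) {n : ℕ} {v : An d}
    (hv : v ∈ vanishing d n) :
    ∃ c : (Fin n → ι) → ℂ, v - ∑ r, c r • ∏ i, X (r i) ∈ vanishing d (n + 1) := by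
  obtain ⟨Ψ, hΨ, hl, -⟩ := hX.exists_inverse
  have h1 : ∀ {E F : Type} [NormedAddCommGroup E] [NormedSpace ℂ E] [NormedAddCommGroup F]
      [NormedSpace ℂ F] {g : E → F}, IsLocalBiholomorphism g →
      Tendsto g (𝓝 0) (𝓝 0) ∧ g =O[𝓝 0] fun x => x := fun {E F _ _ _ _ g} hg => by
    refine ⟨by simpa [ContinuousAt, hg.map_zero] using hg.analytic.continuousAt, ?_⟩
    simpa [hg.map_zero] using hg.analytic.differentiableAt.hasFDerivAt.isBigO_sub
  have hva : AnalyticAt ℂ (fun t => (v : Cn d → ℂ) (Ψ t)) 0 :=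
    AnalyticAt.comp (g := (v : Cn d → ℂ)) (hΨ.map_zero ▸ v.2) hΨ.analytic
  have hvn : (fun t => (v : Cn d → ℂ) (Ψ t)) =O[𝓝 0] fun t => ‖t‖ ^ n :=
    (IsBigO.comp_tendsto hv (h1 hΨ).1).trans ((h1 hΨ).2.norm_norm.pow n)
  obtain ⟨c, hc⟩ := hva.exists_homogeneous hvn
  refine ⟨c, ?_⟩
  have h2 := (hc.comp_tendsto (h1 hX).1).trans ((h1 hX).2.norm_norm.pow (n + 1))
  refine h2.congr' ?_ EventuallyEq.rfl
  filter_upwards [hl] with x hx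
  simp [hx]

end An

end

/-! ### Generalized eigenvectors and polynomials in the operator -/

section

open Asymptotics Polynomial

theorem Polynomial.aeval_mem_of_invariant {A : Type} [AddCommGroup A] [Module ℂ A]
    {T : Module.End ℂ A} {W : Submodule ℂ A} (hW : ∀ v ∈ W, T v ∈ W) (P : ℂ[X]) {v : A}
    (hv : v ∈ W) : aeval T P v ∈ W := by
  induction P using Polynomial.induction_on' with
  | add p q hp hq => simpa using W.add_mem hp hq
  | monomial n a =>
    have h : ∀ n : ℕ, (T ^ n) v ∈ W := fun n => by
      induction n with
      | zero => simpa
      | succ n ih => rw [pow_succ']; exact hW _ ih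
    simpa [aeval_monomial] using W.smul_mem a (h n)

namespace An

variable {d : ℕ} {f : Cn d → Cn d} (hf : AnalyticAt ℂ f 0) (h0 : f 0 = 0)

theorem flat_invariant : ∀ v ∈ flat d, (pullback f hf h0).toLinearMap v ∈ flat d :=
  fun _ hv => pullback_mem_flat (hf := hf) (h0 := h0) hv

theorem vanishing_invariant (n : ℕ) :
    ∀ v ∈ vanishing d n, (pullback f hf h0).toLinearMap v ∈ vanishing d n :=
  fun _ hv => pullback_mem_vanishing (hf := hf) (h0 := h0) hv

end An

/-- Generalized eigenvectors of `T` modulo the invariant subspace `I`. -/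
def IsGenEig {A : Type} [AddCommGroup A] [Module ℂ A] (T : Module.End ℂ A) (I : Submodule ℂ A)
    (μ : ℂ) (v : A) : Prop :=
  ∃ K : ℕ, aeval T ((X - C μ) ^ K) v ∈ I

namespace IsGenEig

section Module

variable {A : Type} [AddCommGroup A] [Module ℂ A] {T : Module.End ℂ A} {I : Submodule ℂ A}
  {μ : ℂ} {v w : A}

theorem of_apply (h : T v - μ • v ∈ I) : IsGenEig T I μ v :=
  ⟨1, by simpa [Module.algebraMap_end_apply] using h⟩

theorem of_mem (h : v ∈ I) : IsGenEig T I μ v := ⟨0, by simpa using h⟩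

theorem exists_ge (hI : ∀ v ∈ I, T v ∈ I) (h : IsGenEig T I μ v) :
    ∃ K : ℕ, ∀ m ≥ K, aeval T ((X - C μ) ^ m) v ∈ I := by
  obtain ⟨K, hK⟩ := h
  refine ⟨K, fun m hm => ?_⟩
  obtain ⟨j, rfl⟩ := Nat.exists_eq_add_of_le' hm
  rw [pow_add, map_mul]
  exact aeval_mem_of_invariant hI _ hK

theorem add (hI : ∀ v ∈ I, T v ∈ I) (hv : IsGenEig T I μ v) (hw : IsGenEig T I μ w) :
    IsGenEig T I μ (v + w) := by
  obtain ⟨K, hK⟩ := hv.exists_ge hI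
  obtain ⟨L, hL⟩ := hw.exists_ge hI
  refine ⟨max K L, ?_⟩
  rw [map_add]
  exact I.add_mem (hK _ (le_max_left _ _)) (hL _ (le_max_right _ _))

theorem smul (c : ℂ) (hv : IsGenEig T I μ v) : IsGenEig T I μ (c • v) := by
  obtain ⟨K, hK⟩ := hv
  exact ⟨K, by rw [map_smul]; exact I.smul_mem c hK⟩

theorem sum (hI : ∀ v ∈ I, T v ∈ I) {ι : Type} {s : Finset ι} {v : ι → A}
    (hv : ∀ i ∈ s, IsGenEig T I μ (v i)) : IsGenEig T I μ (∑ i ∈ s, v i) := by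
  classical
  induction s using Finset.induction_on with
  | empty => exact of_mem (by simp)
  | insert a s ha ih =>
    rw [Finset.sum_insert ha]
    exact add hI (hv _ (Finset.mem_insert_self _ _))
      (ih fun i hi => hv i (Finset.mem_insert_of_mem hi))

theorem aeval_apply (hI : ∀ v ∈ I, T v ∈ I) (hv : IsGenEig T I μ v) (P : ℂ[X]) :
    IsGenEig T I μ (aeval T P v) := by
  obtain ⟨K, hK⟩ := hv
  refine ⟨K, ?_⟩
  rw [← Module.End.mul_apply, ← map_mul, mul_comm, map_mul]
  exact aeval_mem_of_invariant hI _ hK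

/-- Bézout: `(X - μ)^K` and `Q` are coprime, so `Q(T)` is invertible on `v` modulo `I`, with an
inverse that is again a polynomial in `T`. -/
theorem exists_inverse (hI : ∀ v ∈ I, T v ∈ I) (hv : IsGenEig T I μ v) {Q : ℂ[X]}
    (hQ : Q.eval μ ≠ 0) : ∃ U : ℂ[X], v - aeval T (U * Q) v ∈ I := by
  obtain ⟨K, hK⟩ := hv
  have hc : IsCoprime (X - C μ) Q := by
    refine (Polynomial.irreducible_X_sub_C μ).coprime_iff_not_dvd.2 ?_
    rwa [Polynomial.dvd_iff_isRoot]
  obtain ⟨a, b, hab⟩ := hc.pow_left (m := K)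
  refine ⟨b, ?_⟩
  have : v - aeval T (b * Q) v = aeval T (a * (X - C μ) ^ K) v := by
    rw [eq_sub_of_add_eq hab, map_sub, map_one]
    rfl
  rw [this, map_mul]
  exact aeval_mem_of_invariant hI _ hK

end Module

section Algebra

variable {A : Type} [CommRing A] [Algebra ℂ A] {T : A →ₐ[ℂ] A} {I : Submodule ℂ A}

/-- The twisted Leibniz rule `(T - μν)(v w) = (T - μ)v · T w + μ v · (T - ν)w` lowers the nilpotency
order of one of the two factors at each application, so `K + L` applications suffice. -/
theorem mul (hI : ∀ v ∈ I, T v ∈ I) (hm : ∀ v, ∀ w ∈ I, v * w ∈ I) {μ ν : ℂ} {v w : A}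
    (hv : IsGenEig T.toLinearMap I μ v) (hw : IsGenEig T.toLinearMap I ν w) :
    IsGenEig T.toLinearMap I (μ * ν) (v * w) := by
  obtain ⟨K, hK⟩ := hv
  obtain ⟨L, hL⟩ := hw
  have key : ∀ n K L : ℕ, K + L = n → ∀ v w : A,
      aeval T.toLinearMap ((X - C μ) ^ K) v ∈ I → aeval T.toLinearMap ((X - C ν) ^ L) w ∈ I →
      aeval T.toLinearMap ((X - C (μ * ν)) ^ n) (v * w) ∈ I := by
    intro n
    induction n with
    | zero =>
      intro K L hKL v w hv hw
      obtain ⟨rfl, rfl⟩ : K = 0 ∧ L = 0 := by omega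
      simp only [pow_zero, map_one, Module.End.one_apply] at hw ⊢
      exact hm _ _ hw
    | succ n ih =>
      intro K L hKL v w hv hw
      have hI' : ∀ v ∈ I, T.toLinearMap v ∈ I := hI
      rcases K with _ | K
      · refine aeval_mem_of_invariant hI' _ ?_
        rw [mul_comm]
        exact hm _ _ (by simpa using hv)
      rcases L with _ | L
      · exact aeval_mem_of_invariant hI' _ (hm _ _ (by simpa using hw))
      have e : aeval T.toLinearMap (X - C (μ * ν)) (v * w) =
          aeval T.toLinearMap (X - C μ) v * T w + μ • (v * aeval T.toLinearMap (X - C ν) w) := by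
        simp only [map_sub, aeval_X, aeval_C, LinearMap.sub_apply, Module.algebraMap_end_apply,
          AlgHom.toLinearMap_apply, map_mul, sub_mul, mul_sub, smul_sub, smul_mul_assoc,
          mul_smul_comm]
        rw [Module.End.mul_apply, Module.algebraMap_end_apply, Module.algebraMap_end_apply]
        abel
      rw [pow_succ, map_mul (aeval T.toLinearMap),
            Module.End.mul_apply, e, map_add, map_smul]
      refine I.add_mem (ih K (L + 1) (by omega) _ _ ?_ ?_)
        (I.smul_mem _ (ih (K + 1) L (by omega) _ _ hv ?_))
      · rwa [pow_succ, map_mul] at hv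
      · have : aeval T.toLinearMap ((X - C ν) ^ (L + 1)) (T w) =
            aeval T.toLinearMap (X : ℂ[X]) (aeval T.toLinearMap ((X - C ν) ^ (L + 1)) w) := by
          rw [← Module.End.mul_apply, ← map_mul, mul_comm X, map_mul (aeval T.toLinearMap),
            Module.End.mul_apply, aeval_X]
          rfl
        rw [this]
        exact aeval_mem_of_invariant hI' _ hw
      · rwa [pow_succ, map_mul] at hw
  exact ⟨K + L, key _ K L rfl v w hK hL⟩

theorem prod (hI : ∀ v ∈ I, T v ∈ I) (hm : ∀ v, ∀ w ∈ I, v * w ∈ I) {ι : Type} {s : Finset ι}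
    {μ : ι → ℂ} {v : ι → A} (hv : ∀ i ∈ s, IsGenEig T.toLinearMap I (μ i) (v i)) :
    IsGenEig T.toLinearMap I (∏ i ∈ s, μ i) (∏ i ∈ s, v i) := by
  classical
  induction s using Finset.induction_on with
  | empty => exact of_apply (by simp)
  | insert a s ha ih =>
    rw [Finset.prod_insert ha, Finset.prod_insert ha]
    exact mul hI hm (hv _ (Finset.mem_insert_self _ _))
      (ih fun i hi => hv i (Finset.mem_insert_of_mem hi))

end Algebra

end IsGenEig

/-! ### Solvability and uniqueness at high order -/

namespace IsLyapunov

variable {d : ℕ} {f : Cn d → Cn d} {θ : ℝ} {V : Cn d → ℝ} {r C' : ℝ}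
  {hf : AnalyticAt ℂ f 0} {h0 : f 0 = 0}

/-- Over `ℂ` the polynomial splits, and the scalar cohomological equation is solved for one root
after another. -/
theorem exists_aeval_sub_mem_flat (h : IsLyapunov f θ V r C') {N : ℕ} {P : ℂ[X]} (hP : P ≠ 0)
    (hroots : ∀ μ ∈ P.roots, μ ≠ 0 ∧ θ ^ N < ‖μ‖) {v : An d} (hv : v ∈ An.vanishing d N) :
    ∃ w ∈ An.vanishing d N,
      aeval (An.pullback f hf h0).toLinearMap P w - v ∈ An.flat d := by
  have key : ∀ s : Multiset ℂ, (∀ μ ∈ s, μ ≠ 0 ∧ θ ^ N < ‖μ‖) → ∀ v ∈ An.vanishing d N,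
      ∃ w ∈ An.vanishing d N,
        aeval (An.pullback f hf h0).toLinearMap (s.map fun μ => X - C μ).prod w - v
          ∈ An.flat d := by
    intro s
    induction s using Multiset.induction_on with
    | empty => intro _ v hv; exact ⟨v, hv, by simp⟩
    | cons μ s ih =>
      intro hs v hv
      obtain ⟨u, hu, huv⟩ := ih (fun μ hμ => hs μ (Multiset.mem_cons_of_mem hμ)) v hv
      obtain ⟨hμ, hμN⟩ := hs μ (Multiset.mem_cons_self _ _)
      obtain ⟨w, hwa, hwN, hw⟩ := h.exists_cohomological hμ hμN u.2 hu
      refine ⟨⟨w, hwa⟩, hwN, ?_⟩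
      have h1 : aeval (An.pullback f hf h0).toLinearMap (X - C μ) (⟨w, hwa⟩ : An d) - u
          ∈ An.flat d := by
        filter_upwards [hw] with x hx
        have : w (f x) - μ * w x - (u : Cn d → ℂ) x = 0 := sub_eq_zero.2 hx
        simpa [An.pullback_apply, Module.algebraMap_end_apply] using this
      rw [Multiset.map_cons, Multiset.prod_cons, mul_comm, map_mul, Module.End.mul_apply]
      have h2 := aeval_mem_of_invariant (An.flat_invariant hf h0) (s.map fun μ => X - C μ).prod h1
      have h3 := (An.flat d).add_mem h2 huv
      rw [map_sub, sub_add_sub_cancel] at h3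
      exact h3
  have hc : P.leadingCoeff ≠ 0 := leadingCoeff_ne_zero.2 hP
  obtain ⟨w, hw, hwv⟩ := key P.roots hroots (P.leadingCoeff⁻¹ • v)
    ((An.vanishing d N).smul_mem _ hv)
  refine ⟨w, hw, ?_⟩
  rw [(IsAlgClosed.splits P).eq_prod_roots, map_mul, aeval_C, Module.End.mul_apply,
    Module.algebraMap_end_apply]
  have := (An.flat d).smul_mem P.leadingCoeff hwv
  rwa [smul_sub, smul_smul, mul_inv_cancel₀ hc, one_smul] at this

theorem mem_flat_of_isGenEig (h : IsLyapunov f θ V r C') {N : ℕ} {μ : ℂ} (hμ : μ ≠ 0)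
    (hμN : θ ^ N < ‖μ‖) {v : An d} (hv : v ∈ An.vanishing d N)
    (hg : IsGenEig (An.pullback f hf h0).toLinearMap (An.flat d) μ v) : v ∈ An.flat d := by
  obtain ⟨K, hK⟩ := hg
  induction K generalizing v with
  | zero => simpa using hK
  | succ K ih =>
    rw [pow_succ, map_mul, Module.End.mul_apply] at hK
    have h1 := ih (aeval_mem_of_invariant (An.vanishing_invariant hf h0 N) _ hv) hK
    refine h.eventually_eq_zero hμ hμN v.2 hv ?_
    filter_upwards [h1] with x hx
    simpa [An.pullback_apply, Module.algebraMap_end_apply] using hx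

end IsLyapunov

/-! ### Finite jets, differentials and lifting of eigencovectors -/

namespace An

variable {d : ℕ}

/-- The coordinate functions. -/
noncomputable def coord (i : Fin d) : An d := ⟨fun x => x i, by
  exact (ContinuousLinearMap.proj (R := ℂ) (φ := fun _ : Fin d => ℂ) i).analyticAt 0⟩

theorem coord_isLocalBiholomorphism :
    IsLocalBiholomorphism fun (x : Cn d) i => ((coord i : An d) : Cn d → ℂ) x :=
  ⟨analyticAt_id, rfl, ContinuousLinearEquiv.refl ℂ _, hasFDerivAt_id _⟩

theorem exists_fg_sup_vanishing (d N : ℕ) :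
    ∃ S : Submodule ℂ (An d), S.FG ∧ S ⊔ vanishing d N = ⊤ := by
  induction N with
  | zero => exact ⟨⊥, Submodule.fg_bot, by rw [vanishing_zero, sup_top_eq]⟩
  | succ N ih =>
    obtain ⟨S, hS, hST⟩ := ih
    let B : Submodule ℂ (An d) :=
      Submodule.span ℂ (Set.range fun r : Fin N → Fin d => ∏ i, coord (r i))
    refine ⟨S ⊔ B, hS.sup (Submodule.fg_span (Set.finite_range _)), ?_⟩
    have h : vanishing d N ≤ B ⊔ vanishing d (N + 1) := by
      intro v hv
      obtain ⟨c, hc⟩ := exists_homogeneous coord_isLocalBiholomorphism hv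
      rw [← add_sub_cancel (∑ r, c r • ∏ i, coord (r i)) v]
      exact Submodule.add_mem_sup (Submodule.sum_mem _ fun r _ =>
        Submodule.smul_mem _ _ (Submodule.subset_span ⟨r, rfl⟩)) hc
    rw [eq_top_iff, sup_assoc, ← hST]
    exact sup_le_sup_left h S

/-- `f^*` acts on the finite-dimensional space of jets of order below `N`; Cayley–Hamilton there
provides the polynomial. -/
theorem exists_aeval_mem_vanishing {f : Cn d → Cn d} (hf : AnalyticAt ℂ f 0) (h0 : f 0 = 0)
    (N : ℕ) :
    ∃ P : ℂ[X], P ≠ 0 ∧ ∀ v, aeval (pullback f hf h0).toLinearMap P v ∈ vanishing d N := by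
  set T := (pullback f hf h0).toLinearMap with hT
  obtain ⟨S, hS, hST⟩ := exists_fg_sup_vanishing d N
  have hfin : Module.Finite ℂ (An d ⧸ vanishing d N) := by
    have : Module.Finite ℂ S := Module.Finite.iff_fg.2 hS
    refine Module.Finite.of_surjective ((vanishing d N).mkQ ∘ₗ S.subtype) ?_
    intro q
    obtain ⟨v, rfl⟩ := Submodule.mkQ_surjective _ q
    obtain ⟨s, hs, t, ht, rfl⟩ := Submodule.mem_sup.1 (hST ▸ Submodule.mem_top : v ∈ S ⊔ _)
    refine ⟨⟨s, hs⟩, ?_⟩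
    simp [(Submodule.Quotient.mk_eq_zero _).2 ht]
  let Q : Module.End ℂ (An d ⧸ vanishing d N) :=
    (vanishing d N).mapQ (vanishing d N) T (vanishing_invariant hf h0 N)
  have hQ : ∀ (P : ℂ[X]) v, (vanishing d N).mkQ (aeval T P v) =
      aeval Q P ((vanishing d N).mkQ v) := by
    intro P v
    induction P using Polynomial.induction_on' with
    | add p q hp hq => simp only [map_add, LinearMap.add_apply, hp, hq]
    | monomial n a =>
      have : ∀ n : ℕ, (vanishing d N).mkQ ((T ^ n) v) = (Q ^ n) ((vanishing d N).mkQ v) := by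
        intro n
        induction n with
        | zero => rfl
        | succ n ih =>
          rw [pow_succ', pow_succ', Module.End.mul_apply, Module.End.mul_apply, ← ih]
          rfl
      rw [aeval_monomial, aeval_monomial, Module.End.mul_apply, Module.End.mul_apply,
        Module.algebraMap_end_apply, Module.algebraMap_end_apply, map_smul, this]
  refine ⟨Q.charpoly, Q.charpoly_monic.ne_zero, fun v => ?_⟩
  have := hQ Q.charpoly v
  rw [LinearMap.aeval_self_charpoly] at this
  exact (Submodule.Quotient.mk_eq_zero _).1 this

/-- The differential at the origin. -/
noncomputable def differential (d : ℕ) : An d →ₗ[ℂ] (Cn d →L[ℂ] ℂ) where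
  toFun v := fderiv ℂ (v : Cn d → ℂ) 0
  map_add' v w := fderiv_add (analyticAt v).differentiableAt (analyticAt w).differentiableAt
  map_smul' c v := fderiv_const_smul (analyticAt v).differentiableAt c

theorem differential_apply (v : An d) : differential d v = fderiv ℂ (v : Cn d → ℂ) 0 := rfl

theorem hasFDerivAt (v : An d) : HasFDerivAt (v : Cn d → ℂ) (differential d v) 0 :=
  (analyticAt v).differentiableAt.hasFDerivAt

theorem differential_eq_zero {v : An d} (hv : v ∈ vanishing d 2) : differential d v = 0 := by
  have h : (v : Cn d → ℂ) =O[𝓝 0] fun x => ‖x - 0‖ ^ 2 := by simpa using mem_vanishing.1 hv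
  exact (h.hasFDerivAt one_lt_two).fderiv

theorem mem_vanishing_two {v : An d} (hv : v ∈ vanishing d 1) (hd : differential d v = 0) :
    v ∈ vanishing d 2 := by
  refine (analyticAt v).isBigO_succ_of_isLittleO ?_
  have h := (hasFDerivAt v).isLittleO
  rw [hd, mem_vanishing_one.1 hv] at h
  simpa using h.norm_right

theorem differential_mul_of_left {v w : An d} (hv : v ∈ vanishing d 1) :
    differential d (v * w) = (w : Cn d → ℂ) 0 • differential d v := by
  have := ((hasFDerivAt v).mul (hasFDerivAt w)).fderiv
  rw [mem_vanishing_one.1 hv] at this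
  refine this.trans ?_
  ext x
  simp

/-- The transpose of a linear map, acting on the dual space. -/
noncomputable def transpose (L : Cn d →L[ℂ] Cn d) : Module.End ℂ (Cn d →L[ℂ] ℂ) where
  toFun ξ := ξ.comp L
  map_add' _ _ := rfl
  map_smul' _ _ := rfl

theorem transpose_apply (L : Cn d →L[ℂ] Cn d) (ξ : Cn d →L[ℂ] ℂ) :
    transpose L ξ = ξ.comp L := rfl

theorem differential_pullback {f : Cn d → Cn d} (hf : AnalyticAt ℂ f 0) (h0 : f 0 = 0)
    (v : An d) : differential d (pullback f hf h0 v) =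
      transpose (fderiv ℂ f 0) (differential d v) := by
  have h1 : HasFDerivAt (v : Cn d → ℂ) (differential d v) (f 0) := h0.symm ▸ hasFDerivAt v
  exact (h1.comp 0 hf.differentiableAt.hasFDerivAt).fderiv

theorem differential_aeval {f : Cn d → Cn d} (hf : AnalyticAt ℂ f 0) (h0 : f 0 = 0)
    (P : ℂ[X]) (v : An d) : differential d (aeval (pullback f hf h0).toLinearMap P v) =
      aeval (transpose (fderiv ℂ f 0)) P (differential d v) := by
  induction P using Polynomial.induction_on' with
  | add p q hp hq => simp only [map_add, LinearMap.add_apply, hp, hq]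
  | monomial n a =>
    have : ∀ n : ℕ, differential d (((pullback f hf h0).toLinearMap ^ n) v) =
        (transpose (fderiv ℂ f 0) ^ n) (differential d v) := by
      intro n
      induction n with
      | zero => rfl
      | succ n ih =>
        rw [pow_succ', pow_succ', Module.End.mul_apply, Module.End.mul_apply, ← ih]
        exact differential_pullback hf h0 _
    rw [aeval_monomial, aeval_monomial, Module.End.mul_apply, Module.End.mul_apply,
      Module.algebraMap_end_apply, Module.algebraMap_end_apply, map_smul, this]

/-- A covector, as a germ. -/
noncomputable def ofCovector (ξ : Cn d →L[ℂ] ℂ) : An d := ⟨ξ, ξ.analyticAt 0⟩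

theorem differential_ofCovector (ξ : Cn d →L[ℂ] ℂ) : differential d (ofCovector ξ) = ξ :=
  ξ.fderiv

theorem ofCovector_mem (ξ : Cn d →L[ℂ] ℂ) : ofCovector ξ ∈ vanishing d 1 :=
  mem_vanishing_one.2 (map_zero ξ)

end An

theorem IsLyapunov.exists_pow_lt {d : ℕ} {f : Cn d → Cn d} {θ : ℝ} {V : Cn d → ℝ} {r C : ℝ}
    (h : IsLyapunov f θ V r C) {μ : ℂ} (hμ : μ ≠ 0) : ∃ N, ∀ n ≥ N, θ ^ n < ‖μ‖ := by
  obtain ⟨N, hN⟩ := exists_pow_lt_of_lt_one (norm_pos_iff.2 hμ) h.rate_lt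
  exact ⟨N, fun n hn => (pow_le_pow_of_le_one h.rate_pos.le h.rate_lt.le hn).trans_lt hN⟩

/-- Generalized eigencovectors of `df₀` lift to generalized eigenfunctions of `f^*`. -/
theorem IsLyapunov.exists_lift {d : ℕ} {f : Cn d → Cn d} {θ : ℝ} {V : Cn d → ℝ} {r C' : ℝ}
    (h : IsLyapunov f θ V r C') (hf : AnalyticAt ℂ f 0) (h0 : f 0 = 0) {μ : ℂ} (hμ : μ ≠ 0)
    {ξ : Cn d →L[ℂ] ℂ}
    (hξ : ξ ∈ Module.End.maxGenEigenspace (An.transpose (fderiv ℂ f 0)) μ) :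
    ∃ x ∈ An.vanishing d 1, An.differential d x = ξ ∧
      IsGenEig (An.pullback f hf h0).toLinearMap (An.flat d) μ x := by
  set T := (An.pullback f hf h0).toLinearMap with hT
  obtain ⟨N₀, hN₀⟩ := h.exists_pow_lt hμ
  -- `N₀` makes the cohomological equation solvable; order at least `2` ensures that the correction
  -- leaves the differential unchanged.
  set N := max N₀ 2 with hN
  have hNμ : θ ^ N < ‖μ‖ := hN₀ _ (le_max_left _ _)
  obtain ⟨P, hP, hPT⟩ := An.exists_aeval_mem_vanishing hf h0 N
  obtain ⟨a, Q, hPQ, hQ⟩ : ∃ (a : ℕ) (Q : ℂ[X]), P = (X - C μ) ^ a * Q ∧ ¬ X - C μ ∣ Q :=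
    ⟨_, P.exists_eq_pow_rootMultiplicity_mul_and_not_dvd hP μ⟩
  obtain ⟨k, hk⟩ := (Module.End.mem_maxGenEigenspace _ _ _).1 hξ
  have hk' : aeval (An.transpose (fderiv ℂ f 0)) ((X - C μ) ^ k) ξ = 0 := by
    rw [map_pow, map_sub, aeval_X, aeval_C]
    exact hk
  obtain ⟨A, B, hAB⟩ := ((Polynomial.irreducible_X_sub_C μ).coprime_iff_not_dvd.2 hQ).pow_left
    (m := a + k)
  -- `B * Q` acts as the projection to the `μ`-part of the jets. It fixes `ξ`, because `1 - B * Q`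
  -- is a multiple of `(X - μ)^k`, and `(X - μ)^(a + k) * (B * Q)` is a multiple of `P`, hence kills
  -- jets.
  let x₁ := aeval T (B * Q) (An.ofCovector ξ)
  have hx₁ : An.differential d x₁ = ξ := by
    rw [An.differential_aeval, An.differential_ofCovector, eq_sub_of_add_eq' hAB, map_sub, map_one,
      pow_add, ← mul_assoc, map_mul, LinearMap.sub_apply, Module.End.mul_apply, hk', map_zero,
      sub_zero]
    rfl
  have hx₁1 : x₁ ∈ An.vanishing d 1 :=
    aeval_mem_of_invariant (An.vanishing_invariant hf h0 1) _ (An.ofCovector_mem ξ)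
  have hx₁N : aeval T ((X - C μ) ^ (a + k)) x₁ ∈ An.vanishing d N := by
    have : aeval T ((X - C μ) ^ (a + k)) x₁ =
        aeval T (B * (X - C μ) ^ k) (aeval T P (An.ofCovector ξ)) := by
      have e : (X - C μ) ^ (a + k) * (B * Q) = B * (X - C μ) ^ k * P := by rw [hPQ]; ring
      simp only [x₁]
      rw [← Module.End.mul_apply, ← map_mul, ← Module.End.mul_apply, ← map_mul, e]
    rw [this]
    exact aeval_mem_of_invariant (An.vanishing_invariant hf h0 N) _ (hPT _)
  -- Subtracting `w` turns the generalized eigenfunction modulo order `N` into a genuine one.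
  obtain ⟨w, hw, hwf⟩ := h.exists_aeval_sub_mem_flat (hf := hf) (h0 := h0)
    (P := (X - C μ) ^ (a + k)) (pow_ne_zero _ (X_sub_C_ne_zero μ))
    (fun ν hν => by
      rw [roots_pow, roots_X_sub_C] at hν
      obtain rfl : ν = μ := by simpa using Multiset.mem_of_mem_nsmul hν
      exact ⟨hμ, hNμ⟩) hx₁N
  refine ⟨x₁ - w, Submodule.sub_mem _ hx₁1
    (An.vanishing_anti (show 1 ≤ N from le_trans (by norm_num) (le_max_right _ 2)) hw),
    ?_, a + k, ?_⟩
  · rw [map_sub, hx₁, An.differential_eq_zero (An.vanishing_anti (le_max_right _ 2) hw), sub_zero]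
  · rw [map_sub]
    have := (An.flat d).neg_mem hwf
    rwa [neg_sub] at this

/-! ### Resonances in adapted coordinates -/

/-- Coordinates adapted to a contracting germ: the `x k` are generalized eigenfunctions for the
non-zero eigenvalues `lam k`, and the pullbacks of the `w j` vanish to order two. -/
structure IsAdapted {d s : ℕ} {κ : Type} [Fintype κ] (T : An d →ₐ[ℂ] An d) (lam : Cn s)
    (x : Fin s → An d) (w : κ → An d) : Prop where
  coords : IsLocalBiholomorphism fun (p : Cn d) i => ((Sum.elim x w i : An d) : Cn d → ℂ) p
  lam_ne : ∀ k, lam k ≠ 0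
  genEig : ∀ k, IsGenEig T.toLinearMap (An.flat d) (lam k) (x k)
  nilp : ∀ j, T (w j) ∈ An.vanishing d 2

namespace IsAdapted

variable {d s : ℕ} {κ : Type} {f : Cn d → Cn d} {hf : AnalyticAt ℂ f 0} {h0 : f 0 = 0}
  {lam : Cn s} {x : Fin s → An d} {w : κ → An d}

/-- The coordinates `w` carry the weight `0`, so a word of non-zero weight involves only the `x k`
and is a genuine monomial in `x`. -/
theorem exists_polynomial_monomial {n : ℕ} (r : Fin n → Fin s ⊕ κ)
    (hr : ∏ i, Sum.elim lam (0 : κ → ℂ) (r i) ≠ 0) :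
    ∃ a : Fin s →₀ ℕ, a.degree = n ∧ powMonomial lam a = ∏ i, Sum.elim lam (0 : κ → ℂ) (r i) ∧
      MvPolynomial.aeval x (MvPolynomial.monomial a (1 : ℂ)) = ∏ i, Sum.elim x w (r i) := by
  have h1 : ∀ i, ∃ k, r i = Sum.inl k := by
    intro i
    rcases hri : r i with k | j
    · exact ⟨k, rfl⟩
    · exact (Finset.prod_ne_zero_iff.1 hr i (Finset.mem_univ i) (by simp [hri])).elim
  choose ρ hρ using h1
  refine ⟨∑ i, Finsupp.single (ρ i) 1, ?_, ?_, ?_⟩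
  · rw [map_sum]
    simp
  · simp only [hρ, Sum.elim_inl, powMonomial]
    simp only [Finsupp.coe_finsetSum, Finset.sum_apply]
    simp_rw [← Finset.prod_pow_eq_pow_sum]
    rw [Finset.prod_comm]
    refine Finset.prod_congr rfl fun i _ => ?_
    rw [Finset.prod_eq_single (ρ i)]
    · simp
    · intro b _ hb
      simp [hb.symm]
    · simp
  · have : (MvPolynomial.monomial (∑ i, Finsupp.single (ρ i) 1) (1 : ℂ)) =
        ∏ i, MvPolynomial.X (ρ i) := by
      rw [MvPolynomial.monomial_sum_one]
      rfl
    rw [this, map_prod]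
    simp [hρ]

variable [Fintype κ]

theorem mem_vanishing {T : An d →ₐ[ℂ] An d} (h : IsAdapted T lam x w) (i : Fin s ⊕ κ) :
    Sum.elim x w i ∈ An.vanishing d 1 :=
  An.mem_vanishing_one.2 (congrFun h.coords.map_zero i)

/-- If some `w j` occurs, `f^*` raises the order of the monomial, because `f^* (w j)` has order two:
the weight is `0` modulo order `n + 1`. Otherwise the product rule for generalized eigenvectors
applies. -/
theorem genEig_monomial (h : IsAdapted (An.pullback f hf h0) lam x w) {n : ℕ}
    (r : Fin n → Fin s ⊕ κ) :
    IsGenEig (An.pullback f hf h0).toLinearMap (An.vanishing d (n + 1))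
      (∏ i, Sum.elim lam 0 (r i)) (∏ i, Sum.elim x w (r i)) := by
  by_cases hr : ∃ i j, r i = Sum.inr j
  · obtain ⟨i, j, hij⟩ := hr
    have h1 : ∏ i, Sum.elim lam (0 : κ → ℂ) (r i) = 0 :=
      Finset.prod_eq_zero (Finset.mem_univ i) (by simp [hij])
    rw [h1]
    refine IsGenEig.of_apply ?_
    rw [zero_smul, sub_zero]
    simp only [AlgHom.toLinearMap_apply, map_prod]
    rw [← Finset.mul_prod_erase _ _ (Finset.mem_univ i)]
    have h2 := An.prod_mem_vanishing (s := Finset.univ.erase i)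
      (X := fun i => An.pullback f hf h0 (Sum.elim x w (r i)))
      fun i _ => An.pullback_mem_vanishing (h.mem_vanishing (r i))
    have h3 : An.pullback f hf h0 (Sum.elim x w (r i)) ∈ An.vanishing d 2 := by
      rw [hij]; exact h.nilp j
    have h4 := An.mul_mem_vanishing h3 h2
    rw [Finset.card_erase_of_mem (Finset.mem_univ i), Finset.card_univ, Fintype.card_fin] at h4
    have : 2 + (n - 1) = n + 1 := by have := i.pos; omega
    rwa [this] at h4
  · push Not at hr
    have h1 := IsGenEig.prod (T := An.pullback f hf h0) (An.flat_invariant hf h0)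
      (fun v w hw => An.mul_mem_flat v hw) (s := Finset.univ)
      (μ := fun i => Sum.elim lam (0 : κ → ℂ) (r i)) (v := fun i => Sum.elim x w (r i)) (by
        intro i _
        rcases hri : r i with k | j
        · simpa using h.genEig k
        · exact (hr i j hri).elim)
    obtain ⟨K, hK⟩ := h1
    exact ⟨K, An.flat_le_vanishing _ hK⟩

theorem genEig_aeval (h : IsAdapted (An.pullback f hf h0) lam x w) {μ : ℂ}
    {G : MvPolynomial (Fin s) ℂ}
    (hG : G ∈ MvPolynomial.restrictSupport ℂ {a | powMonomial lam a = μ}) :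
    IsGenEig (An.pullback f hf h0).toLinearMap (An.flat d) μ (MvPolynomial.aeval x G) := by
  have h1 : ∀ a : Fin s →₀ ℕ, powMonomial lam a = μ →
      IsGenEig (An.pullback f hf h0).toLinearMap (An.flat d) μ (∏ k, x k ^ a k) := by
    rintro a rfl
    have hpow : ∀ k n, IsGenEig (An.pullback f hf h0).toLinearMap (An.flat d) (lam k ^ n)
        (x k ^ n) := by
      intro k n
      induction n with
      | zero => exact IsGenEig.of_apply (by simp)
      | succ n ih =>
        rw [pow_succ, pow_succ]
        exact IsGenEig.mul (T := An.pullback f hf h0) (An.flat_invariant hf h0)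
          (fun v w hw => An.mul_mem_flat v hw)
          ih (h.genEig k)
    exact IsGenEig.prod (T := An.pullback f hf h0) (s := Finset.univ) (μ := fun k => lam k ^ a k)
      (v := fun k => x k ^ a k)
      (An.flat_invariant hf h0)
          (fun v w hw => An.mul_mem_flat v hw) fun k _ => hpow k (a k)
  rw [MvPolynomial.aeval_def, MvPolynomial.eval₂_eq']
  refine IsGenEig.sum (An.flat_invariant hf h0) fun a ha => ?_
  rw [← Algebra.smul_def]
  exact IsGenEig.smul _ (h1 a ((MvPolynomial.mem_restrictSupport_iff ℂ).1 hG ha))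

/-- Once the words of weight `μ` are subtracted from the leading form, the remainder is a
generalized eigenvector for `μ` and also a combination of words of other weights. A polynomial `Q`
with `Q(μ) ≠ 0` kills it modulo order `n + 1`, so it vanishes to that order. -/
theorem exists_sub_mem_vanishing_succ (h : IsAdapted (An.pullback f hf h0) lam x w) {μ : ℂ}
    (hμ : μ ≠ 0) {n : ℕ} {v : An d} (hv : v ∈ An.vanishing d n)
    (hg : IsGenEig (An.pullback f hf h0).toLinearMap (An.flat d) μ v) :
    ∃ G ∈ MvPolynomial.restrictSupport ℂ {a | powMonomial lam a = μ},
      v - MvPolynomial.aeval x G ∈ An.vanishing d (n + 1) := by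
  classical
  set T := (An.pullback f hf h0).toLinearMap with hT
  have hI := An.vanishing_invariant hf h0 (n + 1)
  obtain ⟨c, hc⟩ := An.exists_homogeneous h.coords hv
  set Λ : (Fin n → Fin s ⊕ κ) → ℂ := fun r => ∏ i, Sum.elim lam (0 : κ → ℂ) (r i) with hΛ
  have hpoly : ∀ r, ∃ G ∈ MvPolynomial.restrictSupport ℂ {a | powMonomial lam a = μ},
      Λ r = μ → MvPolynomial.aeval x G = c r • ∏ i, Sum.elim x w (r i) := by
    intro r
    by_cases hr : Λ r = μ
    · obtain ⟨a, -, ha, hax⟩ := exists_polynomial_monomial (x := x) (w := w) r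
        (show Λ r ≠ 0 by rw [hr]; exact hμ)
      refine ⟨c r • MvPolynomial.monomial a 1, Submodule.smul_mem _ _
        (MvPolynomial.monomial_mem_restrictSupport ℂ |>.2 (Or.inl (ha.trans hr))), fun _ => ?_⟩
      rw [map_smul, hax]
    · exact ⟨0, Submodule.zero_mem _, fun h => (hr h).elim⟩
  choose G hG hGx using hpoly
  refine ⟨∑ r with Λ r = μ, G r, Submodule.sum_mem _ fun r _ => hG r, ?_⟩
  have hGG := Submodule.sum_mem (t := Finset.univ.filter fun r => Λ r = μ)
    (MvPolynomial.restrictSupport ℂ {a | powMonomial lam a = μ}) fun r _ => hG r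
  set δ := v - MvPolynomial.aeval x (∑ r with Λ r = μ, G r) with hδ
  have hδg : IsGenEig T (An.vanishing d (n + 1)) μ δ := by
    have h1 : IsGenEig T (An.flat d) μ δ := by
      rw [hδ, sub_eq_add_neg, ← neg_one_smul ℂ]
      exact hg.add (An.flat_invariant hf h0) ((h.genEig_aeval hGG).smul _)
    obtain ⟨K, hK⟩ := h1
    exact ⟨K, An.flat_le_vanishing _ hK⟩
  have hδ2 : δ - ∑ r with Λ r ≠ μ, c r • ∏ i, Sum.elim x w (r i) ∈ An.vanishing d (n + 1) := by
    have : δ - ∑ r with Λ r ≠ μ, c r • ∏ i, Sum.elim x w (r i) =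
        v - ∑ r, c r • ∏ i, Sum.elim x w (r i) := by
      rw [hδ, map_sum, ← Finset.sum_filter_add_sum_filter_not Finset.univ (fun r => Λ r = μ)
        (fun r => c r • ∏ i, Sum.elim x w (r i)),
        Finset.sum_congr rfl fun r hr => hGx r (Finset.mem_filter.1 hr).2]
      abel
    rw [this]
    exact hc
  choose K hK using fun r => h.genEig_monomial (n := n) r
  let Q : ℂ[X] := ∏ r with Λ r ≠ μ, (X - C (Λ r)) ^ K r
  have hQμ : Q.eval μ ≠ 0 := by
    rw [Polynomial.eval_prod]
    refine Finset.prod_ne_zero_iff.2 fun r hr => ?_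
    simp only [eval_pow, eval_sub, eval_X, eval_C]
    exact pow_ne_zero _ (sub_ne_zero.2 (Finset.mem_filter.1 hr).2.symm)
  have hQδ : aeval T Q δ ∈ An.vanishing d (n + 1) := by
    rw [← sub_add_cancel δ (∑ r with Λ r ≠ μ, c r • ∏ i, Sum.elim x w (r i)), map_add]
    refine Submodule.add_mem _ (aeval_mem_of_invariant hI _ hδ2) ?_
    rw [map_sum]
    refine Submodule.sum_mem _ fun r hr => ?_
    rw [map_smul]
    refine Submodule.smul_mem _ _ ?_
    simp only [Q]
    rw [← Finset.prod_erase_mul _ _ hr, map_mul, Module.End.mul_apply]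
    exact aeval_mem_of_invariant hI _ (hK r)
  obtain ⟨U, hU⟩ := hδg.exists_inverse hI hQμ
  rw [map_mul, Module.End.mul_apply] at hU
  have := Submodule.add_mem _ hU (aeval_mem_of_invariant hI U hQδ)
  rwa [sub_add_cancel] at this

/-- Generalized eigenfunctions are resonant polynomials in the adapted coordinates. -/
theorem exists_sub_mem_flat (h : IsAdapted (An.pullback f hf h0) lam x w)
    {θ : ℝ} {V : Cn d → ℝ} {r C' : ℝ} (hL : IsLyapunov f θ V r C') {μ : ℂ}
    (hμ : μ ≠ 0) {v : An d}
    (hg : IsGenEig (An.pullback f hf h0).toLinearMap (An.flat d) μ v) :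
    ∃ G ∈ MvPolynomial.restrictSupport ℂ {a | powMonomial lam a = μ},
      v - MvPolynomial.aeval x G ∈ An.flat d := by
  have hgen : ∀ G ∈ MvPolynomial.restrictSupport ℂ {a | powMonomial lam a = μ},
      IsGenEig (An.pullback f hf h0).toLinearMap (An.flat d) μ (v - MvPolynomial.aeval x G) := by
    intro G hG
    rw [sub_eq_add_neg, ← neg_one_smul ℂ]
    exact hg.add (An.flat_invariant hf h0) ((h.genEig_aeval hG).smul _)
  have key : ∀ n, ∃ G ∈ MvPolynomial.restrictSupport ℂ {a | powMonomial lam a = μ},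
      v - MvPolynomial.aeval x G ∈ An.vanishing d n := by
    intro n
    induction n with
    | zero => exact ⟨0, Submodule.zero_mem _, by rw [An.vanishing_zero]; trivial⟩
    | succ n ih =>
      obtain ⟨G, hG, hGv⟩ := ih
      obtain ⟨G', hG', hGv'⟩ := h.exists_sub_mem_vanishing_succ hμ hGv (hgen G hG)
      refine ⟨G + G', Submodule.add_mem _ hG hG', ?_⟩
      rwa [map_add, ← sub_sub]
  -- No limit is needed: a generalized eigenfunction for `μ` vanishing to order `N` is already flat,
  -- so the resonant polynomial found at step `N` is exact.
  obtain ⟨N, hN⟩ := hL.exists_pow_lt hμ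
  obtain ⟨G, hG, hGv⟩ := key N
  exact ⟨G, hG, hL.mem_flat_of_isGenEig hμ (hN N le_rfl) hGv (hgen G hG)⟩

/-- Modulo higher order terms, a germ is the sum of a polynomial in the monomials whose eigenvalue
is a root of `χ`, and an element of the range of `χ(f^*)`. -/
theorem exists_resonant_decomposition (h : IsAdapted (An.pullback f hf h0) lam x w) {χ : ℂ[X]}
    (hχ : χ.eval 0 ≠ 0) {n : ℕ} {v : An d} (hv : v ∈ An.vanishing d n) :
    ∃ G ∈ MvPolynomial.restrictSupport ℂ {a | a.degree = n ∧ χ.eval (powMonomial lam a) = 0},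
      ∃ w ∈ An.vanishing d n,
        v - MvPolynomial.aeval x G - aeval (An.pullback f hf h0).toLinearMap χ w ∈
          An.vanishing d (n + 1) := by
  set T := (An.pullback f hf h0).toLinearMap with hT
  have hI := An.vanishing_invariant hf h0 (n + 1)
  obtain ⟨c, hc⟩ := An.exists_homogeneous h.coords hv
  have hr : ∀ r : Fin n → Fin s ⊕ κ,
      ∃ G ∈ MvPolynomial.restrictSupport ℂ {a | a.degree = n ∧ χ.eval (powMonomial lam a) = 0},
      ∃ u ∈ An.vanishing d n,
        ∏ i, Sum.elim x w (r i) - MvPolynomial.aeval x G - aeval T χ u ∈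
          An.vanishing d (n + 1) := by
    intro r
    -- A word whose weight is a root of `χ` goes into `G`; `χ(0) ≠ 0` guarantees that it is a
    -- monomial in `x`. On any other word `χ(f^*)` is invertible modulo higher order.
    by_cases hr : χ.eval (∏ i, Sum.elim lam (0 : κ → ℂ) (r i)) = 0
    · obtain ⟨a, ha, hal, hax⟩ := exists_polynomial_monomial (x := x) (w := w) r
        (fun h => hχ (by rwa [h] at hr))
      refine ⟨MvPolynomial.monomial a 1, MvPolynomial.monomial_mem_restrictSupport ℂ |>.2
        (Or.inl ⟨ha, hal ▸ hr⟩), 0, Submodule.zero_mem _, ?_⟩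
      rw [hax, map_zero, sub_zero, sub_self]
      exact Submodule.zero_mem _
    · obtain ⟨U, hU⟩ := (h.genEig_monomial r).exists_inverse hI hr
      refine ⟨0, Submodule.zero_mem _, aeval T U (∏ i, Sum.elim x w (r i)), ?_, ?_⟩
      · refine aeval_mem_of_invariant (An.vanishing_invariant hf h0 n) U ?_
        have := An.prod_mem_vanishing (s := (Finset.univ : Finset (Fin n)))
          (X := fun i => Sum.elim x w (r i)) fun i _ => h.mem_vanishing (r i)
        rwa [Finset.card_univ, Fintype.card_fin] at this
      · rw [map_zero, sub_zero, ← Module.End.mul_apply, ← map_mul, mul_comm]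
        exact hU
  choose G hG u hu hGu using hr
  refine ⟨∑ r, c r • G r, Submodule.sum_mem _ fun r _ => Submodule.smul_mem _ _ (hG r),
    ∑ r, c r • u r, Submodule.sum_mem _ fun r _ => Submodule.smul_mem _ _ (hu r), ?_⟩
  have h1 := Submodule.add_mem _ hc
    (Submodule.sum_mem _ fun r (_ : r ∈ Finset.univ) => Submodule.smul_mem _ (c r) (hGu r))
  convert h1 using 1
  simp only [map_sum, map_smul, smul_sub, Finset.sum_sub_distrib]
  abel

end IsAdapted

/-! ### Cramer's rule and the vector-valued cohomological equation -/

/-- `χ_B(T)` factors through `T - B`, by Cramer's rule. -/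
theorem Matrix.exists_apply_sub_eq_aeval_charpoly {A : Type} [AddCommGroup A] [Module ℂ A]
    (T : Module.End ℂ A) {p : ℕ} (B : Matrix (Fin p) (Fin p) ℂ) (W : Submodule ℂ A)
    (hW : ∀ v ∈ W, T v ∈ W) {w : Fin p → A} (hw : ∀ k, w k ∈ W) :
    ∃ φ : Fin p → A, (∀ k, φ k ∈ W) ∧
      ∀ i, T (φ i) - ∑ j, B i j • φ j = aeval T B.charpoly (w i) := by
  -- The vector `adj(X - B)(T) w`: the operator `T - B` is `X - B` evaluated at `T`, and `(X - B)
  -- adj(X - B) = χ_B`.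
  obtain ⟨φ, hφ⟩ : ∃ φ : Fin p → A,
      ∀ i, φ i = ∑ k, aeval T (B.charmatrix.adjugate i k) (w k) := ⟨_, fun _ => rfl⟩
  refine ⟨φ, fun i => hφ i ▸
    Submodule.sum_mem _ fun k _ => aeval_mem_of_invariant hW _ (hw k), fun i => ?_⟩
  have h1 : ∀ φ : Fin p → A, T (φ i) - ∑ j, B i j • φ j =
      ∑ j, aeval T (B.charmatrix i j) (φ j) := by
    intro φ
    simp only [Matrix.charmatrix_apply, map_sub, aeval_C, LinearMap.sub_apply,
      Module.algebraMap_end_apply, Finset.sum_sub_distrib]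
    congr 1
    rw [Finset.sum_eq_single i]
    · simp
    · intro j _ hj
      simp [Matrix.diagonal_apply_ne' _ hj]
    · simp
  rw [h1]
  simp_rw [hφ, map_sum, ← Module.End.mul_apply, ← map_mul]
  rw [Finset.sum_comm]
  have h2 : ∀ k, ∑ j, aeval T (B.charmatrix i j * B.charmatrix.adjugate j k) (w k) =
      aeval T ((B.charmatrix * B.charmatrix.adjugate) i k) (w k) := by
    intro k
    rw [Matrix.mul_apply, map_sum, LinearMap.sum_apply]
  simp_rw [h2, Matrix.mul_adjugate]
  rw [Finset.sum_eq_single i]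
  · simp [Matrix.charpoly]
  · intro k _ hk
    simp [Matrix.one_apply_ne' hk]
  · simp

namespace An

variable {d : ℕ}

/-- The germ of `log (1 + v)`. -/
noncomputable def logOneAdd (v : An d) (hv : v ∈ vanishing d 1) : An d :=
  ⟨fun y => Complex.log (1 + (v : Cn d → ℂ) y), by
    refine AnalyticAt.clog (analyticAt_const.add v.2) ?_
    rw [mem_vanishing_one.1 hv, add_zero]
    exact Complex.one_mem_slitPlane⟩

theorem logOneAdd_apply {v : An d} (hv : v ∈ vanishing d 1) (y : Cn d) :
    (logOneAdd v hv : Cn d → ℂ) y = Complex.log (1 + (v : Cn d → ℂ) y) := rfl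

/-- The logarithm is strictly differentiable at `1` with derivative `1`, so the error is `o(‖x‖ ^
n)`, and by analyticity it has order `n + 1`. -/
theorem logOneAdd_add_sub_mem {n : ℕ} {u v : An d} (hv : v ∈ vanishing d 1)
    (huv : v + u ∈ vanishing d 1) (hu : u ∈ vanishing d n) :
    logOneAdd (v + u) huv - logOneAdd v hv - u ∈ vanishing d (n + 1) := by
  refine AnalyticAt.isBigO_succ_of_isLittleO (logOneAdd (v + u) huv - logOneAdd v hv - u).2 ?_
  have h1 := (Complex.hasStrictDerivAt_log Complex.one_mem_slitPlane).isLittleO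
  have ht : ∀ {v : An d}, v ∈ vanishing d 1 →
      Tendsto (fun y => 1 + (v : Cn d → ℂ) y) (𝓝 0) (𝓝 1) := by
    intro v hv
    have := (analyticAt v).continuousAt.tendsto.const_add 1
    rwa [mem_vanishing_one.1 hv, add_zero] at this
  have h2 := h1.comp_tendsto ((ht huv).prodMk_nhds (ht hv))
  have h3 : ((fun q : ℂ × ℂ => q.1 - q.2) ∘ fun y => (1 + ((v + u : An d) : Cn d → ℂ) y,
      1 + (v : Cn d → ℂ) y)) = (u : Cn d → ℂ) := by
    funext y
    simp
  rw [h3] at h2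
  refine (h2.trans_isBigO hu).congr_left fun y => ?_
  simp [logOneAdd_apply]

end An

namespace IsAdapted

variable {d s p : ℕ} {κ : Type} [Fintype κ] {f : Cn d → Cn d} {hf : AnalyticAt ℂ f 0}
  {h0 : f 0 = 0} {lam : Cn s} {x : Fin s → An d} {w : κ → An d}

/-- The cohomological equation `φ ∘ f - B φ + ψ = log (1 + g(x))`, with `g` a polynomial in
secondary resonant monomials. -/
theorem exists_normalization (h : IsAdapted (An.pullback f hf h0) lam x w)
    {θ : ℝ} {V : Cn d → ℝ} {r C' : ℝ} (hL : IsLyapunov f θ V r C')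
    (B : Matrix (Fin p) (Fin p) ℂ) (hB : B.charpoly.eval 0 ≠ 0) (ψ : Fin p → An d)
    (hψ : ∀ k, ψ k ∈ An.vanishing d 1) :
    ∃ φ : Fin p → An d, (∀ k, φ k ∈ An.vanishing d 1) ∧
      ∃ g : Fin p → MvPolynomial (Fin s) ℂ,
        (∀ k, g k ∈ MvPolynomial.restrictSupport ℂ
          {a | a ≠ 0 ∧ B.charpoly.eval (powMonomial lam a) = 0}) ∧
        ∀ k, ∃ hg : MvPolynomial.aeval x (g k) ∈ An.vanishing d 1,
          ψ k + An.pullback f hf h0 (φ k) - ∑ j, B k j • φ j -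
            An.logOneAdd (MvPolynomial.aeval x (g k)) hg ∈ An.flat d := by
  set T := An.pullback f hf h0 with hT
  -- The equation is first solved modulo order `n + 1`, one degree at a time: the resonant part of
  -- the remainder is put into `g`, the rest into `φ`.
  have key : ∀ n, ∃ φ : Fin p → An d, (∀ k, φ k ∈ An.vanishing d 1) ∧
      ∃ g : Fin p → MvPolynomial (Fin s) ℂ,
        (∀ k, g k ∈ MvPolynomial.restrictSupport ℂ
          {a | a ≠ 0 ∧ B.charpoly.eval (powMonomial lam a) = 0}) ∧
        ∀ k, ∃ hg : MvPolynomial.aeval x (g k) ∈ An.vanishing d 1,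
          ψ k + T (φ k) - ∑ j, B k j • φ j -
            An.logOneAdd (MvPolynomial.aeval x (g k)) hg ∈ An.vanishing d (n + 1) := by
    intro n
    induction n with
    | zero =>
      refine ⟨0, fun k => Submodule.zero_mem _, 0, fun k => Submodule.zero_mem _, fun k => ?_⟩
      have hg : MvPolynomial.aeval x ((0 : Fin p → MvPolynomial (Fin s) ℂ) k) ∈
        An.vanishing d 1 := by simp
      refine ⟨hg, ?_⟩
      have : An.logOneAdd _ hg = 0 := by
        ext y
        simp [An.logOneAdd_apply]
      rw [this]
      simpa using hψ k
    | succ n ih =>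
      obtain ⟨φ, hφ, g, hg, hr⟩ := ih
      choose hg1 hr using hr
      choose G hG u hu hGu using fun k => h.exists_resonant_decomposition hB (hr k)
      obtain ⟨φ', hφ', hφu⟩ := B.exists_apply_sub_eq_aeval_charpoly T.toLinearMap
        (An.vanishing d (n + 1)) (An.vanishing_invariant hf h0 _) hu
      have hGn : ∀ k, MvPolynomial.aeval x (G k) ∈ An.vanishing d (n + 1) := by
        intro k
        have h1 := Submodule.sub_mem _ (Submodule.sub_mem _ (hr k) (aeval_mem_of_invariant
          (An.vanishing_invariant hf h0 (n + 1)) B.charpoly (hu k)))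
          (An.vanishing_anti (Nat.le_succ _) (hGu k))
        convert h1 using 1
        abel
      have hle : An.vanishing d (n + 1) ≤ An.vanishing d 1 := An.vanishing_anti (by omega)
      refine ⟨φ - φ', fun k => Submodule.sub_mem _ (hφ k) (hle (hφ' k)), g + G, fun k =>
        Submodule.add_mem _ (hg k) (MvPolynomial.restrictSupport_mono ℂ ?_ (hG k)), fun k => ?_⟩
      · rintro a ⟨ha, hroot⟩
        refine ⟨?_, hroot⟩
        rintro rfl
        simp at ha
      have hgG : MvPolynomial.aeval x (g k) + MvPolynomial.aeval x (G k) ∈ An.vanishing d 1 :=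
        Submodule.add_mem _ (hg1 k) (hle (hGn k))
      have hgG' : MvPolynomial.aeval x ((g + G) k) ∈ An.vanishing d 1 := by
        rw [Pi.add_apply, map_add]; exact hgG
      refine ⟨hgG', ?_⟩
      have e : An.logOneAdd _ hgG' = An.logOneAdd _ hgG := by
        ext y
        simp only [An.logOneAdd_apply, Pi.add_apply, map_add]
      -- As `G` has order `n + 1`, `log (1 + g + G)` is `log (1 + g) + G` modulo order `n + 2`: the
      -- logarithm does not disturb the lower degrees.
      have h1 := Submodule.sub_mem _ (hGu k) (An.logOneAdd_add_sub_mem (hg1 k) hgG (hGn k))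
      rw [← hφu] at h1
      rw [e]
      convert h1 using 1
      simp only [Pi.sub_apply, map_sub, smul_sub, Finset.sum_sub_distrib,
        AlgHom.toLinearMap_apply]
      abel
  have hroots : ∀ μ ∈ B.charpoly.roots, μ ≠ 0 := by
    rintro μ hμ rfl
    exact hB ((Polynomial.mem_roots'.1 hμ).2)
  -- From order `N + 1` on, `χ_B(f^*)` is surjective, so the whole remainder is absorbed by `φ` and
  -- `g` stays a polynomial. Such an `N` exists because no root is zero.
  obtain ⟨N, hN⟩ : ∃ N, ∀ μ ∈ B.charpoly.roots, θ ^ (N + 1) < ‖μ‖ := by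
    have : ∀ s : Multiset ℂ, (∀ μ ∈ s, μ ≠ 0) → ∃ N, ∀ n ≥ N, ∀ μ ∈ s, θ ^ n < ‖μ‖ := by
      intro s
      induction s using Multiset.induction_on with
      | empty => intro _; exact ⟨0, by simp⟩
      | cons μ s ih =>
        intro hs
        obtain ⟨N, hN⟩ := ih fun ν hν => hs ν (Multiset.mem_cons_of_mem hν)
        obtain ⟨M, hM⟩ := hL.exists_pow_lt (hs μ (Multiset.mem_cons_self _ _))
        refine ⟨max N M, fun n hn ν hν => ?_⟩
        rcases Multiset.mem_cons.1 hν with rfl | hν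
        · exact hM n ((le_max_right _ _).trans hn)
        · exact hN n ((le_max_left _ _).trans hn) ν hν
    obtain ⟨N, hN⟩ := this _ hroots
    exact ⟨N, hN (N + 1) (Nat.le_succ _)⟩
  obtain ⟨φ, hφ, g, hg, hr⟩ := key N
  choose hg1 hr using hr
  choose u hu huv using fun k => hL.exists_aeval_sub_mem_flat (hf := hf) (h0 := h0)
    B.charpoly_monic.ne_zero (fun μ hμ => ⟨hroots μ hμ, hN μ hμ⟩) (hr k)
  obtain ⟨φ', hφ', hφu⟩ := B.exists_apply_sub_eq_aeval_charpoly T.toLinearMap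
    (An.vanishing d (N + 1)) (An.vanishing_invariant hf h0 _) hu
  refine ⟨φ - φ', fun k => Submodule.sub_mem _ (hφ k) (An.vanishing_anti (by omega) (hφ' k)),
    g, hg, fun k => ⟨hg1 k, ?_⟩⟩
  have h1 := Submodule.neg_mem _ (huv k)
  rw [← hφu] at h1
  convert h1 using 1
  simp only [Pi.sub_apply, map_sub, smul_sub, Finset.sum_sub_distrib, AlgHom.toLinearMap_apply]
  abel

end IsAdapted

/-! ### Triangular bases of the dual space -/

section Flag

variable {V : Type} [AddCommGroup V] [Module ℂ V] {T : Module.End ℂ V}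

/-- A triangular independent family of generalized eigenvectors for non-zero eigenvalues. -/
structure IsFlag {s : ℕ} (T : Module.End ℂ V) (v : Fin s → V) (lam : Fin s → ℂ) : Prop where
  independent : LinearIndependent ℂ v
  lam_ne : ∀ k, lam k ≠ 0
  mem : ∀ k, v k ∈ T.maxGenEigenspace (lam k)
  triangular : ∀ k, ∃ c : Fin s → ℂ, (∀ l, k ≤ l → c l = 0) ∧ T (v k) = lam k • v k + ∑ l, c l • v l

namespace IsFlag

variable {s : ℕ} {v : Fin s → V} {lam : Fin s → ℂ}

/-- Take a generalized eigenvector outside the span, and then its last iterate under `T - μ` that is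
still outside. The next iterate lies in the span, which is exactly the triangularity of the enlarged
family. -/
theorem exists_snoc [FiniteDimensional ℂ V] (h : IsFlag T v lam)
    (hT : Submodule.span ℂ (Set.range v) ⊔ T.maxGenEigenspace 0 ≠ ⊤) :
    ∃ w μ, IsFlag T (Fin.snoc v w : Fin (s + 1) → V) (Fin.snoc lam μ : Fin (s + 1) → ℂ) := by
  set W := Submodule.span ℂ (Set.range v) with hW
  obtain ⟨μ, hμ, hμW⟩ : ∃ μ : ℂ, μ ≠ 0 ∧ ¬ T.maxGenEigenspace μ ≤ W := by
    by_contra! hcon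
    refine hT (eq_top_iff.2 ?_)
    rw [← Module.End.iSup_maxGenEigenspace_eq_top T]
    refine iSup_le fun μ => ?_
    by_cases hμ : μ = 0
    · rw [hμ]; exact le_sup_right
    · exact (hcon μ hμ).trans le_sup_left
  obtain ⟨v₀, hv₀, hv₀W⟩ := SetLike.not_le_iff_exists.1 hμW
  classical
  have hex : ∃ j : ℕ, ((T - algebraMap ℂ _ μ) ^ j) v₀ ∈ W := by
    obtain ⟨k, hk⟩ := (Module.End.mem_maxGenEigenspace _ _ _).1 hv₀
    refine ⟨k, ?_⟩
    have : ((T - algebraMap ℂ _ μ) ^ k) v₀ = 0 := hk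
    rw [this]
    exact W.zero_mem
  obtain ⟨j, hj⟩ : ∃ j, Nat.find hex = j + 1 := by
    refine Nat.exists_eq_succ_of_ne_zero fun h0 => hv₀W ?_
    have := Nat.find_spec hex
    rw [h0] at this
    simpa using this
  set w := ((T - algebraMap ℂ _ μ) ^ j) v₀ with hw
  have hwW : w ∉ W := Nat.find_min hex (by omega)
  have hTw : T w - μ • w ∈ W := by
    have := Nat.find_spec hex
    rw [hj, pow_succ', Module.End.mul_apply] at this
    exact this
  have hwμ : w ∈ T.maxGenEigenspace μ := by
    obtain ⟨k, hk⟩ := (Module.End.mem_maxGenEigenspace _ _ _).1 hv₀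
    refine (Module.End.mem_maxGenEigenspace _ _ _).2 ⟨k, ?_⟩
    have hk' : ((T - algebraMap ℂ _ μ) ^ k) v₀ = 0 := hk
    change ((T - algebraMap ℂ _ μ) ^ k) w = 0
    rw [hw, ← Module.End.mul_apply, ← pow_add, add_comm, pow_add, Module.End.mul_apply, hk',
      map_zero]
  refine ⟨w, μ, ⟨linearIndependent_finSnoc.2 ⟨h.independent, hwW⟩, fun k => ?_, fun k => ?_,
    fun k => ?_⟩⟩
  · induction k using Fin.lastCases with
    | last => simpa using hμ
    | cast k => simpa using h.lam_ne k
  · induction k using Fin.lastCases with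
    | last => simpa using hwμ
    | cast k => simpa using h.mem k
  · induction k using Fin.lastCases with
    | last =>
      obtain ⟨c, hc⟩ := (Submodule.mem_span_range_iff_exists_fun ℂ).1 hTw
      refine ⟨Fin.snoc c 0, fun l hl => ?_, ?_⟩
      · rw [Fin.last_le_iff.1 hl, Fin.snoc_last]
      · rw [Fin.sum_univ_castSucc]
        simp [hc]
    | cast k =>
      obtain ⟨c, hc0, hc⟩ := h.triangular k
      refine ⟨Fin.snoc c 0, fun l hl => ?_, ?_⟩
      · induction l using Fin.lastCases with
        | last => simp
        | cast l => simpa using hc0 l (by simpa using hl)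
      · rw [Fin.sum_univ_castSucc]
        simp [hc]

/-- Independence bounds the length of a flag by the dimension. The initial vectors are kept in
place, so that the eigencovectors of the fixed components remain the first ones. -/
theorem exists_extend [FiniteDimensional ℂ V] (h : IsFlag T v lam) :
    ∃ (s' : ℕ) (hs : s ≤ s') (v' : Fin s' → V) (lam' : Fin s' → ℂ), IsFlag T v' lam' ∧
      (∀ k, v' (Fin.castLE hs k) = v k ∧ lam' (Fin.castLE hs k) = lam k) ∧
      Submodule.span ℂ (Set.range v') ⊔ T.maxGenEigenspace 0 = ⊤ := by
  have key : ∀ n s, ∀ (v : Fin s → V) (lam : Fin s → ℂ), IsFlag T v lam →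
      Module.finrank ℂ V ≤ s + n →
      ∃ (s' : ℕ) (hs : s ≤ s') (v' : Fin s' → V) (lam' : Fin s' → ℂ), IsFlag T v' lam' ∧
        (∀ k, v' (Fin.castLE hs k) = v k ∧ lam' (Fin.castLE hs k) = lam k) ∧
        Submodule.span ℂ (Set.range v') ⊔ T.maxGenEigenspace 0 = ⊤ := by
    intro n
    induction n with
    | zero =>
      intro s v lam h hn
      refine ⟨s, le_rfl, v, lam, h, fun k => ⟨rfl, rfl⟩, ?_⟩
      by_contra hT
      obtain ⟨w, μ, h'⟩ := h.exists_snoc hT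
      have := h'.independent.fintype_card_le_finrank
      rw [Fintype.card_fin] at this
      omega
    | succ n ih =>
      intro s v lam h hn
      by_cases hT : Submodule.span ℂ (Set.range v) ⊔ T.maxGenEigenspace 0 = ⊤
      · exact ⟨s, le_rfl, v, lam, h, fun k => ⟨rfl, rfl⟩, hT⟩
      · obtain ⟨w, μ, h'⟩ := h.exists_snoc hT
        obtain ⟨s', hs, v', lam', h1, h2, h3⟩ := ih (s + 1) _ _ h' (by omega)
        refine ⟨s', by omega, v', lam', h1, fun k => ?_, h3⟩
        have := h2 k.castSucc
        simpa using this
  exact key _ s v lam h le_add_self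

theorem disjoint (h : IsFlag T v lam) :
    Disjoint (Submodule.span ℂ (Set.range v)) (T.maxGenEigenspace 0) := by
  have h1 := (Module.End.independent_maxGenEigenspace T) 0
  refine (h1.mono_right ?_).symm
  rw [Submodule.span_le]
  rintro _ ⟨k, rfl⟩
  exact (le_iSup₂_of_le (lam k) (h.lam_ne k) le_rfl : T.maxGenEigenspace (lam k) ≤ _) (h.mem k)

theorem of_eigenvectors (hv : LinearIndependent ℂ v) (hlam : ∀ k, lam k ≠ 0)
    (hT : ∀ k, T (v k) = lam k • v k) : IsFlag T v lam :=
  ⟨hv, hlam, fun k => (Module.End.mem_maxGenEigenspace _ _ _).2 ⟨1, by simp [hT]⟩,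
    fun k => ⟨0, by simp, by simp [hT]⟩⟩

end IsFlag

theorem LinearIndependent.exists_sum_elim [FiniteDimensional ℂ V] {K : Submodule ℂ V} {p : ℕ}
    {u : Fin p → V} (hu : LinearIndependent ℂ u) (huK : ∀ k, u k ∈ K) :
    ∃ (m : ℕ) (ζ : Fin m → V), (∀ j, ζ j ∈ K) ∧ LinearIndependent ℂ (Sum.elim u ζ) ∧
      K ≤ Submodule.span ℂ (Set.range (Sum.elim u ζ)) := by
  let u' : Fin p → K := fun k => ⟨u k, huK k⟩
  have hu' : LinearIndependent ℂ u' := LinearIndependent.of_comp K.subtype hu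
  obtain ⟨C, hC⟩ := (Submodule.span ℂ (Set.range u')).exists_isCompl
  let b := Module.finBasis ℂ C
  have hbs : Submodule.span ℂ (Set.range fun j => (b j : K)) = C := by
    have : Submodule.map C.subtype (Submodule.span ℂ (Set.range b)) = C := by
      rw [b.span_eq, Submodule.map_subtype_top]
    rwa [Submodule.map_span, ← Set.range_comp] at this
  have hE : K.subtype ∘ Sum.elim u' (fun j => (b j : K)) =
      Sum.elim u fun j => ((b j : K) : V) := by
    funext i
    rcases i with k | j <;> rfl
  refine ⟨_, fun j => ((b j : K) : V), fun j => (b j : K).2, ?_, ?_⟩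
  · rw [← hE]
    refine LinearIndependent.map' ?_ K.subtype (Submodule.ker_subtype K)
    refine hu'.sum_type (b.linearIndependent.map' C.subtype (Submodule.ker_subtype C)) ?_
    have := hC.disjoint
    rw [← hbs] at this
    exact this
  · have h1 : Submodule.map K.subtype
        (Submodule.span ℂ (Set.range (Sum.elim u' fun j => (b j : K)))) = K := by
      rw [Set.Sum.elim_range, Submodule.span_union, hbs, hC.sup_eq_top, Submodule.map_subtype_top]
    rw [Submodule.map_span, ← Set.range_comp, hE] at h1
    exact h1.ge

/-- The hypothesis gives `ker N² = ker N`, hence `range N² = range N` by dimension, and `range N =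
range N^(k+1)`. A covector killed by the `k`-th power of the transpose is then zero on `range N`. -/
theorem transpose_apply_eq_zero {d : ℕ} {L : Cn d →L[ℂ] Cn d} (hL : NilpotentPartVanishes L)
    {ξ : Cn d →L[ℂ] ℂ} (hξ : ξ ∈ (An.transpose L).maxGenEigenspace 0) :
    An.transpose L ξ = 0 := by
  set N : Module.End ℂ (Cn d) := (L : Cn d →ₗ[ℂ] Cn d) with hN
  have hker : ∀ v, N (N v) = 0 → N v = 0 := fun v hv =>
    hL v ((Module.End.mem_maxGenEigenspace _ _ _).2 ⟨2, by
      rw [zero_smul, sub_zero, pow_two]; exact hv⟩)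
  have hrange : LinearMap.range (N * N) = LinearMap.range N := by
    refine Submodule.eq_of_le_of_finrank_eq (LinearMap.range_comp_le_range N N) ?_
    have h1 := (N * N).finrank_range_add_finrank_ker
    have h2 := N.finrank_range_add_finrank_ker
    have h3 : LinearMap.ker (N * N) = LinearMap.ker N := by
      ext v
      exact ⟨hker v, fun hv => by
        rw [LinearMap.mem_ker] at hv ⊢
        rw [Module.End.mul_apply, hv, map_zero]⟩
    rw [h3] at h1
    omega
  have hsurj : ∀ k, ∀ v, ∃ y, N v = (N ^ (k + 1)) y := by
    intro k
    induction k with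
    | zero => exact fun v => ⟨v, by simp⟩
    | succ k ih =>
      intro v
      obtain ⟨y, hy⟩ : N v ∈ LinearMap.range (N * N) := hrange ▸ ⟨v, rfl⟩
      obtain ⟨z, hz⟩ := ih y
      refine ⟨z, ?_⟩
      rw [← hy, Module.End.mul_apply, hz, ← Module.End.mul_apply, ← pow_succ']
  obtain ⟨k, hk⟩ := (Module.End.mem_maxGenEigenspace _ _ _).1 hξ
  have hk : (An.transpose L ^ k) ξ = 0 := by
    have h0 : An.transpose L - (0 : ℂ) • (1 : Module.End ℂ (Cn d →L[ℂ] ℂ)) = An.transpose L := by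
      ext; simp
    rwa [h0] at hk
  have hpow : ∀ k : ℕ, ∀ y, (An.transpose L ^ k) ξ y = ξ ((N ^ k) y) := by
    intro k
    induction k with
    | zero => exact fun y => rfl
    | succ k ih =>
      intro y
      rw [pow_succ', Module.End.mul_apply, An.transpose_apply, pow_succ, Module.End.mul_apply,
        ContinuousLinearMap.comp_apply, ih]
      rfl
  ext v
  obtain ⟨y, hy⟩ := hsurj k v
  have h1 : An.transpose L ξ v = ξ (N v) := rfl
  rw [h1, hy, pow_succ, Module.End.mul_apply, ← hpow, hk]
  rfl

end Flag

section CoordinateForms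

variable {d s : ℕ} {κ : Type} [Fintype κ] [DecidableEq κ]

/-- A basis of the dual space, as a linear isomorphism. -/
theorem exists_continuousLinearEquiv_of_dual_basis {ι : Type} [Fintype ι]
    {b : ι → Cn d →L[ℂ] ℂ} (hb : LinearIndependent ℂ b)
    (hspan : Submodule.span ℂ (Set.range b) = ⊤) :
    ∃ L : Cn d ≃L[ℂ] (ι → ℂ), ∀ x i, L x i = b i x := by
  have hcard : Fintype.card ι = d := by
    rw [← Module.finrank_eq_card_basis (Module.Basis.mk hb hspan.ge),
      ← (LinearMap.toContinuousLinearMap (𝕜 := ℂ) (E := Cn d) (F' := ℂ)).finrank_eq]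
    simp
  let Λ : Cn d →ₗ[ℂ] (ι → ℂ) := LinearMap.pi fun i => (b i : Cn d →ₗ[ℂ] ℂ)
  have hinj : Function.Injective Λ := by
    rw [← LinearMap.ker_eq_bot, LinearMap.ker_eq_bot']
    intro x hx
    have h1 : ∀ ξ : Cn d →L[ℂ] ℂ, ξ x = 0 := by
      intro ξ
      have hξ : ξ ∈ Submodule.span ℂ (Set.range b) := hspan ▸ Submodule.mem_top
      induction hξ using Submodule.span_induction with
      | mem ξ h =>
        obtain ⟨i, rfl⟩ := h
        exact congrFun hx i
      | zero => rfl
      | add a b _ _ ha hb => simp [ha, hb]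
      | smul c a _ ha => simp [ha]
    funext i
    exact h1 (ContinuousLinearMap.proj i)
  let e := LinearEquiv.ofInjectiveOfFinrankEq Λ hinj (by simp [hcard])
  exact ⟨e.toContinuousLinearEquiv, fun x i => rfl⟩

/-- In the coordinates given by the covectors, `L` is the matrix whose rows are the coefficients of
the transposed action: a lower triangular block with diagonal `lam`, and zeros elsewhere. -/
theorem charpoly_of_dual_basis {L : Cn d →L[ℂ] Cn d} {v : Fin s → Cn d →L[ℂ] ℂ}
    {η : κ → Cn d →L[ℂ] ℂ} (hb : LinearIndependent ℂ (Sum.elim v η))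
    (hspan : Submodule.span ℂ (Set.range (Sum.elim v η)) = ⊤) {lam : Fin s → ℂ}
    (hv : IsFlag (An.transpose L) v lam) (hη : ∀ j, An.transpose L (η j) = 0) :
    (L : Cn d →ₗ[ℂ] Cn d).charpoly =
      X ^ Fintype.card κ * ∏ k, (X - C (lam k)) := by
  obtain ⟨Λ, hΛ⟩ := exists_continuousLinearEquiv_of_dual_basis hb hspan
  choose c hc0 hc using hv.triangular
  let M : Matrix (Fin s) (Fin s) ℂ := Matrix.of fun k l => (if k = l then lam k else 0) + c k l
  let M' : Matrix (Fin s ⊕ κ) (Fin s ⊕ κ) ℂ := Matrix.fromBlocks M 0 0 0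
  have hconj : Λ.toLinearEquiv.conj (L : Cn d →ₗ[ℂ] Cn d) = Matrix.toLin' M' := by
    refine LinearMap.ext fun t => ?_
    obtain ⟨y, rfl⟩ := Λ.surjective t
    rw [LinearEquiv.conj_apply_apply]
    have h1 : Λ.toLinearEquiv.symm (Λ y) = y := Λ.symm_apply_apply y
    rw [h1, Matrix.toLin'_apply]
    funext i
    have h2 : ∀ i, Λ.toLinearEquiv (L y) i = An.transpose L (Sum.elim v η i) y :=
      fun i => hΛ (L y) i
    refine (h2 i).trans ?_
    rcases i with k | j
    · simp only [Sum.elim_inl, hc, M', M, Matrix.mulVec, dotProduct, Fintype.sum_sum_type, hΛ]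
      simp [add_mul, Finset.sum_add_distrib]
    · simp only [Sum.elim_inr, hη, M', Matrix.mulVec, dotProduct, Fintype.sum_sum_type]
      simp
  have hM : M.charpoly = ∏ k, (X - C (lam k)) := by
    rw [← Matrix.charpoly_transpose, Matrix.charpoly_of_isUpperTriangular]
    · refine Finset.prod_congr rfl fun k _ => ?_
      simp [M, hc0 k k le_rfl]
    · intro k l hkl
      have hkl' : l < k := hkl
      simp [M, hc0 l k hkl'.le, hkl'.ne]
  rw [← LinearEquiv.charpoly_conj Λ.toLinearEquiv, hconj, Matrix.charpoly_toLin',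
    Matrix.charpoly_fromBlocks_zero₁₂, hM, mul_comm]
  congr 1
  simp [Matrix.charpoly_zero]

end CoordinateForms

end

section

open Asymptotics

/-! ### Division by coordinates and monomial factorization -/

section PolydiscCoordinates

variable {ι : Type} [Fintype ι] [DecidableEq ι]

/-- Hadamard's lemma: a holomorphic germ that vanishes on a coordinate hyperplane is divisible by
the coordinate. -/
theorem AnalyticAt.exists_eq_coord_mul {F : (ι → ℂ) → ℂ} (hF : AnalyticAt ℂ F 0) (l : ι)
    (h0 : ∀ᶠ t in 𝓝 (0 : ι → ℂ), t l = 0 → F t = 0) :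
    ∃ G : (ι → ℂ) → ℂ, AnalyticAt ℂ G 0 ∧ ∀ᶠ t in 𝓝 0, F t = t l * G t := by
  obtain ⟨p, r, hp⟩ := hF
  obtain ⟨ρ, hρ0, hρ⟩ := ENNReal.lt_iff_exists_nnreal_btwn.1 hp.r_pos
  have hρ0' : (0 : ℝ) < ρ := by exact_mod_cast hρ0
  obtain ⟨K, hK, hpK⟩ := p.norm_mul_pow_le_of_lt_radius (hρ.trans_le hp.r_le)
  let P : ∀ n, (Fin n → ι) → Prop := fun n r => ∃ i, r i = l
  let c : ∀ n, (Fin n → ι) → ℂ := fun n r => p n fun i => Pi.single (r i) 1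
  have hexp : ∀ n t, (p n fun _ => t) = ∑ r, c n r * ∏ i, t (r i) := by
    intro n t
    have h1 : (fun _ : Fin n => t) = fun _ => ∑ j, t j • (Pi.single j (1 : ℂ) : ι → ℂ) := by
      funext i
      conv_lhs => rw [pi_eq_sum_univ' t]
    rw [h1]
    have h2 := (p n).toMultilinearMap.map_sum
      fun (_ : Fin n) (j : ι) => t j • (Pi.single j (1 : ℂ) : ι → ℂ)
    simp only [ContinuousMultilinearMap.coe_coe] at h2
    rw [h2]
    refine Finset.sum_congr rfl fun r _ => ?_
    have h3 := (p n).map_smul_univ (fun i => t (r i)) fun i => (Pi.single (r i) (1 : ℂ) : ι → ℂ)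
    rw [h3, smul_eq_mul, mul_comm]
  classical
  -- All positions of the word except one chosen occurrence of `l`: the product over them is the
  -- monomial divided by `t l`.
  let E : ∀ n, (Fin n → ι) → Finset (Fin n) := fun n r =>
    if h : P n r then Finset.univ.erase h.choose else ∅
  let G : ℕ → (ι → ℂ) → ℂ := fun n t => ∑ r with P n r, c n r * ∏ i ∈ E n r, t (r i)
  have hG1 : ∀ n t, t l * G n t = ∑ r with P n r, c n r * ∏ i, t (r i) := by
    intro n t
    simp only [G, Finset.mul_sum]
    refine Finset.sum_congr rfl fun r hr => ?_
    have hr' : P n r := (Finset.mem_filter.1 hr).2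
    simp only [E, dif_pos hr']
    rw [← Finset.mul_prod_erase _ _ (Finset.mem_univ hr'.choose), hr'.choose_spec]
    ring
  -- Words avoiding `l` do not see the update, the others vanish on it. Summed over `n`, the right
  -- side is `F t` minus the value of `F` at the projection of `t` to the hyperplane, which is zero.
  have hG2 : ∀ n t, t l * G n t = (p n fun _ => t) - p n fun _ => Function.update t l 0 := by
    intro n t
    rw [hG1, hexp n t, hexp n (Function.update t l 0),
      ← Finset.sum_filter_add_sum_filter_not Finset.univ (P n) fun r => c n r * ∏ i, t (r i),
      ← Finset.sum_filter_add_sum_filter_not Finset.univ (P n)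
        fun r => c n r * ∏ i, Function.update t l 0 (r i)]
    have h1 : ∑ r with P n r, c n r * ∏ i, Function.update t l 0 (r i) = 0 := by
      refine Finset.sum_eq_zero fun r hr => ?_
      obtain ⟨i, hi⟩ := (Finset.mem_filter.1 hr).2
      rw [Finset.prod_eq_zero (Finset.mem_univ i) (by simp [hi]), mul_zero]
    have h2 : ∑ r with ¬ P n r, c n r * ∏ i, Function.update t l 0 (r i) =
        ∑ r with ¬ P n r, c n r * ∏ i, t (r i) := by
      refine Finset.sum_congr rfl fun r hr => ?_
      congr 1
      refine Finset.prod_congr rfl fun i _ => ?_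
      have hi : r i ≠ l := fun hi => (Finset.mem_filter.1 hr).2 ⟨i, hi⟩
      rw [Function.update_of_ne hi]
    rw [h1, h2]
    ring
  obtain ⟨N, hN⟩ : ∃ N : ℝ, N = (Fintype.card ι : ℝ) := ⟨_, rfl⟩
  have hN0 : 0 ≤ N := by rw [hN]; positivity
  -- There are `N ^ n` words of length `n`; this radius absorbs their number and leaves a factor
  -- `2^{-n}`.
  obtain ⟨R, hR, hRρ⟩ : ∃ R : ℝ, 0 < R ∧ 2 * (N + 1) * R = ρ :=
    ⟨ρ / (2 * (N + 1)), by positivity, by field_simp⟩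
  have hGa : ∀ n, AnalyticOnNhd ℂ (G n) (Metric.ball 0 R) := by
    intro n t _
    refine Finset.analyticAt_fun_sum _ fun r _ => analyticAt_const.mul ?_
    refine Finset.analyticAt_fun_prod _ fun i _ => ?_
    exact (ContinuousLinearMap.proj (R := ℂ) (φ := fun _ : ι => ℂ) (r i)).analyticAt t
  have hGb : ∀ n, ∀ t ∈ Metric.ball (0 : ι → ℂ) R, ‖G n t‖ ≤ K / R * (1 / 2) ^ n := by
    intro n t ht
    have ht' : ∀ j, ‖t j‖ ≤ R := fun j =>
      (norm_le_pi_norm t j).trans (le_of_lt (by simpa using ht))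
    have hterm : ∀ r ∈ Finset.univ.filter (P n), ‖c n r * ∏ i ∈ E n r, t (r i)‖ ≤
        ‖p n‖ * (R ^ n / R) := by
      intro r hr
      have hr' : P n r := (Finset.mem_filter.1 hr).2
      have hn : 0 < n := hr'.choose.pos
      rw [norm_mul, norm_prod]
      gcongr
      · have := (p n).le_opNorm fun i => (Pi.single (r i) (1 : ℂ) : ι → ℂ)
        simpa [Pi.norm_single] using this
      · refine (Finset.prod_le_prod (fun _ _ => norm_nonneg _) fun i _ => ht' (r i)).trans ?_
        simp only [E, dif_pos hr']
        rw [Finset.prod_const, Finset.card_erase_of_mem (Finset.mem_univ _), Finset.card_univ,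
          Fintype.card_fin, le_div_iff₀ hR, ← pow_succ, Nat.sub_add_cancel hn]
    calc ‖G n t‖ ≤ ∑ r with P n r, ‖p n‖ * (R ^ n / R) :=
          (norm_sum_le _ _).trans (Finset.sum_le_sum hterm)
      _ ≤ ∑ r : Fin n → ι, ‖p n‖ * (R ^ n / R) :=
          Finset.sum_le_sum_of_subset_of_nonneg (Finset.filter_subset _ _)
            fun _ _ _ => by positivity
      _ = N ^ n * (‖p n‖ * (R ^ n / R)) := by simp [hN]
      _ ≤ (N + 1) ^ n * (‖p n‖ * (R ^ n / R)) := by gcongr; linarith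
      _ = (‖p n‖ * ρ ^ n) / R * (1 / 2) ^ n := by
          rw [← hRρ, mul_pow, mul_pow, one_div, inv_pow]
          field_simp
      _ ≤ K / R * (1 / 2) ^ n := by gcongr; exact hpK n
  refine ⟨fun t => ∑' n, G n t, analyticAt_tsum_of_bounded hR hGa hGb
    ((summable_geometric_of_lt_one (by norm_num) (by norm_num)).mul_left _), ?_⟩
  have hupd : Tendsto (fun t : ι → ℂ => Function.update t l 0) (𝓝 0) (𝓝 0) := by
    have : Continuous fun t : ι → ℂ => Function.update t l (0 : ℂ) :=
      continuous_id.update l continuous_const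
    simpa using this.tendsto 0
  filter_upwards [hp.hasFPowerSeriesAt.eventually_hasSum_sub,
    hupd.eventually hp.hasFPowerSeriesAt.eventually_hasSum_sub, hupd.eventually h0] with t h1 h2 h3
  rw [h3 (by simp)] at h2
  simp only [sub_zero] at h1 h2
  have h4 := h1.sub h2
  rw [sub_zero] at h4
  rw [← h4.tsum_eq, ← tsum_mul_left]
  exact tsum_congr fun n => (hG2 n t).symm

/-- If the zeros of a germ lie on coordinate hyperplanes and it does not vanish identically on one
of these, then that hyperplane is superfluous. -/
theorem AnalyticAt.eventually_zero_imp_erase {F : (ι → ℂ) → ℂ} (hF : AnalyticAt ℂ F 0)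
    {S : Finset ι} {l : ι} (hz : ∀ᶠ t in 𝓝 (0 : ι → ℂ), F t = 0 → ∃ k ∈ insert l S, t k = 0)
    (hl : l ∉ S) (hnz : ¬ ∀ᶠ t in 𝓝 (0 : ι → ℂ), t l = 0 → F t = 0) :
    ∀ᶠ t in 𝓝 (0 : ι → ℂ), F t = 0 → ∃ k ∈ S, t k = 0 := by
  obtain ⟨r, hr, hball⟩ := Metric.eventually_nhds_iff_ball.1 (hz.and hF.eventually_analyticAt)
  have hmem : ∀ {t : ι → ℂ} {ζ : ℂ}, t ∈ Metric.ball 0 r → ‖ζ‖ < r →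
      Function.update t l ζ ∈ Metric.ball (0 : ι → ℂ) r := by
    intro t ζ ht hζ
    rw [mem_ball_zero_iff, pi_norm_lt_iff hr] at ht ⊢
    intro k
    by_cases hk : k = l
    · subst hk; simpa using hζ
    · rw [Function.update_of_ne hk]; exact ht k
  have hupdc : Continuous fun y : (ι → ℂ) × ℂ => Function.update y.1 l y.2 :=
    continuous_fst.update l continuous_snd
  filter_upwards [Metric.ball_mem_nhds (0 : ι → ℂ) hr] with t ht hFt
  -- Such a zero `t` lies on the `l`-th hyperplane only. For nearby `t'`, `F` is bounded below on a
  -- circle in the direction `l` but small at its centre, so by the maximum principle for `1/F` it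
  -- must vanish somewhere in the disc, hence at the centre. `F` then vanishes on an open part of
  -- the hyperplane, and by the identity theorem on all of it near `0`.
  by_contra! hS
  have htl : t l = 0 := by
    obtain ⟨k, hk, hk0⟩ := (hball t ht).1 hFt
    rcases Finset.mem_insert.1 hk with rfl | hk
    · exact hk0
    · exact (hS k hk hk0).elim
  have htupd : Function.update t l 0 = t := by rw [← htl, Function.update_eq_self]
  have hpos : ∀ {t' : ι → ℂ} {ζ : ℂ}, t' ∈ Metric.ball 0 r → ‖ζ‖ < r → ζ ≠ 0 →
      (∀ k ∈ S, t' k ≠ 0) → F (Function.update t' l ζ) ≠ 0 := by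
    intro t' ζ ht' hζ hζ0 hS' h
    obtain ⟨k, hk, hk0⟩ := (hball _ (hmem ht' hζ)).1 h
    rcases Finset.mem_insert.1 hk with rfl | hk'
    · exact hζ0 (by simpa using hk0)
    · rw [Function.update_of_ne (by rintro rfl; exact hl hk')] at hk0
      exact hS' k hk' hk0
  have hrad : r / 2 < r := by linarith
  have hsphere : ∀ ζ ∈ Metric.sphere (0 : ℂ) (r / 2), ‖ζ‖ < r ∧ ζ ≠ 0 := by
    intro ζ hζ
    rw [mem_sphere_zero_iff_norm] at hζ
    exact ⟨by linarith, norm_pos_iff.1 (by linarith)⟩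
  have hcont : ∀ ζ ∈ Metric.sphere (0 : ℂ) (r / 2),
      ContinuousAt (fun y : (ι → ℂ) × ℂ => F (Function.update y.1 l y.2)) (t, ζ) := by
    intro ζ hζ
    have := (hball _ (hmem ht (hsphere ζ hζ).1)).2.continuousAt
    exact ContinuousAt.comp (f := fun y : (ι → ℂ) × ℂ => Function.update y.1 l y.2)
      this hupdc.continuousAt
  obtain ⟨ε, hε, hεF⟩ : ∃ ε > 0, ∀ᶠ t' in 𝓝 t, ∀ ζ ∈ Metric.sphere (0 : ℂ) (r / 2),
      ε < ‖F (Function.update t' l ζ)‖ := by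
    have hK := isCompact_sphere (0 : ℂ) (r / 2)
    have hne : (Metric.sphere (0 : ℂ) (r / 2)).Nonempty :=
      (NormedSpace.sphere_nonempty).2 (by positivity)
    obtain ⟨ζ₀, hζ₀, hmin⟩ := hK.exists_isMinOn hne
      (f := fun ζ => ‖F (Function.update t l ζ)‖) (fun ζ hζ => by
        have h1 := (hcont ζ hζ).comp (f := fun z : ℂ => ((t, z) : (ι → ℂ) × ℂ)) (by fun_prop)
        exact h1.norm.continuousWithinAt)
    have h0 : 0 < ‖F (Function.update t l ζ₀)‖ :=
      norm_pos_iff.2 (hpos ht (hsphere _ hζ₀).1 (hsphere _ hζ₀).2 hS)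
    refine ⟨‖F (Function.update t l ζ₀)‖ / 2, by positivity,
      hK.eventually_forall_of_forall_eventually fun ζ hζ => ?_⟩
    have h1 : ‖F (Function.update t l ζ₀)‖ ≤ ‖F (Function.update t l ζ)‖ := hmin hζ
    exact (hcont ζ hζ).norm.eventually_const_lt (by simp only; linarith)
  have hsmall : ∀ᶠ t' in 𝓝 t, ‖F (Function.update t' l 0)‖ < ε := by
    have h1 : ContinuousAt (fun t' : ι → ℂ => F (Function.update t' l 0)) t := by
      refine ContinuousAt.comp (g := F) (f := fun t' : ι → ℂ => Function.update t' l 0) ?_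
        (continuous_id.update l continuous_const).continuousAt
      exact (hball _ (hmem ht (by simpa using hr))).2.continuousAt
    refine h1.norm.eventually_lt_const ?_
    simpa only [htupd, hFt, norm_zero] using hε
  have hSev : ∀ᶠ t' in 𝓝 t, ∀ k ∈ S, t' k ≠ 0 := by
    rw [eventually_all_finset]
    exact fun k hk => (continuous_apply k).continuousAt.eventually_ne (hS k hk)
  have hvan : ∀ᶠ t' in 𝓝 t, F (Function.update t' l 0) = 0 := by
    filter_upwards [hεF, hsmall, hSev, Metric.isOpen_ball.mem_nhds ht] with t' h1 h2 h3 h4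
    by_contra hne
    have hnz' : ∀ ζ ∈ Metric.closedBall (0 : ℂ) (r / 2), F (Function.update t' l ζ) ≠ 0 := by
      intro ζ hζ
      by_cases h : ζ = 0
      · rw [h]; exact hne
      · exact hpos h4 (lt_of_le_of_lt (by simpa using hζ) hrad) h h3
    have hdiff : DifferentiableOn ℂ (fun ζ => (F (Function.update t' l ζ))⁻¹)
        (Metric.closedBall 0 (r / 2)) := by
      intro ζ hζ
      have hζ' : ‖ζ‖ < r := lt_of_le_of_lt (by simpa using hζ) hrad
      refine DifferentiableAt.differentiableWithinAt (DifferentiableAt.inv ?_ (hnz' ζ hζ))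
      exact DifferentiableAt.comp (g := F) ζ (hball _ (hmem h4 hζ')).2.differentiableAt
        (hasDerivAt_update t' l ζ).differentiableAt
    have h5 := Complex.norm_le_of_forall_mem_frontier_norm_le (U := Metric.ball (0 : ℂ) (r / 2))
      Metric.isBounded_ball (f := fun ζ => (F (Function.update t' l ζ))⁻¹) (C := ε⁻¹)
      (hdiff.diffContOnCl_ball subset_rfl) (fun ζ hζ => by
        rw [frontier_ball _ (by positivity)] at hζ
        rw [norm_inv]
        exact inv_anti₀ hε (h1 ζ hζ).le) (z := 0)
      (subset_closure (Metric.mem_ball_self (by positivity)))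
    rw [norm_inv, inv_le_inv₀ (norm_pos_iff.2 hne) hε] at h5
    exact absurd h2 (not_lt.2 h5)
  have hana : AnalyticOnNhd ℂ (fun t' : ι → ℂ => F (Function.update t' l 0)) (Metric.ball 0 r) := by
    intro t' ht'
    refine AnalyticAt.comp (g := F) (f := fun t' : ι → ℂ => Function.update t' l 0)
      (hball _ (hmem ht' (by simpa using hr))).2 ?_
    refine AnalyticAt.pi fun k => ?_
    by_cases hk : k = l
    · subst hk
      simpa using analyticAt_const
    · simp only [Function.update_of_ne hk]
      exact (ContinuousLinearMap.proj (R := ℂ) (φ := fun _ : ι => ℂ) k).analyticAt t'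
  have hzero := hana.eqOn_zero_of_preconnected_of_eventuallyEq_zero
    (convex_ball _ _).isPreconnected ht hvan
  refine hnz ?_
  filter_upwards [Metric.ball_mem_nhds (0 : ι → ℂ) hr] with t' ht' h0
  have h1 : F (Function.update t' l 0) = 0 := hzero ht'
  rw [← h0, Function.update_eq_self] at h1
  exact h1.trans h0

end PolydiscCoordinates

namespace An

variable {d : ℕ}

theorem mem_flat_or_mem_flat {v w : An d} (h : v * w ∈ flat d) : v ∈ flat d ∨ w ∈ flat d := by
  by_contra! hcon
  obtain ⟨hv, hw⟩ := hcon
  obtain ⟨r, hr, hball⟩ := Metric.eventually_nhds_iff_ball.1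
    (((mem_flat.1 h).and (analyticAt v).eventually_analyticAt).and
      (analyticAt w).eventually_analyticAt)
  obtain ⟨x, hx, hxv⟩ : ∃ x ∈ Metric.ball (0 : Cn d) r, (v : Cn d → ℂ) x ≠ 0 := by
    by_contra! hcon
    exact hv (mem_of_superset (Metric.ball_mem_nhds 0 hr) hcon)
  refine hw ?_
  have hz : (w : Cn d → ℂ) =ᶠ[𝓝 x] 0 := by
    filter_upwards [(hball x hx).1.2.continuousAt.eventually_ne hxv,
      Metric.isOpen_ball.mem_nhds hx] with y h1 h2
    exact (mul_eq_zero.1 (hball y h2).1.1).resolve_left h1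
  have := AnalyticOnNhd.eqOn_zero_of_preconnected_of_eventuallyEq_zero
    (fun y hy => (hball y hy).2) (convex_ball (0 : Cn d) r).isPreconnected hx hz
  exact mem_of_superset (Metric.ball_mem_nhds 0 hr) this

theorem pow_notMem_flat {v : An d} (hv : v ∉ flat d) (n : ℕ) : v ^ n ∉ flat d := by
  induction n with
  | zero =>
    intro h
    have := (mem_flat.1 h).self_of_nhds
    simp at this
  | succ n ih =>
    intro h
    rw [pow_succ] at h
    exact (mem_flat_or_mem_flat h).elim ih hv

theorem tendsto_of_isLocalBiholomorphism {E F : Type} [NormedAddCommGroup E] [NormedSpace ℂ E]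
    [NormedAddCommGroup F] [NormedSpace ℂ F] {g : E → F} (hg : IsLocalBiholomorphism g) :
    Tendsto g (𝓝 0) (𝓝 0) := by
  simpa [ContinuousAt, hg.map_zero] using hg.analytic.continuousAt

section Coordinates

variable {ι : Type} [Fintype ι] {X : ι → An d}
  (hX : IsLocalBiholomorphism fun x i => (X i : Cn d → ℂ) x)

include hX in
theorem exists_eq_mul_of_vanish (l : ι) {v : An d}
    (hv : ∀ᶠ x in 𝓝 0, (X l : Cn d → ℂ) x = 0 → (v : Cn d → ℂ) x = 0) :
    ∃ w : An d, v - X l * w ∈ flat d := by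
  classical
  obtain ⟨Ψ, hΨ, hl, hr⟩ := hX.exists_inverse
  have hF : AnalyticAt ℂ (fun t => (v : Cn d → ℂ) (Ψ t)) 0 :=
    AnalyticAt.comp (g := (v : Cn d → ℂ)) (hΨ.map_zero.symm ▸ v.2) hΨ.analytic
  obtain ⟨G, hG, hFG⟩ := hF.exists_eq_coord_mul l (by
    filter_upwards [hr, (tendsto_of_isLocalBiholomorphism hΨ).eventually hv] with t h1 h2 h3
    exact h2 ((congrFun h1 l).trans h3))
  refine ⟨⟨fun x => G fun i => (X i : Cn d → ℂ) x,
    AnalyticAt.comp (g := G) (hX.map_zero.symm ▸ hG) hX.analytic⟩, ?_⟩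
  filter_upwards [hl, (tendsto_of_isLocalBiholomorphism hX).eventually hFG] with x h1 h2
  rw [h1] at h2
  simpa [sub_eq_zero] using h2

include hX in
theorem zero_imp_erase {l : ι} {S : Finset ι} [DecidableEq ι] {v : An d}
    (hz : ∀ᶠ x in 𝓝 0, (v : Cn d → ℂ) x = 0 → ∃ k ∈ insert l S, (X k : Cn d → ℂ) x = 0)
    (hl : l ∉ S) (hnz : ¬ ∀ᶠ x in 𝓝 0, (X l : Cn d → ℂ) x = 0 → (v : Cn d → ℂ) x = 0) :
    ∀ᶠ x in 𝓝 0, (v : Cn d → ℂ) x = 0 → ∃ k ∈ S, (X k : Cn d → ℂ) x = 0 := by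
  obtain ⟨Ψ, hΨ, hli, hr⟩ := hX.exists_inverse
  have hF : AnalyticAt ℂ (fun t => (v : Cn d → ℂ) (Ψ t)) 0 :=
    AnalyticAt.comp (g := (v : Cn d → ℂ)) (hΨ.map_zero.symm ▸ v.2) hΨ.analytic
  have h1 := hF.eventually_zero_imp_erase (S := S) (l := l) (by
    filter_upwards [hr, (tendsto_of_isLocalBiholomorphism hΨ).eventually hz] with t h1 h2 h3
    obtain ⟨k, hk, hk0⟩ := h2 h3
    exact ⟨k, hk, (congrFun h1 k).symm.trans hk0⟩) hl (fun hcon => hnz (by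
      filter_upwards [hli, (tendsto_of_isLocalBiholomorphism hX).eventually hcon] with x h1 h2 h3
      have := h2 h3
      rwa [h1] at this))
  filter_upwards [hli, (tendsto_of_isLocalBiholomorphism hX).eventually h1] with x h2 h3 h4
  exact h3 (by rwa [h2])

include hX in
/-- A non-zero germ whose zeros lie on coordinate hypersurfaces is a monomial times a unit. -/
theorem exists_factorization (S : Finset ι) {v : An d} (hv : v ∉ flat d)
    (hz : ∀ᶠ x in 𝓝 0, (v : Cn d → ℂ) x = 0 → ∃ k ∈ S, (X k : Cn d → ℂ) x = 0) :
    ∃ (a : ι → ℕ) (w : An d), (w : Cn d → ℂ) 0 ≠ 0 ∧ v - (∏ k ∈ S, X k ^ a k) * w ∈ flat d := by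
  classical
  induction S using Finset.induction_on generalizing v with
  | empty =>
    refine ⟨0, v, fun h0 => ?_, by simp⟩
    have := hz.self_of_nhds h0
    simp at this
  | insert l S hl ih =>
    -- The exponent of `X l` is the last `m` for which division is possible; if all powers divided,
    -- `v` would vanish to every order. The cofactor is then not identically zero on `X l = 0`, so
    -- its zeros lie on the remaining hypersurfaces.
    have hex : ∃ m, ¬ ∃ w : An d, v - X l ^ m * w ∈ flat d := by
      by_contra! hcon
      refine hv ((analyticAt v).eventually_eq_zero_of_isBigO fun n => ?_)
      obtain ⟨w, hw⟩ := hcon n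
      have hXl : X l ∈ vanishing d 1 := mem_vanishing_one.2 (congrFun hX.map_zero l)
      have h1 := prod_mem_vanishing (s := (Finset.univ : Finset (Fin n))) (X := fun _ => X l)
        fun _ _ => hXl
      rw [Finset.prod_const, Finset.card_univ, Fintype.card_fin] at h1
      have h2 := mul_mem_vanishing_left w h1
      have h3 := Submodule.add_mem _ (flat_le_vanishing n hw) h2
      rw [mul_comm w, sub_add_cancel] at h3
      exact h3
    obtain ⟨m, hm⟩ : ∃ m, Nat.find hex = m + 1 := by
      refine Nat.exists_eq_succ_of_ne_zero fun h0 => ?_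
      have := Nat.find_spec hex
      rw [h0] at this
      exact this ⟨v, by simp⟩
    obtain ⟨w, hw⟩ := not_not.1 (Nat.find_min hex (show m < Nat.find hex by omega))
    have hspec := Nat.find_spec hex
    rw [hm] at hspec
    have hwz : ∀ᶠ x in 𝓝 0, (w : Cn d → ℂ) x = 0 → ∃ k ∈ S, (X k : Cn d → ℂ) x = 0 := by
      refine zero_imp_erase hX ?_ hl fun hcon => hspec ?_
      · filter_upwards [hz, hw] with x h1 h2 h3
        refine h1 ?_
        have h4 : (v : Cn d → ℂ) x - (X l : Cn d → ℂ) x ^ m * (w : Cn d → ℂ) x = 0 := h2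
        rw [h3, mul_zero, sub_zero] at h4
        exact h4
      · obtain ⟨w', hw'⟩ := exists_eq_mul_of_vanish hX l hcon
        refine ⟨w', ?_⟩
        have := Submodule.add_mem _ hw (mul_mem_flat (X l ^ m) hw')
        convert this using 1
        ring
    have hwf : w ∉ flat d := by
      intro hcon
      have := Submodule.add_mem _ hw (mul_mem_flat (X l ^ m) hcon)
      rw [sub_add_cancel] at this
      exact hv this
    obtain ⟨a, w', hw'0, hw'⟩ := ih hwf hwz
    refine ⟨Function.update a l m, w', hw'0, ?_⟩
    have := Submodule.add_mem _ hw (mul_mem_flat (X l ^ m) hw')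
    convert this using 1
    rw [Finset.prod_insert hl, Function.update_self, Finset.prod_congr rfl fun k hk => by
      rw [Function.update_of_ne (by rintro rfl; exact hl hk)]]
    ring

include hX in
theorem ordAlong_eq [DecidableEq ι] {S : Finset ι} {l : ι} (hl : l ∈ S) {g : Cn d → ℂ} {a : ι → ℕ}
    {w : An d} (hw : (w : Cn d → ℂ) 0 ≠ 0)
    (hg : ∀ᶠ x in 𝓝 0, g x = (((∏ k ∈ S, X k ^ a k) * w : An d) : Cn d → ℂ) x) :
    ordAlong (X l : Cn d → ℂ) g = a l := by
  obtain ⟨Ψ, hΨ, -, hr⟩ := hX.exists_inverse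
  set R : An d := (∏ k ∈ S.erase l, X k ^ a k) * w with hR
  have hprod : (∏ k ∈ S, X k ^ a k) * w = X l ^ a l * R := by
    rw [hR, ← Finset.mul_prod_erase S _ hl, mul_assoc]
  -- A curve inside the hyperplane `l` and off all the others. The cofactor `R` is non-zero along
  -- it, so `X l` cannot divide `R`.
  let t : ℂ → ι → ℂ := fun ε k => if k = l then 0 else ε
  have htc : Tendsto t (𝓝[≠] 0) (𝓝 0) := by
    have : Continuous t := by
      refine continuous_pi fun k => ?_
      by_cases hk : k = l
      · simp only [t, hk, if_true]; exact continuous_const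
      · simp only [t, hk, if_false]; exact continuous_id
    have h0 : t 0 = 0 := by funext k; simp [t]
    rw [← h0]
    exact (this.tendsto 0).mono_left nhdsWithin_le_nhds
  have hRt : ∀ᶠ ε in 𝓝[≠] (0 : ℂ), (X l : Cn d → ℂ) (Ψ (t ε)) = 0 ∧
      (R : Cn d → ℂ) (Ψ (t ε)) ≠ 0 := by
    have h1 : ∀ᶠ y in 𝓝 (0 : ι → ℂ), (w : Cn d → ℂ) (Ψ y) ≠ 0 :=
      (tendsto_of_isLocalBiholomorphism hΨ).eventually
        ((analyticAt w).continuousAt.eventually_ne hw)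
    filter_upwards [htc.eventually (h1.and hr), self_mem_nhdsWithin] with ε h2 hε
    have hXk : ∀ k, (X k : Cn d → ℂ) (Ψ (t ε)) = t ε k := fun k => congrFun h2.2 k
    refine ⟨by rw [hXk]; simp [t], ?_⟩
    have h3 : (R : Cn d → ℂ) (Ψ (t ε)) =
        (∏ k ∈ S.erase l, (X k : Cn d → ℂ) (Ψ (t ε)) ^ a k) * (w : Cn d → ℂ) (Ψ (t ε)) := by
      simp [hR]
    rw [h3]
    refine mul_ne_zero (Finset.prod_ne_zero_iff.2 fun k hk => pow_ne_zero _ ?_) h2.1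
    rw [hXk]
    simpa [t, Finset.ne_of_mem_erase hk] using hε
  have hXl : X l ∉ flat d := by
    intro h
    have h1 : Tendsto (fun ε : ℂ => (fun _ => ε : ι → ℂ)) (𝓝[≠] 0) (𝓝 0) := by
      have : Continuous (fun ε : ℂ => (fun _ => ε : ι → ℂ)) := by fun_prop
      exact (this.tendsto 0).mono_left nhdsWithin_le_nhds
    have h2 := (tendsto_of_isLocalBiholomorphism hΨ).eventually (mem_flat.1 h)
    obtain ⟨ε, h3, hε⟩ := ((h1.eventually (h2.and hr)).and self_mem_nhdsWithin).exists
    exact hε ((congrFun h3.2 l).symm.trans h3.1)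
  have hset : {m : ℕ | ∃ v : Cn d → ℂ, AnalyticAt ℂ v 0 ∧
      ∀ᶠ x in 𝓝 (0 : Cn d), g x = (X l : Cn d → ℂ) x ^ m * v x} = Set.Iic (a l) := by
    ext m
    constructor
    · rintro ⟨v, hv, hgv⟩
      by_contra hm
      obtain ⟨j, hj⟩ := Nat.exists_eq_add_of_lt (not_le.1 hm)
      have h1 : X l ^ a l * (X l ^ (j + 1) * (⟨v, hv⟩ : An d) - R) ∈ flat d := by
        filter_upwards [hg, hgv] with x h1 h2
        rw [h1, hprod, hj] at h2
        have h3 : (X l : Cn d → ℂ) x ^ a l * (R : Cn d → ℂ) x =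
          (X l : Cn d → ℂ) x ^ (a l + j + 1) * v x := h2
        have h4 : (X l : Cn d → ℂ) x ^ a l * ((X l : Cn d → ℂ) x ^ (j + 1) * v x -
          (R : Cn d → ℂ) x) = 0 := by
          rw [mul_sub, h3]; ring
        exact h4
      have h2 := (mem_flat_or_mem_flat h1).resolve_left (pow_notMem_flat hXl _)
      obtain ⟨ε, h3, h4⟩ := (hRt.and (htc.eventually
        ((tendsto_of_isLocalBiholomorphism hΨ).eventually (mem_flat.1 h2)))).exists
      have h5 : (X l : Cn d → ℂ) (Ψ (t ε)) ^ (j + 1) * v (Ψ (t ε)) -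
          (R : Cn d → ℂ) (Ψ (t ε)) = 0 := h4
      rw [h3.1] at h5
      exact h3.2 (by simpa using h5)
    · intro hm
      refine ⟨((X l ^ (a l - m) * R : An d) : Cn d → ℂ), (X l ^ (a l - m) * R).2, ?_⟩
      filter_upwards [hg] with x hx
      rw [hx, hprod]
      change (X l : Cn d → ℂ) x ^ a l * (R : Cn d → ℂ) x =
        (X l : Cn d → ℂ) x ^ m * ((X l : Cn d → ℂ) x ^ (a l - m) * (R : Cn d → ℂ) x)
      rw [← mul_assoc, ← pow_add, Nat.add_sub_cancel' hm]
  rw [ordAlong, hset, csSup_Iic]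

end Coordinates

end An

end

section

open Asymptotics Polynomial

namespace An

variable {d : ℕ}

theorem isLocalBiholomorphism_of_differential {ι : Type} [Fintype ι] {X : ι → An d}
    (h1 : ∀ i, X i ∈ vanishing d 1) (hind : LinearIndependent ℂ fun i => differential d (X i))
    (hspan : Submodule.span ℂ (Set.range fun i => differential d (X i)) = ⊤) :
    IsLocalBiholomorphism fun x i => (X i : Cn d → ℂ) x := by
  obtain ⟨L, hL⟩ := exists_continuousLinearEquiv_of_dual_basis hind hspan
  refine ⟨AnalyticAt.pi fun i => (X i).2, funext fun i => mem_vanishing_one.1 (h1 i), L, ?_⟩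
  rw [hasFDerivAt_pi']
  intro i
  have hLi : (ContinuousLinearMap.proj i).comp (L : Cn d →L[ℂ] ι → ℂ) = differential d (X i) :=
    ContinuousLinearMap.ext fun x => hL x i
  rw [hLi]
  exact hasFDerivAt (X i)

theorem exists_coords {q : ℕ} {u : Fin q → An d} (h1 : ∀ k, u k ∈ vanishing d 1)
    (hind : LinearIndependent ℂ fun k => differential d (u k)) :
    ∃ (m : ℕ) (η : Fin m → An d),
      IsLocalBiholomorphism fun x i => ((Sum.elim u η i : An d) : Cn d → ℂ) x := by
  obtain ⟨m, ζ, -, hζ, hspan⟩ := hind.exists_sum_elim (K := ⊤) fun _ => Submodule.mem_top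
  have e : (fun i => differential d (Sum.elim u (fun j => ofCovector (ζ j)) i)) =
      Sum.elim (fun k => differential d (u k)) ζ := by
    funext i
    rcases i with k | j
    · rfl
    · exact differential_ofCovector _
  refine ⟨m, fun j => ofCovector (ζ j), isLocalBiholomorphism_of_differential ?_ ?_ ?_⟩
  · rintro (k | j)
    · exact h1 k
    · exact ofCovector_mem _
  · rw [e]; exact hζ
  · rw [e]; exact top_le_iff.1 hspan

theorem prod_pow_mem_vanishing {q : ℕ} {u : Fin q → An d} (h1 : ∀ k, u k ∈ vanishing d 1)
    (a : Fin q → ℕ) : ∏ k, u k ^ a k ∈ vanishing d (∑ k, a k) := by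
  have hpow : ∀ k n, u k ^ n ∈ vanishing d n := by
    intro k n
    have := prod_mem_vanishing (s := (Finset.univ : Finset (Fin n))) (X := fun _ => u k)
      fun _ _ => h1 k
    rwa [Finset.prod_const, Finset.card_univ, Fintype.card_fin] at this
  have key : ∀ s : Finset (Fin q), ∏ k ∈ s, u k ^ a k ∈ vanishing d (∑ k ∈ s, a k) := by
    intro s
    induction s using Finset.induction_on with
    | empty => simp [vanishing_zero]
    | insert k s hk ih =>
      rw [Finset.prod_insert hk, Finset.sum_insert hk]
      exact mul_mem_vanishing (hpow k _) ih
  exact key _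

end An

/-! ### Action of the germ on the critical components -/

section InternalAction

variable {d q : ℕ} {f : Cn d → Cn d} {u : Fin q → Cn d → ℂ}

/-- The components of the critical set, as elements of `An d`. -/
def IsSNC.component {C : Set (Cn d)} (hu : IsSNC C u) (k : Fin q) : An d := ⟨u k, hu.analytic k⟩

theorem IsSNC.component_mem {C : Set (Cn d)} (hu : IsSNC C u) (k : Fin q) :
    hu.component k ∈ An.vanishing d 1 := An.mem_vanishing_one.2 (hu.map_zero k)

/-- If `u k ∘ f` vanished near `0`, the chain rule and `d(u k) ≠ 0` would make `df` degenerate at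
every nearby point, so the generalized critical set would be a full neighbourhood. The point with
all coordinates equal to a small `ε ≠ 0` lies on no component. -/
theorem IsSNC.pullback_notMem_flat (hu : IsSNC (genCrit f) u) (hf : AnalyticAt ℂ f 0)
    (h0 : f 0 = 0) (k : Fin q) : An.pullback f hf h0 (hu.component k) ∉ An.flat d := by
  intro hflat
  have h1 : ∀ᶠ x in 𝓝 (0 : Cn d), x ∈ genCrit f := by
    have hft : Tendsto f (𝓝 0) (𝓝 0) := by simpa [ContinuousAt, h0] using hf.continuousAt
    have hdu : ∀ᶠ y in 𝓝 (0 : Cn d), fderiv ℂ (u k) y ≠ 0 ∧ AnalyticAt ℂ (u k) y :=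
      ((hu.analytic k).fderiv.continuousAt.eventually_ne (hu.independent.ne_zero k)).and
        (hu.analytic k).eventually_analyticAt
    filter_upwards [hft.eventually hdu, hf.eventually_analyticAt,
      (An.mem_flat.1 hflat).eventually_nhds] with x hx hfx hz
    refine ⟨0, ?_⟩
    by_contra hdet
    have hz' : (u k ∘ f) =ᶠ[𝓝 x] fun _ => 0 := hz
    have h2 : (fderiv ℂ (u k) (f x)).comp (fderiv ℂ f x) = 0 := by
      have h3 := (hx.2.differentiableAt.hasFDerivAt.comp x hfx.differentiableAt.hasFDerivAt).fderiv
      rw [← h3, hz'.fderiv_eq]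
      simp
    refine hx.1 (ContinuousLinearMap.ext fun y => ?_)
    have hsurj : Function.Surjective (fderiv ℂ f x) := by
      have hunit : IsUnit ((fderiv ℂ f x : Cn d →ₗ[ℂ] Cn d)) := by
        rw [LinearMap.isUnit_iff_isUnit_det]
        exact isUnit_iff_ne_zero.2 hdet
      exact ((Module.End.isUnit_iff _).1 hunit).2
    obtain ⟨z, rfl⟩ := hsurj y
    exact DFunLike.congr_fun h2 z
  obtain ⟨m, η, hX⟩ := An.exists_coords hu.component_mem hu.independent
  obtain ⟨Ψ, hΨ, -, hr⟩ := hX.exists_inverse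
  have hc : Tendsto (fun ε : ℂ => (fun _ => ε : Fin q ⊕ Fin m → ℂ)) (𝓝[≠] 0) (𝓝 0) := by
    have : Continuous (fun ε : ℂ => (fun _ => ε : Fin q ⊕ Fin m → ℂ)) := by fun_prop
    exact (this.tendsto 0).mono_left nhdsWithin_le_nhds
  have h2 := (An.tendsto_of_isLocalBiholomorphism hΨ).eventually (h1.and hu.locus)
  obtain ⟨ε, h3, hε⟩ := ((hc.eventually (h2.and hr)).and self_mem_nhdsWithin).exists
  obtain ⟨l, hl⟩ := h3.1.2.1 h3.1.1
  exact hε ((congrFun h3.2 (Sum.inl l)).symm.trans hl)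

/-- `f^* u^k = ∏ₗ (u^l)^(a l k)` up to a unit. -/
theorem IsSNC.exists_pullback_eq (hu : IsSNC (genCrit f) u) (hf : AnalyticAt ℂ f 0)
    (h0 : f 0 = 0) (k : Fin q) :
    ∃ w : An d, (w : Cn d → ℂ) 0 ≠ 0 ∧
      An.pullback f hf h0 (hu.component k) -
        (∏ l, hu.component l ^ internalAction f u l k) * w ∈ An.flat d := by
  classical
  obtain ⟨m, η, hX⟩ := An.exists_coords hu.component_mem hu.independent
  have hft : Tendsto f (𝓝 0) (𝓝 0) := by simpa [ContinuousAt, h0] using hf.continuousAt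
  let S : Finset (Fin q ⊕ Fin m) := Finset.univ.map Function.Embedding.inl
  obtain ⟨a, w, hw, hfac⟩ := An.exists_factorization hX S (hu.pullback_notMem_flat hf h0 k) (by
    filter_upwards [hu.locus, hft.eventually hu.locus] with x h1 h2 h3
    obtain ⟨n, hn⟩ := h2.2 ⟨k, h3⟩
    -- Backward invariance: if `f x` becomes critical after `n` steps, `x` does after `n + 1`.
    obtain ⟨l, hl⟩ := h1.1 ⟨n + 1, by rwa [Function.iterate_succ_apply]⟩
    exact ⟨Sum.inl l, by simp [S], hl⟩)
  have hA : ∀ l, internalAction f u l k = a (Sum.inl l) := by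
    intro l
    refine An.ordAlong_eq hX (S := S) (l := Sum.inl l) (by simp [S]) hw ?_
    filter_upwards [hfac] with x hx
    exact sub_eq_zero.1 hx
  refine ⟨w, hw, ?_⟩
  simp only [S, Finset.prod_map, Function.Embedding.inl_apply, Sum.elim_inl] at hfac
  simpa only [hA] using hfac

/-- The total exponent of `f^* u^k` decides: at least two kills the differential, zero contradicts
`f 0 = 0`, and one leaves a single `u^l` times a unit, whose value at `0` is `c`. -/
theorem IsSNC.transpose_cases (hu : IsSNC (genCrit f) u) (hf : AnalyticAt ℂ f 0)
    (h0 : f 0 = 0) (k : Fin q) :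
    An.transpose (fderiv ℂ f 0) (An.differential d (hu.component k)) = 0 ∨
      ∃ (l : Fin q) (c : ℂ), c ≠ 0 ∧
        (internalAction f u).mulVec (Pi.single k 1) = Pi.single l 1 ∧
        An.transpose (fderiv ℂ f 0) (An.differential d (hu.component k)) =
          c • An.differential d (hu.component l) := by
  obtain ⟨w, hw, hfac⟩ := hu.exists_pullback_eq hf h0 k
  set a : Fin q → ℕ := fun l => internalAction f u l k with ha
  have hd : An.transpose (fderiv ℂ f 0) (An.differential d (hu.component k)) =
      An.differential d ((∏ l, hu.component l ^ a l) * w) := by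
    rw [← An.differential_pullback hf h0, ← sub_eq_zero, ← map_sub]
    exact An.differential_eq_zero (An.flat_le_vanishing 2 hfac)
  rw [hd]
  rcases lt_or_ge 1 (∑ l, a l) with h2 | h2
  · left
    refine An.differential_eq_zero (An.vanishing_anti h2 ?_)
    rw [mul_comm]
    exact An.mul_mem_vanishing_left w (An.prod_pow_mem_vanishing hu.component_mem a)
  · right
    have hne : ∑ l, a l ≠ 0 := by
      intro hs
      have ha0 : ∀ l, a l = 0 := fun l => Finset.sum_eq_zero_iff.1 hs l (Finset.mem_univ l)
      have h3 := (An.mem_flat.1 hfac).self_of_nhds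
      have h4 : (An.pullback f hf h0 (hu.component k) : Cn d → ℂ) 0 = 0 := by
        rw [An.pullback_apply, h0]
        exact hu.map_zero k
      change (An.pullback f hf h0 (hu.component k) : Cn d → ℂ) 0 -
        ((∏ l, hu.component l ^ a l) * w : An d).1 0 = 0 at h3
      rw [h4] at h3
      simp only [ha0, pow_zero, Finset.prod_const_one, one_mul, zero_sub, neg_eq_zero] at h3
      exact hw h3
    obtain ⟨l, hl⟩ : ∃ l, a l ≠ 0 := by
      by_contra! hcon
      exact hne (Finset.sum_eq_zero fun l _ => hcon l)
    have hal : a = Pi.single l 1 := by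
      have h5 := Finset.add_sum_erase Finset.univ a (Finset.mem_univ l)
      have h6 : a l = 1 := by omega
      have h7 : ∑ i ∈ Finset.univ.erase l, a i = 0 := by omega
      funext i
      by_cases hi : i = l
      · subst hi; simp [h6]
      · rw [Pi.single_eq_of_ne hi]
        exact Finset.sum_eq_zero_iff.1 h7 i (Finset.mem_erase.2 ⟨hi, Finset.mem_univ i⟩)
    refine ⟨l, (w : Cn d → ℂ) 0, hw, ?_, ?_⟩
    · rw [Matrix.mulVec_single_one]
      exact hal
    · have h8 : ∏ i, hu.component i ^ a i = hu.component l := by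
        rw [Finset.prod_eq_single l]
        · simp [hal]
        · intro i _ hi
          simp [hal, hi]
        · simp
      rw [h8, An.differential_mul_of_left (hu.component_mem l)]

/-- Without a nilpotent part, a covector that is not killed at once is never killed. Its iterates
are then multiples of the `du^l`, and the column of `k` follows a path of basis vectors under `A`.
-/
theorem IsSNC.transpose_eq_zero_of_not_fixed (hu : IsSNC (genCrit f) u) (hf : AnalyticAt ℂ f 0)
    (h0 : f 0 = 0) (hinj : IsInjectiveAction (internalAction f u))
    (hfix : PeriodicComponentsFixed (internalAction f u))
    (hnil : NilpotentPartVanishes (fderiv ℂ f 0)) {k : Fin q}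
    (hk : (internalAction f u).mulVec (Pi.single k 1) ≠ Pi.single k 1) :
    An.transpose (fderiv ℂ f 0) (An.differential d (hu.component k)) = 0 := by
  by_contra hne
  set T := An.transpose (fderiv ℂ f 0) with hT
  set A := internalAction f u with hA
  have hpow : ∀ i : ℕ, (T ^ i) (An.differential d (hu.component k)) ≠ 0 := by
    intro i hi
    refine hne (transpose_apply_eq_zero hnil ((Module.End.mem_maxGenEigenspace _ _ _).2 ⟨i, ?_⟩))
    rwa [zero_smul, show T - (0 : Module.End ℂ (Cn d →L[ℂ] ℂ)) = T from sub_zero T]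
  have hchain : ∀ i : ℕ, ∃ (l : Fin q) (c : ℂ), (A ^ i).mulVec (Pi.single k 1) = Pi.single l 1 ∧
      (T ^ i) (An.differential d (hu.component k)) = c • An.differential d (hu.component l) := by
    intro i
    induction i with
    | zero => exact ⟨k, 1, by rw [pow_zero, Matrix.one_mulVec], by simp⟩
    | succ i ih =>
      obtain ⟨l, c, h1, h2⟩ := ih
      have h3 : (T ^ (i + 1)) (An.differential d (hu.component k)) =
          c • T (An.differential d (hu.component l)) := by
        rw [pow_succ', Module.End.mul_apply, h2, map_smul]
      rcases hu.transpose_cases hf h0 l with h4 | ⟨l', c', -, h5, h6⟩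
      · exact (hpow (i + 1) (by rw [h3, h4]; exact smul_zero (A := Cn d →L[ℂ] ℂ) c)).elim
      · refine ⟨l', c * c', ?_, ?_⟩
        · rw [pow_succ', ← Matrix.mulVec_mulVec, h1, h5]
        · rw [h3, h6, mul_smul]
  choose l c hl hc using hchain
  -- Two iterates reach the same component; cancelling `A ^ i` by injectivity, `k` itself is
  -- periodic with period `j - i`, hence fixed.
  obtain ⟨i, j, hij, hlij⟩ := Finite.exists_ne_map_eq_of_infinite l
  wlog hlt : i < j generalizing i j
  · exact this j i hij.symm hlij.symm (lt_of_le_of_ne (not_lt.1 hlt) hij.symm)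
  have hinjpow : ∀ n : ℕ, Function.Injective fun v : Fin q → ℕ => (A ^ n).mulVec v := by
    have h1 : Function.Injective fun v : Fin q → ℕ => A.mulVec v := by
      intro v v' hv
      have hcast : ∀ v : Fin q → ℕ, (A.map (Nat.cast : ℕ → ℤ)).mulVec (fun i => (v i : ℤ)) =
          fun i => ((A.mulVec v i : ℕ) : ℤ) := by
        intro v
        funext i
        simp [Matrix.mulVec, dotProduct]
      have h2 : (A.map (Nat.cast : ℕ → ℤ)).mulVec (fun i => (v i : ℤ)) =
          (A.map (Nat.cast : ℕ → ℤ)).mulVec fun i => (v' i : ℤ) := by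
        rw [hcast, hcast]
        funext i
        exact congrArg _ (congrFun hv i)
      funext i
      exact_mod_cast congrFun (hinj h2) i
    intro n
    induction n with
    | zero => intro v v' h; simpa using h
    | succ n ih =>
      intro v v' h
      simp only [pow_succ, ← Matrix.mulVec_mulVec] at h
      exact h1 (ih h)
  refine hk (hfix k ⟨j - i, by omega, hinjpow i ?_⟩)
  simp only [Matrix.mulVec_mulVec, ← pow_add]
  rw [Nat.add_sub_cancel' hlt.le, hl, hl, hlij]

end InternalAction

/-! ### Units as exponentials and linearization of fixed components -/

namespace IsLyapunov

variable {d : ℕ} {f : Cn d → Cn d} {θ : ℝ} {V : Cn d → ℝ} {r C : ℝ}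

/-- A unit is, up to a constant, the exponential of a germ vanishing at the origin. -/
theorem _root_.An.exists_eq_mul_exp {w : An d} (hw : (w : Cn d → ℂ) 0 ≠ 0) :
    ∃ ψ ∈ An.vanishing d 1, ∀ᶠ x in 𝓝 0,
      (w : Cn d → ℂ) x = (w : Cn d → ℂ) 0 * Complex.exp ((ψ : Cn d → ℂ) x) := by
  set c := (w : Cn d → ℂ) 0 with hc
  let v : An d := c⁻¹ • w - 1
  have hv : v ∈ An.vanishing d 1 := by
    rw [An.mem_vanishing_one]
    change c⁻¹ * (w : Cn d → ℂ) 0 - 1 = 0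
    rw [← hc, inv_mul_cancel₀ hw, sub_self]
  refine ⟨An.logOneAdd v hv, ?_, ?_⟩
  · rw [An.mem_vanishing_one, An.logOneAdd_apply, An.mem_vanishing_one.1 hv]
    simp
  · filter_upwards [(An.analyticAt w).continuousAt.eventually_ne hw] with x hx
    have h1 : 1 + (v : Cn d → ℂ) x = c⁻¹ * (w : Cn d → ℂ) x := by
      change 1 + (c⁻¹ * (w : Cn d → ℂ) x - 1) = _
      ring
    rw [An.logOneAdd_apply, h1, Complex.exp_log (mul_ne_zero (inv_ne_zero hw) hx), ← mul_assoc,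
      mul_inv_cancel₀ hw, one_mul]

/-- The germ `v e^φ`. -/
noncomputable def _root_.An.mulExp (v φ : An d) : An d :=
  ⟨fun x => (v : Cn d → ℂ) x * Complex.exp ((φ : Cn d → ℂ) x), v.2.mul φ.2.cexp⟩

theorem _root_.An.mulExp_apply (v φ : An d) (x : Cn d) :
    (An.mulExp v φ : Cn d → ℂ) x = (v : Cn d → ℂ) x * Complex.exp ((φ : Cn d → ℂ) x) := rfl

theorem _root_.An.mulExp_mem {v : An d} (hv : v ∈ An.vanishing d 1) (φ : An d) :
    An.mulExp v φ ∈ An.vanishing d 1 := by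
  rw [An.mem_vanishing_one, An.mulExp_apply, An.mem_vanishing_one.1 hv, zero_mul]

theorem _root_.An.differential_mulExp {v φ : An d} (hv : v ∈ An.vanishing d 1)
    (hφ : φ ∈ An.vanishing d 1) : An.differential d (An.mulExp v φ) = An.differential d v := by
  have h1 : An.mulExp v φ = v * ⟨fun x => Complex.exp ((φ : Cn d → ℂ) x), φ.2.cexp⟩ := rfl
  rw [h1, An.differential_mul_of_left hv]
  simp [An.mem_vanishing_one.1 hφ]

/-- Fixed components are linearizable. -/
theorem exists_linearization (h : IsLyapunov f θ V r C) (hf : AnalyticAt ℂ f 0) (h0 : f 0 = 0)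
    {u w : An d} (hw : (w : Cn d → ℂ) 0 ≠ 0)
    (huw : An.pullback f hf h0 u - u * w ∈ An.flat d) :
    ∃ φ ∈ An.vanishing d 1,
      An.pullback f hf h0 (An.mulExp u φ) - (w : Cn d → ℂ) 0 • An.mulExp u φ ∈ An.flat d := by
  obtain ⟨ψ, hψ, hwψ⟩ := An.exists_eq_mul_exp hw
  -- With `f^* u = c u e^ψ`, the product `u e^φ` is an eigenfunction as soon as `φ ∘ f - φ = -ψ`.
  -- Order one is enough here, since `θ < 1`.
  obtain ⟨φ, hφa, hφ1, hφ⟩ := h.exists_cohomological (μ := 1) one_ne_zero (N := 1)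
    (by simpa using h.rate_lt) (v := fun x => -(ψ : Cn d → ℂ) x) ψ.2.neg (IsBigO.neg_left hψ)
  refine ⟨⟨φ, hφa⟩, hφ1, ?_⟩
  filter_upwards [hφ, hwψ, huw] with x h1 h2 h3
  have h4 : (u : Cn d → ℂ) (f x) = (u : Cn d → ℂ) x * (w : Cn d → ℂ) x := sub_eq_zero.1 h3
  change (u : Cn d → ℂ) (f x) * Complex.exp (φ (f x)) -
    (w : Cn d → ℂ) 0 * ((u : Cn d → ℂ) x * Complex.exp (φ x)) = 0
  have h5 : φ x = (ψ : Cn d → ℂ) x + φ (f x) := by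
    linear_combination -h1
  rw [h4, h5, Complex.exp_add]
  nth_rewrite 1 [h2]
  ring

end IsLyapunov

theorem exists_sum_equiv_of_predicate {q : ℕ} (P : Fin q → Prop) :
    ∃ (r p : ℕ) (e : Fin r ⊕ Fin p ≃ Fin q), (∀ i, P (e (Sum.inl i))) ∧
      ∀ j, ¬ P (e (Sum.inr j)) := by
  classical
  refine ⟨_, _, ((Fintype.equivFin {k // P k}).symm.sumCongr
    (Fintype.equivFin {k // ¬ P k}).symm).trans (Equiv.sumCompl P), fun i => ?_, fun j => ?_⟩
  · simpa using ((Fintype.equivFin {k // P k}).symm i).2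
  · simpa using ((Fintype.equivFin {k // ¬ P k}).symm j).2

/-! ### The block of the internal action on non-fixed components -/

section NonFixedBlock

variable {q r p : ℕ} {A : Matrix (Fin q) (Fin q) ℕ} {e : Fin r ⊕ Fin p ≃ Fin q}

/-- The block of `A` on the complement of the fixed components is injective. -/
theorem det_block_ne_zero (hinj : IsInjectiveAction A)
    (he : ∀ i, A.mulVec (Pi.single (e (Sum.inl i)) 1) = Pi.single (e (Sum.inl i)) 1) :
    ((A.submatrix (e ∘ Sum.inr) (e ∘ Sum.inr)).map (Nat.cast : ℕ → ℤ)).det ≠ 0 := by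
  intro hdet
  obtain ⟨v, hv, hDv⟩ := Matrix.exists_mulVec_eq_zero_iff.2 hdet
  have hA : ∀ k i, A k (e (Sum.inl i)) = if k = e (Sum.inl i) then 1 else 0 := by
    intro k i
    have := congrFun (he i) k
    rwa [Matrix.mulVec_single_one, Pi.single_apply] at this
  -- `A` is the identity on the fixed columns, so the entries of `V` there can be chosen to cancel
  -- the fixed rows; a kernel vector of the block extends to one of `A`.
  let V : Fin r ⊕ Fin p → ℤ :=
    Sum.elim (fun i => -∑ j, (A (e (Sum.inl i)) (e (Sum.inr j)) : ℤ) * v j) v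
  have hV : (A.map (Nat.cast : ℕ → ℤ)).mulVec (V ∘ e.symm) = 0 := by
    funext k
    obtain ⟨k, rfl⟩ := e.surjective k
    simp only [Matrix.mulVec, dotProduct, Matrix.map_apply, Function.comp_apply, Pi.zero_apply]
    rw [← e.sum_comp, Fintype.sum_sum_type]
    simp only [Equiv.symm_apply_apply, hA, V, Sum.elim_inl, Sum.elim_inr]
    rcases k with i | j
    · simp
    · have := congrFun hDv j
      simp only [Matrix.mulVec, dotProduct, Matrix.map_apply, Matrix.submatrix_apply,
        Function.comp_apply, Pi.zero_apply] at this
      simp [this]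
  have h0 : V ∘ e.symm = 0 := hinj (by rw [hV, Matrix.mulVec_zero])
  refine hv (funext fun j => ?_)
  simpa [V] using congrFun h0 (e (Sum.inr j))

/-- The fixed columns vanish on the other rows, so an eigenvector of the transposed block extended
by zero is one of the transpose of `A`, and transposition preserves the characteristic polynomial.
-/
theorem hasEigenvalue_of_block
    (he : ∀ i, A.mulVec (Pi.single (e (Sum.inl i)) 1) = Pi.single (e (Sum.inl i)) 1) {μ : ℂ}
    (hμ : ((A.submatrix (e ∘ Sum.inr) (e ∘ Sum.inr)).map
      (Nat.cast : ℕ → ℂ)).transpose.charpoly.eval μ = 0) :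
    Module.End.HasEigenvalue (Matrix.toLin' (A.map (Nat.cast : ℕ → ℂ))) μ := by
  classical
  set D := (A.submatrix (e ∘ Sum.inr) (e ∘ Sum.inr)).map (Nat.cast : ℕ → ℂ) with hD
  have hA : ∀ k i, A k (e (Sum.inl i)) = if k = e (Sum.inl i) then 1 else 0 := by
    intro k i
    have := congrFun (he i) k
    rwa [Matrix.mulVec_single_one, Pi.single_apply] at this
  have h1 : Module.End.HasEigenvalue (Matrix.toLin' D.transpose) μ := by
    rw [Module.End.hasEigenvalue_iff_isRoot_charpoly, Matrix.charpoly_toLin']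
    exact hμ
  obtain ⟨v, hv⟩ := h1.exists_hasEigenvector
  have hDv : D.transpose.mulVec v = μ • v := hv.apply_eq_smul
  let W : Fin r ⊕ Fin p → ℂ := Sum.elim 0 v
  have hW : (A.map (Nat.cast : ℕ → ℂ)).transpose.mulVec (W ∘ e.symm) = μ • (W ∘ e.symm) := by
    funext k
    obtain ⟨k, rfl⟩ := e.surjective k
    simp only [Matrix.mulVec, dotProduct, Matrix.map_apply, Function.comp_apply, Pi.smul_apply,
      Matrix.transpose_apply]
    rw [← e.sum_comp, Fintype.sum_sum_type]
    simp only [Equiv.symm_apply_apply, W, Sum.elim_inl, Sum.elim_inr]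
    rcases k with i | j
    · simp [hA]
    · have := congrFun hDv j
      simp only [Matrix.mulVec, dotProduct, hD, Matrix.transpose_apply, Matrix.map_apply,
        Matrix.submatrix_apply, Function.comp_apply] at this
      simp [this]
  have h2 : Module.End.HasEigenvalue (Matrix.toLin' (A.map (Nat.cast : ℕ → ℂ)).transpose) μ := by
    refine Module.End.hasEigenvalue_of_hasEigenvector
      (x := W ∘ e.symm) (Module.End.hasEigenvector_iff.2 ⟨?_, ?_⟩)
    · rw [Module.End.mem_eigenspace_iff]
      exact hW
    · intro h0
      refine hv.2 (funext fun j => ?_)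
      simpa [W] using congrFun h0 (e (Sum.inr j))
  rw [Module.End.hasEigenvalue_iff_isRoot_charpoly, Matrix.charpoly_toLin'] at h2 ⊢
  rwa [Matrix.charpoly_transpose] at h2

/-- The value is the determinant of the block up to sign. This is the non-vanishing at `0` required
by the cohomological equation. -/
theorem charpoly_block_eval_zero (hinj : IsInjectiveAction A)
    (he : ∀ i, A.mulVec (Pi.single (e (Sum.inl i)) 1) = Pi.single (e (Sum.inl i)) 1) :
    ((A.submatrix (e ∘ Sum.inr) (e ∘ Sum.inr)).map
      (Nat.cast : ℕ → ℂ)).transpose.charpoly.eval 0 ≠ 0 := by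
  rw [Matrix.charpoly_transpose, Matrix.eval_charpoly]
  have h1 := det_block_ne_zero hinj he
  set D := A.submatrix (e ∘ Sum.inr) (e ∘ Sum.inr)
  have h2 : D.map (Nat.cast : ℕ → ℂ) = (D.map (Nat.cast : ℕ → ℤ)).map (Int.castRingHom ℂ) := by
    ext i j; simp
  have h3 : (D.map (Nat.cast : ℕ → ℂ)).det = (((D.map (Nat.cast : ℕ → ℤ)).det : ℤ) : ℂ) := by
    rw [h2]
    exact (RingHom.map_det (Int.castRingHom ℂ) _).symm
  rw [map_zero, zero_sub, Matrix.det_neg, h3]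
  exact mul_ne_zero (pow_ne_zero _ (by simp)) (Int.cast_ne_zero.2 h1)

end NonFixedBlock

namespace An

variable {d s : ℕ}

theorem aeval_apply (x : Fin s → An d) (G : MvPolynomial (Fin s) ℂ) (y : Cn d) :
    (MvPolynomial.aeval x G : Cn d → ℂ) y =
      MvPolynomial.eval (fun k => (x k : Cn d → ℂ) y) G := by
  induction G using MvPolynomial.induction_on with
  | C a => simp [Algebra.algebraMap_eq_smul_one]
  | add p q hp hq => simp [hp, hq]
  | mul_X p k hp => simp [hp]

theorem differential_aeval_mvPolynomial {x : Fin s → An d} (hx : ∀ k, x k ∈ vanishing d 1)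
    (G : MvPolynomial (Fin s) ℂ) :
    differential d (MvPolynomial.aeval x G) =
      ∑ l, MvPolynomial.coeff (Finsupp.single l 1) G • differential d (x l) := by
  classical
  induction G using MvPolynomial.induction_on with
  | C a =>
    have h1 : differential d (MvPolynomial.aeval x (MvPolynomial.C a)) = 0 := by
      rw [MvPolynomial.aeval_C, differential_apply]
      exact fderiv_const_apply a
    rw [h1]
    refine (Finset.sum_eq_zero fun l _ => ?_).symm
    rw [MvPolynomial.coeff_C, if_neg (by simp [eq_comm])]
    exact zero_smul (M₀ := ℂ) (A := Cn d →L[ℂ] ℂ) _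
  | add p q hp hq =>
    simp only [map_add, MvPolynomial.coeff_add, hp, hq]
    rw [← Finset.sum_add_distrib]
    exact Finset.sum_congr rfl fun l _ => (add_smul (M := Cn d →L[ℂ] ℂ) _ _ _).symm
  | mul_X p k hp =>
    rw [map_mul, MvPolynomial.aeval_X, mul_comm, differential_mul_of_left (hx k), aeval_apply]
    have h0 : (fun k => (x k : Cn d → ℂ) 0) = 0 := funext fun k => mem_vanishing_one.1 (hx k)
    rw [h0, Finset.sum_eq_single k]
    · rw [MvPolynomial.coeff_mul_X']
      simp [MvPolynomial.constantCoeff_eq]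
    · intro l _ hl
      rw [MvPolynomial.coeff_mul_X', if_neg (by simp [hl.symm])]
      exact zero_smul (M₀ := ℂ) (A := Cn d →L[ℂ] ℂ) _
    · simp

end An

/-! ### Construction of the adapted coordinates -/

section AdaptedCoordinates

variable {d q : ℕ} {f : Cn d → Cn d} {u : Fin q → Cn d → ℂ} {θ : ℝ} {V : Cn d → ℝ} {R C' : ℝ}

/-- Coordinates `x` (generalized eigenfunctions, the first ones cutting out the fixed components of
the critical set) completed by the other components of the critical set and by linear forms. -/
theorem IsSNC.exists_adapted (hu : IsSNC (genCrit f) u) (hL : IsLyapunov f θ V R C')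
    (hf : AnalyticAt ℂ f 0) (h0 : f 0 = 0)
    (hinj : IsInjectiveAction (internalAction f u))
    (hfix : PeriodicComponentsFixed (internalAction f u))
    (hnil : NilpotentPartVanishes (fderiv ℂ f 0)) {r p : ℕ} {e : Fin r ⊕ Fin p ≃ Fin q}
    (he : ∀ i, (internalAction f u).mulVec (Pi.single (e (Sum.inl i)) 1) =
      Pi.single (e (Sum.inl i)) 1)
    (he' : ∀ j, (internalAction f u).mulVec (Pi.single (e (Sum.inr j)) 1) ≠
      Pi.single (e (Sum.inr j)) 1) :
    ∃ (s m : ℕ) (hr : r ≤ s) (x : Fin s → An d) (lam : Cn s) (ζ : Fin m → Cn d →L[ℂ] ℂ),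
      IsAdapted (An.pullback f hf h0) lam x
        (Sum.elim (fun j => hu.component (e (Sum.inr j))) fun j => An.ofCovector (ζ j)) ∧
      IsFlag (An.transpose (fderiv ℂ f 0)) (fun k => An.differential d (x k)) lam ∧
      (∀ i, ∃ φ ∈ An.vanishing d 1,
        x (Fin.castLE hr i) = An.mulExp (hu.component (e (Sum.inl i))) φ) ∧
      (∀ j, An.transpose (fderiv ℂ f 0) (ζ j) = 0) ∧
      (∀ j, An.transpose (fderiv ℂ f 0) (An.differential d (hu.component (e (Sum.inr j)))) = 0) ∧
      LinearIndependent ℂ (Sum.elim (fun k => An.differential d (x k))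
        (Sum.elim (fun j => An.differential d (hu.component (e (Sum.inr j)))) ζ)) ∧
      Submodule.span ℂ (Set.range (Sum.elim (fun k => An.differential d (x k))
        (Sum.elim (fun j => An.differential d (hu.component (e (Sum.inr j)))) ζ))) = ⊤ := by
  set T := An.transpose (fderiv ℂ f 0) with hT
  have hlin : ∀ i : Fin r, ∃ (φ : An d) (c : ℂ), φ ∈ An.vanishing d 1 ∧ c ≠ 0 ∧
      An.pullback f hf h0 (An.mulExp (hu.component (e (Sum.inl i))) φ) -
        c • An.mulExp (hu.component (e (Sum.inl i))) φ ∈ An.flat d := by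
    intro i
    obtain ⟨w, hw, hfac⟩ := hu.exists_pullback_eq hf h0 (e (Sum.inl i))
    have hA : ∀ l, internalAction f u l (e (Sum.inl i)) =
        (Pi.single (e (Sum.inl i)) 1 : _ → ℕ) l := by
      intro l
      have := congrFun (he i) l
      rwa [Matrix.mulVec_single_one] at this
    have hprod : ∏ l, hu.component l ^ internalAction f u l (e (Sum.inl i)) =
        hu.component (e (Sum.inl i)) := by
      rw [Finset.prod_eq_single (e (Sum.inl i))]
      · simp [hA]
      · intro l _ hl
        simp [hA, hl]
      · simp
    rw [hprod] at hfac
    obtain ⟨φ, hφ, h⟩ := hL.exists_linearization hf h0 hw hfac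
    exact ⟨φ, _, hφ, hw, h⟩
  choose φ c hφ hc hφc using hlin
  set xF : Fin r → An d := fun i => An.mulExp (hu.component (e (Sum.inl i))) (φ i) with hxF
  have hdF : ∀ i, An.differential d (xF i) = An.differential d (hu.component (e (Sum.inl i))) :=
    fun i => An.differential_mulExp (hu.component_mem _) (hφ i)
  have hindF : LinearIndependent ℂ fun i => An.differential d (xF i) := by
    simp only [hdF]
    exact hu.independent.comp (fun i => e (Sum.inl i)) (e.injective.comp Sum.inl_injective)
  have hflagF : IsFlag T (fun i => An.differential d (xF i)) c := by
    refine IsFlag.of_eigenvectors hindF hc fun i => ?_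
    rw [hT, ← An.differential_pullback hf h0, ← sub_eq_zero, ← map_smul, ← map_sub]
    exact An.differential_eq_zero (An.flat_le_vanishing 2 (hφc i))
  obtain ⟨s, hr, v, lam, hv, hext, hsup⟩ := hflagF.exists_extend
  have hzero : ∀ j, T (An.differential d (hu.component (e (Sum.inr j)))) = 0 := fun j =>
    hu.transpose_eq_zero_of_not_fixed hf h0 hinj hfix hnil (he' j)
  have hindN : LinearIndependent ℂ fun j => An.differential d (hu.component (e (Sum.inr j))) :=
    hu.independent.comp (fun j => e (Sum.inr j)) (e.injective.comp Sum.inr_injective)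
  -- The differentials of the non-fixed components lie in the generalized eigenspace for `0`, and
  -- the forms `ζ` complete them to a basis of it.
  obtain ⟨m, ζ, hζ, hζind, hζspan⟩ := hindN.exists_sum_elim (K := T.maxGenEigenspace 0)
    fun j => (Module.End.mem_maxGenEigenspace _ _ _).2 ⟨1, by
      rw [pow_one, zero_smul, show T - (0 : Module.End ℂ (Cn d →L[ℂ] ℂ)) = T from sub_zero T]
      exact hzero j⟩
  -- The first `r` covectors keep the eigenfunctions built from the fixed components, which cut out
  -- these components; only the added ones are lifted abstractly.
  have hxex : ∀ k, ∃ x ∈ An.vanishing d 1, An.differential d x = v k ∧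
      IsGenEig (An.pullback f hf h0).toLinearMap (An.flat d) (lam k) x ∧
      ∀ i, Fin.castLE hr i = k → x = xF i := by
    intro k
    by_cases hk : ∃ i, Fin.castLE hr i = k
    · obtain ⟨i, rfl⟩ := hk
      refine ⟨xF i, An.mulExp_mem (hu.component_mem _) _, (hext i).1.symm, ?_, ?_⟩
      · rw [(hext i).2]
        exact IsGenEig.of_apply (hφc i)
      · intro j hj
        rw [Fin.castLE_injective hr hj]
    · obtain ⟨x, hx1, hx2, hx3⟩ := hL.exists_lift hf h0 (hv.lam_ne k) (hv.mem k)
      exact ⟨x, hx1, hx2, hx3, fun i hi => (hk ⟨i, hi⟩).elim⟩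
  choose x hx1 hxd hxgen hxF' using hxex
  have hdx : (fun k => An.differential d (x k)) = v := funext hxd
  have hK : Submodule.span ℂ (Set.range (Sum.elim
      (fun j => An.differential d (hu.component (e (Sum.inr j)))) ζ)) ≤ T.maxGenEigenspace 0 := by
    rw [Submodule.span_le]
    rintro _ ⟨j | j, rfl⟩
    · refine (Module.End.mem_maxGenEigenspace _ _ _).2 ⟨1, ?_⟩
      rw [pow_one, zero_smul, show T - (0 : Module.End ℂ (Cn d →L[ℂ] ℂ)) = T from sub_zero T]
      exact hzero j
    · exact hζ j
  have hind : LinearIndependent ℂ (Sum.elim (fun k => An.differential d (x k))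
      (Sum.elim (fun j => An.differential d (hu.component (e (Sum.inr j)))) ζ)) := by
    rw [hdx]
    exact hv.independent.sum_type hζind (hv.disjoint.mono_right hK)
  have hspan : Submodule.span ℂ (Set.range (Sum.elim (fun k => An.differential d (x k))
      (Sum.elim (fun j => An.differential d (hu.component (e (Sum.inr j)))) ζ))) = ⊤ := by
    rw [hdx, Set.Sum.elim_range, Submodule.span_union, eq_top_iff, ← hsup]
    exact sup_le_sup_left hζspan _
  have hζ0 : ∀ j, T (ζ j) = 0 := fun j => transpose_apply_eq_zero hnil (hζ j)
  refine ⟨s, m, hr, x, lam, ζ, ⟨?_, hv.lam_ne, hxgen, ?_⟩, hdx ▸ hv, fun i => ?_, hζ0, hzero,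
    hind, hspan⟩
  · have hd : (fun i => An.differential d (Sum.elim x (Sum.elim
        (fun j => hu.component (e (Sum.inr j))) fun j => An.ofCovector (ζ j)) i)) =
        Sum.elim (fun k => An.differential d (x k))
          (Sum.elim (fun j => An.differential d (hu.component (e (Sum.inr j)))) ζ) := by
      funext i
      rcases i with k | j | j
      · rfl
      · rfl
      · exact An.differential_ofCovector _
    refine An.isLocalBiholomorphism_of_differential ?_ (by rwa [hd]) (by rwa [hd])
    rintro (k | j | j)
    · exact hx1 k
    · exact hu.component_mem _
    · exact An.ofCovector_mem _
  · rintro (j | j)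
    · refine An.mem_vanishing_two (An.pullback_mem_vanishing (hu.component_mem _)) ?_
      rw [An.differential_pullback]
      exact hzero j
    · refine An.mem_vanishing_two (An.pullback_mem_vanishing (An.ofCovector_mem _)) ?_
      rw [An.differential_pullback, Sum.elim_inr, An.differential_ofCovector]
      exact hζ0 j
  · exact ⟨φ i, hφ i, hxF' _ i rfl⟩

end AdaptedCoordinates

/-! ### The Poincaré–Dulac part -/

section PoincareDulac

variable {d s : ℕ} {f : Cn d → Cn d} {θ : ℝ} {V : Cn d → ℝ} {R C' : ℝ}

/-- The adapted coordinates `x` put `f` in Poincaré–Dulac normal form. -/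
theorem IsAdapted.exists_poincareDulac {κ : Type} [Fintype κ] {hf : AnalyticAt ℂ f 0}
    {h0 : f 0 = 0} {lam : Cn s} {x : Fin s → An d} {w : κ → An d}
    (h : IsAdapted (An.pullback f hf h0) lam x w) (hL : IsLyapunov f θ V R C')
    (hlt : ∀ k, ‖lam k‖ < 1)
    (hflag : IsFlag (An.transpose (fderiv ℂ f 0)) (fun k => An.differential d (x k)) lam) :
    ∃ σ : Fin s → MvPolynomial (Fin s) ℂ, IsPoincareDulac lam σ ∧
      ∀ k, An.pullback f hf h0 (x k) - MvPolynomial.aeval x (σ k) ∈ An.flat d := by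
  -- `f^* x^k` is again a generalized eigenfunction for `lam k`, hence a resonant polynomial in `x`.
  have hex : ∀ k, ∃ G ∈ MvPolynomial.restrictSupport ℂ {a | powMonomial lam a = lam k},
      An.pullback f hf h0 (x k) - MvPolynomial.aeval x G ∈ An.flat d := by
    intro k
    refine h.exists_sub_mem_flat hL (h.lam_ne k) ?_
    have := (h.genEig k).aeval_apply (T := (An.pullback f hf h0).toLinearMap)
      (An.flat_invariant hf h0) X
    rwa [aeval_X] at this
  choose σ hσ hσx using hex
  have hres : ∀ k n, MvPolynomial.coeff n (σ k) ≠ 0 → powMonomial lam n = lam k := fun k n hn =>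
    ((MvPolynomial.mem_restrictSupport_iff ℂ).1 (hσ k)) (MvPolynomial.mem_support_iff.2 hn)
  choose c hc0 hc using hflag.triangular
  have hcoeff : ∀ k l, MvPolynomial.coeff (Finsupp.single l 1) (σ k) =
      (Pi.single k (lam k) : Fin s → ℂ) l + c k l := by
    intro k
    have h1 : ∑ l, MvPolynomial.coeff (Finsupp.single l 1) (σ k) • An.differential d (x l) =
        ∑ l, ((Pi.single k (lam k) : Fin s → ℂ) l + c k l) • An.differential d (x l) := by
      rw [← An.differential_aeval_mvPolynomial (x := x) fun k => h.mem_vanishing (Sum.inl k)]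
      have h2 : An.differential d (MvPolynomial.aeval x (σ k)) =
          An.differential d (An.pullback f hf h0 (x k)) := by
        rw [eq_comm, ← sub_eq_zero, ← map_sub]
        exact An.differential_eq_zero (An.flat_le_vanishing 2 (hσx k))
      rw [h2, An.differential_pullback, hc k]
      have h3 : lam k • An.differential d (x k) =
          ∑ l, (Pi.single k (lam k) : Fin s → ℂ) l • An.differential d (x l) := by
        rw [Finset.sum_eq_single k]
        · simp
        · intro l _ hl
          rw [Pi.single_eq_of_ne hl]
          exact zero_smul (M₀ := ℂ) (A := Cn d →L[ℂ] ℂ) _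
        · simp
      rw [h3, ← Finset.sum_add_distrib]
      exact Finset.sum_congr rfl fun l _ => (add_smul (M := Cn d →L[ℂ] ℂ) _ _ _).symm
    have h4 := Fintype.linearIndependent_iff.1 hflag.independent
      (fun l => MvPolynomial.coeff (Finsupp.single l 1) (σ k) -
        ((Pi.single k (lam k) : Fin s → ℂ) l + c k l)) (by
      have h5 := sub_eq_zero.2 h1
      rw [← Finset.sum_sub_distrib] at h5
      rw [← h5]
      exact Finset.sum_congr rfl fun l _ => sub_smul (M := Cn d →L[ℂ] ℂ) _ _ _)
    exact fun l => sub_eq_zero.1 (h4 l)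
  refine ⟨σ, ⟨fun k => norm_pos_iff.2 (h.lam_ne k), hlt, fun k => ?_, fun k => ?_,
    fun k l hkl => ?_, hres⟩, hσx⟩
  -- A constant term would be resonant with `lam k = λ^0 = 1`, against the contraction.
  · by_contra hne
    have h6 := hres k 0 hne
    simp only [powMonomial, Finsupp.coe_zero, Pi.zero_apply, pow_zero, Finset.prod_const_one] at h6
    have := hlt k
    rw [← h6, norm_one] at this
    exact lt_irrefl _ this
  · rw [hcoeff, Pi.single_eq_same, hc0 k k le_rfl, add_zero]
  · rw [hcoeff, Pi.single_eq_of_ne hkl.ne', hc0 k l hkl.le, add_zero]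

end PoincareDulac

/-! ### The monomial part -/

section MonomialCoordinates

variable {d q : ℕ} {f : Cn d → Cn d} {u : Fin q → Cn d → ℂ} {θ : ℝ} {V : Cn d → ℝ} {R C' : ℝ}

/-- The exponents of the components indexed by `Fin r`, the first `r` among `s` coordinates. -/
def Matrix.extendRows {r s p : ℕ} (hr : r ≤ s) (E : Matrix (Fin r) (Fin p) ℕ) :
    Matrix (Fin s) (Fin p) ℕ :=
  Matrix.of fun l j => ∑ i, if Fin.castLE hr i = l then E i j else 0

theorem matPow_extendRows {r s p : ℕ} (hr : r ≤ s) (E : Matrix (Fin r) (Fin p) ℕ) (x : Cn s)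
    (j : Fin p) : matPow x (E.extendRows hr) j = ∏ i, x (Fin.castLE hr i) ^ E i j := by
  simp only [matPow, Matrix.extendRows, Matrix.of_apply, ← Finset.prod_pow_eq_pow_sum]
  rw [Finset.prod_comm]
  refine Finset.prod_congr rfl fun i _ => ?_
  rw [Finset.prod_eq_single (Fin.castLE hr i)]
  · simp
  · intro l _ hl
    simp [hl.symm]
  · simp

/-- The components of the critical set that are not fixed, corrected by units, satisfy the monomial
equations of the normal form. -/
theorem IsSNC.exists_monomial_coordinates (hu : IsSNC (genCrit f) u) (hL : IsLyapunov f θ V R C')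
    {hf : AnalyticAt ℂ f 0} {h0 : f 0 = 0} (hinj : IsInjectiveAction (internalAction f u))
    {r p s : ℕ} {e : Fin r ⊕ Fin p ≃ Fin q}
    (he : ∀ i, (internalAction f u).mulVec (Pi.single (e (Sum.inl i)) 1) =
      Pi.single (e (Sum.inl i)) 1) (hr : r ≤ s) {x : Fin s → An d} {lam : Cn s}
    {κ : Type} [Fintype κ] {w : κ → An d} (h : IsAdapted (An.pullback f hf h0) lam x w)
    (hx : ∀ i, ∃ φ ∈ An.vanishing d 1,
      x (Fin.castLE hr i) = An.mulExp (hu.component (e (Sum.inl i))) φ) :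
    ∃ (β : Cn p) (φ : Fin p → An d) (g : Fin p → MvPolynomial (Fin s) ℂ),
      (∀ k, β k ≠ 0) ∧ (∀ k, φ k ∈ An.vanishing d 1) ∧
      (∀ k n, MvPolynomial.coeff n (g k) ≠ 0 →
        IsSecondaryResonant lam (internalAction f u) n) ∧
      ∀ k, ∀ᶠ z in 𝓝 (0 : Cn d),
        (An.mulExp (hu.component (e (Sum.inr k))) (φ k) : Cn d → ℂ) (f z) =
          β k * matPow (fun l => (x l : Cn d → ℂ) z) (((internalAction f u).submatrix
            (e ∘ Sum.inl) (e ∘ Sum.inr)).extendRows hr) k *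
          matPow (fun j => (An.mulExp (hu.component (e (Sum.inr j))) (φ j) : Cn d → ℂ) z)
            ((internalAction f u).submatrix (e ∘ Sum.inr) (e ∘ Sum.inr)) k *
          (1 + polyMap g (fun l => (x l : Cn d → ℂ) z) k) := by
  set A := internalAction f u with hA
  have hw : ∀ k : Fin p, ∃ w : An d, (w : Cn d → ℂ) 0 ≠ 0 ∧
      An.pullback f hf h0 (hu.component (e (Sum.inr k))) -
        (∏ l, hu.component l ^ A l (e (Sum.inr k))) * w ∈ An.flat d := fun k =>
    hu.exists_pullback_eq hf h0 (e (Sum.inr k))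
  choose w hw hfac using hw
  choose ψ₀ hψ₀ hwψ using fun k => An.exists_eq_mul_exp (hw k)
  choose φF hφF hxF using hx
  -- The fixed factors `u^l` are rewritten as `x^l e^{-φF}`, which shifts the logarithm of the unit
  -- by these terms.
  let ψ : Fin p → An d := fun k => ψ₀ k - ∑ i, (A (e (Sum.inl i)) (e (Sum.inr k)) : ℂ) • φF i
  have hψ : ∀ k, ψ k ∈ An.vanishing d 1 := fun k =>
    Submodule.sub_mem _ (hψ₀ k) (Submodule.sum_mem _ fun i _ => Submodule.smul_mem _ _ (hφF i))
  obtain ⟨φ, hφ, g, hg, hnorm⟩ := h.exists_normalization hL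
    -- The transpose appears because `y^D` has `k`-th exponent vector the `k`-th column of `D`: its
    -- logarithm contributes `∑ j, D j k • φ j`.
    ((A.submatrix (e ∘ Sum.inr) (e ∘ Sum.inr)).map (Nat.cast : ℕ → ℂ)).transpose
    (charpoly_block_eval_zero hinj he) ψ hψ
  choose hgx hnorm using hnorm
  refine ⟨fun k => (w k : Cn d → ℂ) 0, φ, g, hw, hφ, fun k n hn => ?_, fun k => ?_⟩
  · have h1 := ((MvPolynomial.mem_restrictSupport_iff ℂ).1 (hg k))
      (MvPolynomial.mem_support_iff.2 hn)
    exact ⟨h1.1, hasEigenvalue_of_block he h1.2⟩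
  · have hne : ∀ᶠ z in 𝓝 (0 : Cn d), 1 + (MvPolynomial.aeval x (g k) : Cn d → ℂ) z ≠ 0 := by
      refine ContinuousAt.eventually_ne (continuousAt_const.add
        (An.analyticAt (MvPolynomial.aeval x (g k))).continuousAt) ?_
      rw [An.mem_vanishing_one.1 (hgx k)]
      simp
    filter_upwards [hfac k, hwψ k, hnorm k, hne] with z h1 h2 h3 h4
    rw [matPow_extendRows]
    simp only [matPow, polyMap, An.mulExp_apply, ← An.aeval_apply, Matrix.submatrix_apply,
      Function.comp_apply, hxF, mul_pow, Finset.prod_mul_distrib, ← Complex.exp_nat_mul,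
      ← Complex.exp_sum]
    have h5 : (hu.component (e (Sum.inr k)) : Cn d → ℂ) (f z) =
        (∏ i, (hu.component (e (Sum.inl i)) : Cn d → ℂ) z ^ A (e (Sum.inl i)) (e (Sum.inr k))) *
        (∏ j, (hu.component (e (Sum.inr j)) : Cn d → ℂ) z ^ A (e (Sum.inr j)) (e (Sum.inr k))) *
        (w k : Cn d → ℂ) z := by
      have h6 := sub_eq_zero.1 h1
      rw [← Fintype.prod_sum_type
        (fun l => (hu.component (e l) : Cn d → ℂ) z ^ A (e l) (e (Sum.inr k))),
        e.prod_comp fun l => (hu.component l : Cn d → ℂ) z ^ A l (e (Sum.inr k))]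
      refine h6.trans ?_
      simp
    have h7 : Complex.exp ((ψ₀ k : Cn d → ℂ) z -
        ∑ i, (A (e (Sum.inl i)) (e (Sum.inr k)) : ℂ) * (φF i : Cn d → ℂ) z +
        (φ k : Cn d → ℂ) (f z) -
        ∑ j, (A (e (Sum.inr j)) (e (Sum.inr k)) : ℂ) * (φ j : Cn d → ℂ) z) =
        1 + (MvPolynomial.aeval x (g k) : Cn d → ℂ) z := by
      rw [← Complex.exp_log h4, ← An.logOneAdd_apply (hgx k)]
      congr 1
      rw [← sub_eq_zero, ← h3]
      simp [ψ, An.pullback_apply]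
    rw [h5, h2, ← h7, Complex.exp_sub, Complex.exp_add, Complex.exp_sub]
    field_simp

end MonomialCoordinates

end

/-! ### Assembly of the normal form -/

theorem IsLocalBiholomorphism.continuousLinearEquiv_comp {E F G : Type} [NormedAddCommGroup E]
    [NormedSpace ℂ E] [NormedAddCommGroup F] [NormedSpace ℂ F] [NormedAddCommGroup G]
    [NormedSpace ℂ G] {Φ : E → F} (h : IsLocalBiholomorphism Φ) (Λ : F ≃L[ℂ] G) :
    IsLocalBiholomorphism fun x => Λ (Φ x) := by
  obtain ⟨L, hL⟩ := h.invertible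
  exact ⟨((Λ : F →L[ℂ] G).analyticAt _).comp h.analytic, (congrArg Λ h.map_zero).trans Λ.map_zero,
    L.trans Λ, (Λ : F →L[ℂ] G).hasFDerivAt.comp 0 hL⟩

theorem differentiable_polyMap {s p : ℕ} (P : Fin p → MvPolynomial (Fin s) ℂ) :
    Differentiable ℂ (polyMap P) :=
  differentiable_pi.2 fun k x => (AnalyticOnNhd.eval_mvPolynomial (P k) x trivial).differentiableAt

/-- The germ `v ∘ f` has zero differential if the transpose of `df₀` kills that of `v`. -/
theorem An.hasFDerivAt_comp_zero {d p : ℕ} {f : Cn d → Cn d} (hf : AnalyticAt ℂ f 0)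
    (h0 : f 0 = 0) {v : Fin p → An d}
    (hv : ∀ k, An.transpose (fderiv ℂ f 0) (An.differential d (v k)) = 0) :
    HasFDerivAt (fun z k => (v k : Cn d → ℂ) (f z)) (0 : Cn d →L[ℂ] Cn p) 0 := by
  rw [hasFDerivAt_pi']
  intro k
  have h1 := An.hasFDerivAt (An.pullback f hf h0 (v k))
  rw [An.differential_pullback, hv] at h1
  rw [ContinuousLinearMap.comp_zero]
  exact h1

theorem theorem1 (d : ℕ) (f : Cn d → Cn d) (hf : IsContractingGerm f)
    -- `f` is rigid, with components `W^k = {u k = 0}` of the generalized critical set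
    (q : ℕ) (u : Fin q → Cn d → ℂ) (hrigid : IsSNC (genCrit f) u)
    (hinj : IsInjectiveAction (internalAction f u))
    (hfix : PeriodicComponentsFixed (internalAction f u))
    (hnil : NilpotentPartVanishes (fderiv ℂ f 0)) :
    ∃ (s p m : ℕ) (Φ : Cn d → Cn s × Cn p × Cn m)
      (lam : Cn s) (σ : Fin s → MvPolynomial (Fin s) ℂ) (β : Cn p)
      (E : Matrix (Fin s) (Fin p) ℕ) (D : Matrix (Fin p) (Fin p) ℕ)
      (g : Fin p → MvPolynomial (Fin s) ℂ) (h : Cn s × Cn p × Cn m → Cn m),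
      s + p + m = d ∧
      -- `Φ` conjugates `f` to the normal form
      IsLocalBiholomorphism Φ ∧
      (∀ᶠ x in 𝓝 (0 : Cn d), Φ (f x) = normalForm σ β E D g h (Φ x)) ∧
      -- `lam` is the vector of non-zero eigenvalues of `df₀`, with multiplicities
      (fderiv ℂ f 0 : Cn d →ₗ[ℂ] Cn d).charpoly =
        Polynomial.X ^ (p + m) * ∏ k, (Polynomial.X - Polynomial.C (lam k)) ∧
      IsPoincareDulac lam σ ∧
      (∀ k, β k ≠ 0) ∧
      (D.map (Nat.cast : ℕ → ℤ)).det ≠ 0 ∧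
      -- the differential of the normal form is `dσ₀ ⊕ 0`
      (∀ w : Cn s × Cn p × Cn m, fderiv ℂ (normalForm σ β E D g h) 0 w =
        (fderiv ℂ (polyMap σ) 0 w.1, 0, 0)) ∧
      -- `{y^1 = 0} ⊆ genCrit f ⊆ {x^1 y^1 = 0}` in the coordinates `(x, y, z) = Φ`
      (∀ᶠ x in 𝓝 (0 : Cn d),
        ((∃ k, (Φ x).2.1 k = 0) → x ∈ genCrit f) ∧
        (x ∈ genCrit f → (∃ l, (Φ x).1 l = 0) ∨ ∃ k, (Φ x).2.1 k = 0)) ∧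
      -- `g` contains only secondary resonant monomials (in particular no constant term)
      (∀ k n, MvPolynomial.coeff n (g k) ≠ 0 →
        IsSecondaryResonant lam (internalAction f u) n) ∧
      AnalyticAt ℂ h 0 ∧ h 0 = 0 ∧ fderiv ℂ h 0 = 0 := by
  obtain ⟨θ, V, R, C', hL⟩ := hf.exists_lyapunov
  have hfa := hf.analytic
  have h0 := hf.map_zero
  obtain ⟨r, p, e, he, he'⟩ := exists_sum_equiv_of_predicate fun k =>
    (internalAction f u).mulVec (Pi.single k 1) = Pi.single k 1
  obtain ⟨s, m, hr, x, lam, ζ, hadapt, hflag, hxF, hζ, huN, hind, hspan⟩ :=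
    hrigid.exists_adapted hL hfa h0 hinj hfix hnil he he'
  have hchar : (fderiv ℂ f 0 : Cn d →ₗ[ℂ] Cn d).charpoly =
      Polynomial.X ^ (p + m) * ∏ k, (Polynomial.X - Polynomial.C (lam k)) := by
    have h1 : ∀ j : Fin p ⊕ Fin m, An.transpose (fderiv ℂ f 0) (Sum.elim (fun j =>
        An.differential d (hrigid.component (e (Sum.inr j)))) ζ j) = 0 := by
      rintro (j | j)
      · exact huN j
      · exact hζ j
    have h2 := charpoly_of_dual_basis hind hspan hflag h1
    rwa [Fintype.card_sum, Fintype.card_fin, Fintype.card_fin] at h2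
  have hlt : ∀ k, ‖lam k‖ < 1 := by
    intro k
    refine hf.eigenvalue_lt _ ?_
    rw [Module.End.hasEigenvalue_iff_isRoot_charpoly, hchar, Polynomial.IsRoot,
      Polynomial.eval_mul, Polynomial.eval_prod,
      Finset.prod_eq_zero (Finset.mem_univ k) (by simp), mul_zero]
  obtain ⟨σ, hσ, hσx⟩ := hadapt.exists_poincareDulac hL hlt hflag
  obtain ⟨β, φ, g, hβ, hφ, hg, hy⟩ :=
    hrigid.exists_monomial_coordinates hL hinj he hr hadapt hxF
  set E := ((internalAction f u).submatrix (e ∘ Sum.inl) (e ∘ Sum.inr)).extendRows hr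
  set D := (internalAction f u).submatrix (e ∘ Sum.inr) (e ∘ Sum.inr)
  set y : Fin p → An d := fun k => An.mulExp (hrigid.component (e (Sum.inr k))) (φ k) with hydef
  have hdy : ∀ k, An.differential d (y k) =
      An.differential d (hrigid.component (e (Sum.inr k))) := fun k =>
    An.differential_mulExp (hrigid.component_mem _) (hφ k)
  let z : Fin m → An d := fun j => An.ofCovector (ζ j)
  let Φ : Cn d → Cn s × Cn p × Cn m := fun t =>
    (fun l => (x l : Cn d → ℂ) t, fun k => (y k : Cn d → ℂ) t, fun j => (z j : Cn d → ℂ) t)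
  have hcard : s + p + m = d := by
    obtain ⟨L, -⟩ := exists_continuousLinearEquiv_of_dual_basis hind hspan
    have h1 := L.toLinearEquiv.finrank_eq
    simp only [Module.finrank_fintype_fun_eq_card, Fintype.card_fin, Fintype.card_sum] at h1
    omega
  have hΦ : IsLocalBiholomorphism Φ := by
    have hd : (fun i => An.differential d (Sum.elim x (Sum.elim y z) i)) =
        Sum.elim (fun k => An.differential d (x k)) (Sum.elim (fun j =>
          An.differential d (hrigid.component (e (Sum.inr j)))) ζ) := by
      funext i
      rcases i with k | j | j
      · rfl
      · exact hdy j
      · exact An.differential_ofCovector _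
    have h1 : IsLocalBiholomorphism fun t i =>
        ((Sum.elim x (Sum.elim y z) i : An d) : Cn d → ℂ) t := by
      refine An.isLocalBiholomorphism_of_differential ?_ (by rwa [hd]) (by rwa [hd])
      rintro (k | j | j)
      · exact hadapt.mem_vanishing (Sum.inl k)
      · exact An.mulExp_mem (hrigid.component_mem _) _
      · exact An.ofCovector_mem _
    exact h1.continuousLinearEquiv_comp
      ((LinearEquiv.sumArrowLequivProdArrow (Fin s) (Fin p ⊕ Fin m) ℂ ℂ).trans
        (LinearEquiv.prodCongr (LinearEquiv.refl ℂ (Cn s))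
          (LinearEquiv.sumArrowLequivProdArrow (Fin p) (Fin m) ℂ ℂ))).toContinuousLinearEquiv
  obtain ⟨Ψ, hΨ, hΨΦ, hΦΨ⟩ := hΦ.exists_inverse
  -- The last component is whatever conjugation by `Φ` produces; its differential vanishes because
  -- the `ζ j` are killed by the transpose of `df₀`.
  let h : Cn s × Cn p × Cn m → Cn m := fun w j => (z j : Cn d → ℂ) (f (Ψ w))
  have hΨd : HasFDerivAt Ψ (fderiv ℂ Ψ 0) 0 := hΨ.analytic.differentiableAt.hasFDerivAt
  have hΨt : Tendsto Ψ (𝓝 0) (𝓝 0) := An.tendsto_of_isLocalBiholomorphism hΨ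
  have hcomp : ∀ {n : ℕ} {v : Fin n → An d},
      (∀ k, An.transpose (fderiv ℂ f 0) (An.differential d (v k)) = 0) →
      HasFDerivAt (fun w k => (v k : Cn d → ℂ) (f (Ψ w)))
        (0 : Cn s × Cn p × Cn m →L[ℂ] Cn n) 0 := by
    intro n v hv
    have h1 := An.hasFDerivAt_comp_zero hfa h0 hv
    rw [← hΨ.map_zero] at h1
    have h2 := h1.comp (0 : Cn s × Cn p × Cn m) hΨd
    rwa [ContinuousLinearMap.zero_comp] at h2
  have hh : HasFDerivAt h 0 0 := hcomp fun j => by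
    rw [An.differential_ofCovector]
    exact hζ j
  have hyall := eventually_all.2 hy
  have hσall := eventually_all.2 hσx
  refine ⟨s, p, m, Φ, lam, σ, β, E, D, g, h, hcard, hΦ, ?_, hchar, hσ, hβ,
    det_block_ne_zero hinj he, ?_, ?_, hg, ?_, ?_, hh.fderiv⟩
  · filter_upwards [hyall, hσall, hΨΦ] with t h1 h2 h3
    refine Prod.ext (funext fun k => ?_) (Prod.ext (funext fun k => h1 k) (funext fun j => ?_))
    · exact (sub_eq_zero.1 (h2 k)).trans (An.aeval_apply x (σ k) t)
    · change (z j : Cn d → ℂ) (f t) = (z j : Cn d → ℂ) (f (Ψ (Φ t)))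
      rw [h3]
  · intro w
    have h1 : HasFDerivAt (fun w : Cn s × Cn p × Cn m => polyMap σ w.1)
        ((fderiv ℂ (polyMap σ) 0).comp (ContinuousLinearMap.fst ℂ (Cn s) (Cn p × Cn m))) 0 :=
      HasFDerivAt.comp (g := polyMap σ) (f := Prod.fst) (0 : Cn s × Cn p × Cn m)
        (differentiable_polyMap σ (0 : Cn s)).hasFDerivAt
        (ContinuousLinearMap.fst ℂ (Cn s) (Cn p × Cn m)).hasFDerivAt
    -- Near `0` the middle component equals `y ∘ f ∘ Ψ`, so its differential is zero because `dy` is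
    -- killed by the transpose of `df₀`; the exponents need not be inspected.
    have h2 : HasFDerivAt (fun w : Cn s × Cn p × Cn m => (normalForm σ β E D g h w).2.1)
        (0 : Cn s × Cn p × Cn m →L[ℂ] Cn p) 0 := by
      refine HasFDerivAt.congr_of_eventuallyEq (hcomp (v := y) fun k => by rw [hdy]; exact huN k) ?_
      filter_upwards [hΨt.eventually hyall, hΦΨ] with w h3 h4
      funext k
      refine Eq.trans ?_ (h3 k).symm
      change (normalForm σ β E D g h w).2.1 k = (normalForm σ β E D g h (Φ (Ψ w))).2.1 k
      rw [h4]
    have h3 : HasFDerivAt (normalForm σ β E D g h)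
        (((fderiv ℂ (polyMap σ) 0).comp (ContinuousLinearMap.fst ℂ (Cn s) (Cn p × Cn m))).prod
          ((0 : Cn s × Cn p × Cn m →L[ℂ] Cn p).prod 0)) 0 := h1.prodMk (h2.prodMk hh)
    rw [h3.fderiv]
    rfl
  · filter_upwards [hrigid.locus] with t ht
    refine ⟨?_, fun hcrit => ?_⟩
    · rintro ⟨k, hk⟩
      exact ht.2 ⟨_, (mul_eq_zero.1 hk).resolve_right (Complex.exp_ne_zero _)⟩
    · obtain ⟨k, hk⟩ := ht.1 hcrit
      obtain ⟨i | j, rfl⟩ := e.surjective k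
      · left
        obtain ⟨φ', -, hφ'⟩ := hxF i
        refine ⟨Fin.castLE hr i, ?_⟩
        change (x (Fin.castLE hr i) : Cn d → ℂ) t = 0
        rw [hφ', An.mulExp_apply]
        exact mul_eq_zero_of_left hk _
      · exact Or.inr ⟨j, mul_eq_zero_of_left hk _⟩
  · refine AnalyticAt.pi fun j => ?_
    have h1 : AnalyticAt ℂ (An.pullback f hfa h0 (z j) : Cn d → ℂ) (Ψ 0) := by
      rw [hΨ.map_zero]
      exact An.analyticAt _
    exact h1.comp hΨ.analytic
  · funext j
    change ζ j (f (Ψ 0)) = 0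
    rw [hΨ.map_zero, h0, map_zero]
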